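/- Let $n\ge 3$ and $m\ge 1$ be integers, let $\tau,c>0$ and $b\in\mathbb R$, and let $g:(0,\infty)\to\mathbb R$ be a memory kernel such that: $g\in W^{1,1}(0,\infty)$ and $g'$ is locally absolutely continuous on $(0,\infty)$; $g\ge 0$ and $0<\int_0^\infty g(s)\,ds<c^2$; there is $\zeta>0$ with $g'(s)\le-\zeta g(s)$ for all $s>0$; and $g''\ge 0$ almost everywhere. Put $c_g^2=c^2-\int_0^\infty g(s)\,ds$ and assume $b\ge\tau c^2>\tau c_g^2$. All functions are real valued. Let $X^m=\{\psi\in L^{2n/(n-2)}(\mathbb R^n):\nabla\psi,\dots,\nabla^m\psi\in L^2(\mathbb R^n)\}$ (weak derivatives) with norm $\|\nabla\psi\|_{H^{m-1}}$, and let $\mathcal M^m=L^2\big((0,\infty),-g'(s)\,ds;X^m\big)$, i.e. $\|\eta\|_{\mathcal M^m}^2=\int_0^\infty -g'(s)\,\|\nabla\eta(s)\|_{H^{m-1}}^2\,ds$. Let $$\mathcal H^{m-1}=X^m\times H^m(\mathbb R^n)\times H^{m-1}(\mathbb R^n)\times\mathcal M^m,$$ $$\|(\psi,v,w,\eta)\|^2=\|\nabla\psi\|_{H^{m-1}}^2+\|v\|_{H^m}^2+\|w\|_{H^{m-1}}^2+\|\eta\|_{\mathcal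 M^m}^2 .$$ Let $\mathcal A$ be the operator $$\mathcal A(\psi,v,w,\eta)=\Big(v,\ w,\ -\tfrac1\tau w+\tfrac{c_g^2}{\tau}\Delta\psi+\tfrac b\tau\Delta v+\tfrac1\tau\int_0^\infty g(s)\Delta\eta(s)\,ds,\ v-\eta_s\Big)$$ whose domain $D(\mathcal A)$ consists of all $(\psi,v,w,\eta)\in\mathcal H^{m-1}$ such that $w\in H^m(\mathbb R^n)$, $\tfrac{c_g^2}{\tau}\Delta\psi+\tfrac b\tau\Delta v+\tfrac1\tau\int_0^\infty g(s)\Delta\eta(s)\,ds\in H^{m-1}(\mathbb R^n)$ (Laplacians in the sense of distributions), $\eta_s\in\mathcal M^m$ and $\eta(s=0)=0$. Then $\mathcal H^{m-1}$ is a Hilbert space and $\mathcal A$, with domain $D(\mathcal A)$, is the infinitesimal generator of a $C_0$-semigroup of bounded linear operators $S(t)=e^{t\mathcal A}:\mathcal H^{m-1}\to\mathcal H^{m-1}$, $t\ge0$. -/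

import Mathlib

open MeasureTheory Filter Topology Set
open scoped ContDiff NNReal ENNReal

noncomputable section

namespace MGT

/-! ## Strongly continuous semigroups and their generators -/

/-- A `C₀`-semigroup of bounded linear operators on a real normed space. -/
structure C0Semigroup (X : Type*) [NormedAddCommGroup X] [NormedSpace ℝ X] where
  /-- the operator at time `t` -/
  op : ℝ≥0 → X →L[ℝ] X
  op_zero : op 0 = ContinuousLinearMap.id ℝ X
  op_add : ∀ s t : ℝ≥0, op (s + t) = (op s).comp (op t)
  tendsto_zero : ∀ x : X, Tendsto (fun t : ℝ≥0 => op t x) (𝓝 0) (𝓝 x)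

/-- `(S(t)x - x) / t → y` as `t ↓ 0`. -/
def C0Semigroup.HasDerivZero {X : Type*} [NormedAddCommGroup X] [NormedSpace ℝ X]
    (S : C0Semigroup X) (x y : X) : Prop :=
  Tendsto (fun t : ℝ≥0 => (t : ℝ)⁻¹ • (S.op t x - x)) (𝓝[>] 0) (𝓝 y)

/-- The operator with domain `D` and graph `{(x, y) | x ∈ D, A x y}` is the infinitesimal generator
of `S`: the domain is the set of all `x` at which the orbit has a right derivative at `0`, and
`A x y` (read `y = A x`) says that `y` is this derivative. -/
def C0Semigroup.IsGenerator {X : Type*} [NormedAddCommGroup X] [NormedSpace ℝ X]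
    (S : C0Semigroup X) (D : Set X) (A : X → X → Prop) : Prop :=
  (∀ x, x ∈ D ↔ ∃ y, S.HasDerivZero x y) ∧ ∀ x ∈ D, ∀ y, A x y ↔ S.HasDerivZero x y

/-! ## Weak derivatives and Sobolev spaces on `ℝⁿ` -/

/-- Euclidean space `ℝⁿ`. -/
abbrev E (n : ℕ) := EuclideanSpace ℝ (Fin n)

/-- Real `L²(ℝⁿ)`. -/
abbrev L2 (n : ℕ) := Lp ℝ 2 (volume : Measure (E n))

/-- The classical partial derivative `∂_{α₁} ⋯ ∂_{α_k} φ`. -/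
def partialD {n k : ℕ} (α : Fin k → Fin n) (φ : E n → ℝ) (x : E n) : ℝ :=
  iteratedFDeriv ℝ k φ x (fun i => EuclideanSpace.single (α i) 1)

/-- `f` is the weak derivative `∂_{α₁} ⋯ ∂_{α_k} u`. -/
structure HasWeakDeriv {n k : ℕ} (α : Fin k → Fin n) (u f : E n → ℝ) : Prop where
  locInt_fun : LocallyIntegrable u
  locInt_deriv : LocallyIntegrable f
  integral_eq : ∀ φ : E n → ℝ, ContDiff ℝ ∞ φ → HasCompactSupport φ →
    ∫ x, u x * partialD α φ x = (-1) ^ k * ∫ x, f x * φ x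

theorem continuous_partialD {n k : ℕ} (α : Fin k → Fin n) {φ : E n → ℝ} (h : ContDiff ℝ ∞ φ) :
    Continuous (partialD α φ) := by
  have := h.continuous_iteratedFDeriv (m := k) (by exact_mod_cast le_top)
  unfold partialD
  fun_prop

theorem hasCompactSupport_partialD {n k : ℕ} (α : Fin k → Fin n) {φ : E n → ℝ}
    (h : HasCompactSupport φ) : HasCompactSupport (partialD α φ) := by
  refine (h.iteratedFDeriv (𝕜 := ℝ) k).mono fun x hx => ?_
  simp only [Function.mem_support, partialD] at hx ⊢
  rintro h0
  exact hx (by rw [h0]; rfl)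

theorem integrable_mul_test {n : ℕ} {u χ : E n → ℝ} (hu : LocallyIntegrable u)
    (hχ : Continuous χ) (hc : HasCompactSupport χ) : Integrable (fun x => u x * χ x) := by
  simpa using hu.integrable_smul_right_of_hasCompactSupport hχ hc

theorem HasWeakDeriv.zero {n k : ℕ} (α : Fin k → Fin n) :
    HasWeakDeriv α (0 : E n → ℝ) 0 :=
  ⟨locallyIntegrable_zero, locallyIntegrable_zero, fun φ _ _ => by simp⟩

theorem HasWeakDeriv.add {n k : ℕ} {α : Fin k → Fin n} {u f u' f' : E n → ℝ}
    (h : HasWeakDeriv α u f) (h' : HasWeakDeriv α u' f') : HasWeakDeriv α (u + u') (f + f') := by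
  refine ⟨h.1.add h'.1, h.2.add h'.2, fun φ hφ hc => ?_⟩
  have c1 := continuous_partialD α hφ
  have c2 := hasCompactSupport_partialD α hc
  simp only [Pi.add_apply, add_mul]
  rw [integral_add (integrable_mul_test h.1 c1 c2) (integrable_mul_test h'.1 c1 c2),
    integral_add (integrable_mul_test h.2 hφ.continuous hc)
      (integrable_mul_test h'.2 hφ.continuous hc), h.3 φ hφ hc, h'.3 φ hφ hc, mul_add]

theorem HasWeakDeriv.smul {n k : ℕ} {α : Fin k → Fin n} {u f : E n → ℝ} (r : ℝ)
    (h : HasWeakDeriv α u f) : HasWeakDeriv α (r • u) (r • f) := by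
  refine ⟨h.1.smul r, h.2.smul r, fun φ hφ hc => ?_⟩
  simp only [Pi.smul_apply, smul_eq_mul, mul_assoc]
  rw [integral_const_mul, integral_const_mul, h.3 φ hφ hc]
  ring

theorem HasWeakDeriv.congr {n k : ℕ} {α : Fin k → Fin n} {u f u' f' : E n → ℝ}
    (h : HasWeakDeriv α u f) (hu : u =ᵐ[volume] u') (hf : f =ᵐ[volume] f') :
    HasWeakDeriv α u' f' := by
  refine ⟨h.1.congr hu, h.2.congr hf, fun φ hφ hc => ?_⟩
  rw [← integral_congr_ae (hu.mono fun x hx => by simp only [hx]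
      : (fun x => u x * partialD α φ x) =ᵐ[volume] fun x => u' x * partialD α φ x),
    ← integral_congr_ae (hf.mono fun x hx => by simp only [hx]
      : (fun x => f x * φ x) =ᵐ[volume] fun x => f' x * φ x), h.3 φ hφ hc]

/-- Indices of all iterated partial derivatives of orders `0, …, m`. -/
abbrev Word (n m : ℕ) := Σ k : Fin (m + 1), (Fin (k : ℕ) → Fin n)

/-- Indices of all iterated partial derivatives of orders `1, …, m`. -/
abbrev HomWord (n m : ℕ) := Σ k : Fin m, (Fin ((k : ℕ) + 1) → Fin n)

/-- The empty word, index of the function itself. -/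
def Word.nil (n m : ℕ) : Word n m := ⟨⟨0, Nat.succ_pos m⟩, Fin.elim0⟩

/-- The index of `∂_j`. -/
def Word.single {n : ℕ} (p : ℕ) (j : Fin n) : Word n (p + 1) :=
  ⟨⟨1, Nat.succ_lt_succ (Nat.succ_pos p)⟩, fun _ => j⟩

/-- The index of `∂_j`. -/
def HomWord.single {n : ℕ} (p : ℕ) (j : Fin n) : HomWord n (p + 1) :=
  ⟨⟨0, Nat.succ_pos p⟩, fun _ => j⟩

/-- Families `(u_α)` in `L²(ℝⁿ)`, `α` of length at most `m`, in which `u_α` is the weak derivative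
`∂_α` of the member `u` with empty index. -/
def sobSubmodule (n m : ℕ) : Submodule ℝ (PiLp 2 (fun _ : Word n m => L2 n)) where
  carrier := {U | ∀ α : Word n m, HasWeakDeriv α.2 (U (Word.nil n m)) (U α)}
  zero_mem' := fun α => (HasWeakDeriv.zero α.2).congr
    (Lp.coeFn_zero _ _ _).symm (Lp.coeFn_zero _ _ _).symm
  add_mem' := fun hU hV α => ((hU α).add (hV α)).congr
    (Lp.coeFn_add _ _).symm (Lp.coeFn_add _ _).symm
  smul_mem' := fun r _ hU α => ((hU α).smul r).congr
    (Lp.coeFn_smul _ _).symm (Lp.coeFn_smul _ _).symm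

/-- The Sobolev space `H^m(ℝⁿ)`. A function `u ∈ L²` is stored together with all its (unique) weak
derivatives of order at most `m`, all in `L²`; the norm is `‖u‖² = ∑_{k ≤ m} ‖∇^k u‖²`, the inner
product the corresponding one. -/
def Sob (n m : ℕ) : Type := sobSubmodule n m

instance (n m : ℕ) : NormedAddCommGroup (Sob n m) :=
  inferInstanceAs (NormedAddCommGroup (sobSubmodule n m))

instance (n m : ℕ) : InnerProductSpace ℝ (Sob n m) :=
  inferInstanceAs (InnerProductSpace ℝ (sobSubmodule n m))

/-- The weak derivative `∂_α u` of `u ∈ H^m`. -/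
def Sob.d {n m : ℕ} (u : Sob n m) (α : Word n m) : L2 n := u.1 α

/-- The underlying `L²` function of an element of `H^m`. -/
def Sob.fn {n m : ℕ} (u : Sob n m) : L2 n := u.d (Word.nil n m)

/-- The function `ψ ∈ L^{2n/(n-2)}` has the family `U` as its weak derivatives of orders
`1, …, m`. -/
def IsPotential {n m : ℕ} (U : PiLp 2 (fun _ : HomWord n m => L2 n)) (ψ : E n → ℝ) : Prop :=
  MemLp ψ (ENNReal.ofReal (2 * n / ((n : ℝ) - 2))) ∧ ∀ α : HomWord n m, HasWeakDeriv α.2 ψ (U α)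

/-- Families in `L²(ℝⁿ)` that are the weak derivatives of orders `1, …, m` of one function
`ψ ∈ L^{2n/(n-2)}(ℝⁿ)`. -/
def homSobSubmodule (n m : ℕ) : Submodule ℝ (PiLp 2 (fun _ : HomWord n m => L2 n)) where
  carrier := {U | ∃ ψ : E n → ℝ, IsPotential U ψ}
  zero_mem' := ⟨0, MemLp.zero, fun α => (HasWeakDeriv.zero α.2).congr
    (EventuallyEq.refl _ _) (Lp.coeFn_zero _ _ _).symm⟩
  add_mem' := by
    rintro U V ⟨ψ, h1, h2⟩ ⟨χ, h3, h4⟩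
    exact ⟨ψ + χ, h1.add h3, fun α => ((h2 α).add (h4 α)).congr
      (EventuallyEq.refl _ _) (Lp.coeFn_add _ _).symm⟩
  smul_mem' := by
    rintro r U ⟨ψ, h1, h2⟩
    exact ⟨r • ψ, h1.const_smul r, fun α => ((h2 α).smul r).congr
      (EventuallyEq.refl _ _) (Lp.coeFn_smul _ _).symm⟩

/-- The space `{ψ : ∇ψ, …, ∇^m ψ ∈ L²(ℝⁿ)}` with the norm `‖∇ψ‖_{H^{m-1}}`, for `n ≥ 3`, `m ≥ 1`.
The norm vanishes on constants; as usual for `n ≥ 3` each class modulo constants is represented by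
its unique member `ψ` in `L^{2n/(n-2)}`. An element is stored as the family of the weak derivatives
of orders `1, …, m` of such a `ψ`; this family determines `ψ`. -/
def HomSob (n m : ℕ) : Type := homSobSubmodule n m

instance (n m : ℕ) : NormedAddCommGroup (HomSob n m) :=
  inferInstanceAs (NormedAddCommGroup (homSobSubmodule n m))

instance (n m : ℕ) : InnerProductSpace ℝ (HomSob n m) :=
  inferInstanceAs (InnerProductSpace ℝ (homSobSubmodule n m))

/-- The weak derivative `∂_α ψ`, of order between `1` and `m`. -/
def HomSob.d {n m : ℕ} (U : HomSob n m) (α : HomWord n m) : L2 n := U.1 α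

/-! ## The memory kernel, the history space and the state space -/

/-- Assumptions on the relaxation kernel: `g ∈ W^{1,1}(0,∞)` with `g'` (locally) absolutely
continuous on `(0,∞)`; `g ≥ 0` and `0 < ∫ g < c²`; `g' ≤ -ζ g` for some `ζ > 0`; and `g'' ≥ 0`
almost everywhere. -/
structure IsMemoryKernel (c : ℝ) (g : ℝ → ℝ) : Prop where
  integrable : IntegrableOn g (Ioi 0)
  differentiable : ∀ s > 0, DifferentiableAt ℝ g s
  deriv_integrable : IntegrableOn (deriv g) (Ioi 0)
  deriv_ac : ∀ s₁ s₂ : ℝ, 0 < s₁ → s₁ ≤ s₂ → AbsolutelyContinuousOnInterval (deriv g) s₁ s₂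
  nonneg : ∀ s > 0, 0 ≤ g s
  integral_pos : 0 < ∫ s in Ioi (0 : ℝ), g s
  integral_lt : ∫ s in Ioi (0 : ℝ), g s < c ^ 2
  decay : ∃ ζ > 0, ∀ s > 0, deriv g s ≤ -ζ * g s
  deriv2_nonneg : ∀ᵐ s ∂(volume.restrict (Ioi (0 : ℝ))), 0 ≤ deriv (deriv g) s

/-- The modified squared speed `c_g² = c² - ∫₀^∞ g`. -/
def cgSq (c : ℝ) (g : ℝ → ℝ) : ℝ := c ^ 2 - ∫ s in Ioi (0 : ℝ), g s

/-- The measure `-g'(s) ds` on `(0,∞)`. -/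
def histMeasure (g : ℝ → ℝ) : Measure ℝ :=
  (volume.restrict (Ioi 0)).withDensity fun s => ENNReal.ofReal (-deriv g s)

/-- `𝓜^m = {η : ∇η, …, ∇^m η ∈ L²_{-g'}((0,∞); L²(ℝⁿ))}` with norm
`‖η‖² = ∫₀^∞ -g'(s) ‖∇η(s)‖²_{H^{m-1}} ds`. -/
def Hist (n m : ℕ) (g : ℝ → ℝ) : Type := Lp (HomSob n m) 2 (histMeasure g)

instance (n m : ℕ) (g : ℝ → ℝ) : NormedAddCommGroup (Hist n m g) :=
  inferInstanceAs (NormedAddCommGroup (Lp (HomSob n m) 2 (histMeasure g)))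

instance (n m : ℕ) (g : ℝ → ℝ) : InnerProductSpace ℝ (Hist n m g) :=
  inferInstanceAs (InnerProductSpace ℝ (Lp (HomSob n m) 2 (histMeasure g)))

/-- A representative `s ↦ η(s)` of `η ∈ 𝓜^m`. -/
def Hist.rep {n m : ℕ} {g : ℝ → ℝ} (η : Hist n m g) : ℝ → HomSob n m :=
  (show Lp (HomSob n m) 2 (histMeasure g) from η : ℝ →ₘ[histMeasure g] HomSob n m)

/-- `𝓗^p`, for `p = m - 1 ≥ 0`: quadruples `((ψ, v), (w, η))` with `∇ψ, …, ∇^{p+1} ψ ∈ L²`,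
`v ∈ H^{p+1}`, `w ∈ H^p`, `η ∈ 𝓜^{p+1}`; the squared norm is the sum of the four squared norms. -/
def State (n p : ℕ) (g : ℝ → ℝ) : Type :=
  WithLp 2 (WithLp 2 (HomSob n (p + 1) × Sob n (p + 1)) × WithLp 2 (Sob n p × Hist n (p + 1) g))

instance (n p : ℕ) (g : ℝ → ℝ) : NormedAddCommGroup (State n p g) :=
  inferInstanceAs (NormedAddCommGroup
    (WithLp 2 (WithLp 2 (HomSob n (p + 1) × Sob n (p + 1)) ×
      WithLp 2 (Sob n p × Hist n (p + 1) g))))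

instance (n p : ℕ) (g : ℝ → ℝ) : InnerProductSpace ℝ (State n p g) :=
  inferInstanceAs (InnerProductSpace ℝ
    (WithLp 2 (WithLp 2 (HomSob n (p + 1) × Sob n (p + 1)) ×
      WithLp 2 (Sob n p × Hist n (p + 1) g))))

namespace State

variable {n p : ℕ} {g : ℝ → ℝ}

/-- first component -/
def psi (Ψ : State n p g) : HomSob n (p + 1) := (WithLp.ofLp (WithLp.ofLp Ψ).1).1

/-- second component -/
def v (Ψ : State n p g) : Sob n (p + 1) := (WithLp.ofLp (WithLp.ofLp Ψ).1).2

/-- third component -/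
def w (Ψ : State n p g) : Sob n p := (WithLp.ofLp (WithLp.ofLp Ψ).2).1

/-- fourth component -/
def eta (Ψ : State n p g) : Hist n (p + 1) g := (WithLp.ofLp (WithLp.ofLp Ψ).2).2

end State

/-! ## The operator -/

/-- `f = div F` in the sense of distributions. -/
def IsWeakDiv {n : ℕ} (F : Fin n → L2 n) (f : L2 n) : Prop :=
  ∀ φ : E n → ℝ, ContDiff ℝ ∞ φ → HasCompactSupport φ →
    ∫ x, f x * φ x = -∑ j, ∫ x, F j x * fderiv ℝ φ x (EuclideanSpace.single j 1)

/-- `∂_j` of `(c_g²/τ) ψ + (b/τ) v + (1/τ) ∫₀^∞ g(s) η(s) ds`. -/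
def flux {n p : ℕ} (τ b c : ℝ) (g : ℝ → ℝ) (Ψ : State n p g) (j : Fin n) : L2 n :=
  (cgSq c g / τ) • Ψ.psi.d (HomWord.single p j) + (b / τ) • Ψ.v.d (Word.single p j)
    + (1 / τ) • ∫ s in Ioi (0 : ℝ), g s • (Ψ.eta.rep s).d (HomWord.single p j)

/-- `f = (c_g²/τ) Δψ + (b/τ) Δv + (1/τ) ∫₀^∞ g(s) Δη(s) ds` in the sense of distributions. -/
def IsElliptic {n p : ℕ} (τ b c : ℝ) (g : ℝ → ℝ) (Ψ : State n p g) (f : L2 n) : Prop :=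
  IsWeakDiv (flux τ b c g Ψ) f

/-- `η` has (a representative with) `η(0) = 0` and `η_s = ξ`, that is, `η(s) = ∫₀^s ξ(r) dr`
almost everywhere for the measure `-g'(s) ds`; the equation is read for each spatial derivative,
as an identity in `L²(ℝⁿ)`. -/
def IsHistDeriv {n m : ℕ} {g : ℝ → ℝ} (η ξ : Hist n m g) : Prop :=
  ∀ᵐ s ∂(histMeasure g), ∀ α : HomWord n m, (η.rep s).d α = ∫ r in (0 : ℝ)..s, (ξ.rep r).d α

/-- The domain of `𝒜` in `𝓗^p`, `p = m - 1`: the states with `w ∈ H^m`,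
`(c_g²/τ) Δψ + (b/τ) Δv + (1/τ) ∫ g Δη ∈ H^{m-1}`, and `η ∈ D(𝕋)`, that is, `η_s ∈ 𝓜^m` and
`η(0) = 0`. -/
def domainA {n p : ℕ} (τ b c : ℝ) (g : ℝ → ℝ) : Set (State n p g) :=
  {Ψ | (∃ w' : Sob n (p + 1), w'.fn = Ψ.w.fn) ∧
    (∃ f : Sob n p, IsElliptic τ b c g Ψ f.fn) ∧
    ∃ ξ : Hist n (p + 1) g, IsHistDeriv Ψ.eta ξ}

/-- `Φ = 𝒜 Ψ`: the four components of `Φ` are `v`, `w`,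
`-(1/τ) w + (c_g²/τ) Δψ + (b/τ) Δv + (1/τ) ∫ g Δη`, and `v - η_s`. -/
structure IsImageA {n p : ℕ} (τ b c : ℝ) (g : ℝ → ℝ) (Ψ Φ : State n p g) : Prop where
  psi_eq : IsPotential Φ.psi.1 Ψ.v.fn
  v_eq : Φ.v.fn = Ψ.w.fn
  w_eq : ∃ f : L2 n, IsElliptic τ b c g Ψ f ∧ Φ.w.fn = -((1 / τ) • Ψ.w.fn) + f
  eta_eq : ∃ (V : HomSob n (p + 1)) (ξ : Hist n (p + 1) g), IsPotential V.1 Ψ.v.fn ∧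
    IsHistDeriv Ψ.eta ξ ∧ ∀ᵐ s ∂(histMeasure g), Φ.eta.rep s = V - ξ.rep s

end MGT

end

/-! The system is a damped wave equation in disguise. Put z = v + (c_g²/b) ψ + (1/b) ∫ g η (`effL`).
The third component then reads w_t = -(1/τ) w + (b/τ) Δz. Moreover z_t equals w plus terms that are
bounded in the state: integration by parts in the age variable turns ∫ g η_s into ∫ (-g') η
(`IsPrim.memInt_eq`), so no derivative of the history survives.

Measure the state by the homogeneous norms of ψ and η, that of z with weight b/τ, the H^p norm of w
and the L² norm of v. This Hilbert norm is equivalent to the given one, because ∇v is recovered from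
z, ψ and η (`exists_norm_le_energyL`). In the energy identity the two unbounded terms, ⟨∇z, ∇w⟩ and
⟨w, Δz⟩, cancel by Green's formula (`inner_div_eq`). The friction -(1/τ) w has a good sign, and so
has -η_s, because g'' ≥ 0 makes the weight -g' nonincreasing (`IsPrim.inner_nonneg`). All that
remains is bounded, so the operator minus a constant is dissipative (`IsImageA.inner_energyL_le`).

For the range condition, ψ, w and η are eliminated from the resolvent equation, η by means of the
exponential convolution that inverts l + d/ds (`isPrim_expConv`). One equation μ v - Δv = h + div G
with μ > 0 is left. Its weak solution is an orthogonal projection in L²; the projection commutes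
with translations, hence with weak derivatives, so data in H^p give v in H^{p+1}
(`hasWeakPD_ellSol`, `exists_elliptic_solution`, `exists_resolvent`).

A quasi-dissipative, single-valued operator with full range in a Hilbert space is densely defined
(`IsQuasiMDissipative.dense_domain`), and the exponentials of its Yosida approximations converge to
a semigroup with exactly this generator (`IsQuasiMDissipative.exists_semigroup`). The change of
inner product is handled by working on the range of the energy map (`exists_semigroup_of_form`).

Completeness of the state space is delicate only for the homogeneous space: a limit of gradients
must again be the gradient of a function in L^{2n/(n-2)}. This follows from density of test
functions and the Sobolev inequality (`isClosed_homSobSubmodule`). -/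

noncomputable section

namespace MGT

/-! ## Generation of semigroups by quasi-dissipative operators in Hilbert spaces -/

section Generation

variable {H : Type*} [NormedAddCommGroup H] [InnerProductSpace ℝ H]

/-- The graph `G` is that of a single-valued operator `A` with `A - γ` maximal dissipative. -/
structure IsQuasiMDissipative (G : Submodule ℝ (H × H)) (γ : ℝ) : Prop where
  nonneg : 0 ≤ γ
  inner_le : ∀ q ∈ G, inner ℝ q.2 q.1 ≤ γ * ‖q.1‖ ^ 2
  surj : ∀ l > γ, ∀ f, ∃ q ∈ G, l • q.1 - q.2 = f
  single : ∀ y, ((0 : H), y) ∈ G → y = 0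

namespace IsQuasiMDissipative

variable {G : Submodule ℝ (H × H)} {γ : ℝ}

theorem norm_le (hG : IsQuasiMDissipative G γ) {l : ℝ} (hl : γ < l) {q : H × H} (hq : q ∈ G) :
    ‖q.1‖ ≤ (l - γ)⁻¹ * ‖l • q.1 - q.2‖ := by
  have h1 : (l - γ) * ‖q.1‖ ^ 2 ≤ ‖l • q.1 - q.2‖ * ‖q.1‖ := by
    have h2 := real_inner_le_norm (l • q.1 - q.2) q.1
    rw [inner_sub_left, real_inner_smul_left, real_inner_self_eq_norm_sq] at h2
    have := hG.inner_le q hq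
    linarith
  have hlw : 0 < l - γ := sub_pos.2 hl
  rcases (norm_nonneg q.1).eq_or_lt with h0 | h0
  · rw [← h0]; positivity
  · rw [inv_mul_eq_div, le_div_iff₀ hlw]
    nlinarith

/-- By `norm_le` the solution of l x - A x = f is unique, so any choice of solutions is
automatically linear, and the same estimate bounds it. -/
theorem exists_resolvent (hG : IsQuasiMDissipative G γ) {l : ℝ} (hl : γ < l) :
    ∃ R : H →L[ℝ] H, (∀ f, (R f, l • R f - f) ∈ G) ∧ ∀ f, ‖R f‖ ≤ (l - γ)⁻¹ * ‖f‖ := by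
  choose q hq hf using hG.surj l hl
  have huniq : ∀ f, ∀ r ∈ G, l • r.1 - r.2 = f → r.1 = (q f).1 := by
    intro f r hr h
    have h1 := hG.norm_le hl (G.sub_mem hr (hq f))
    have h2 : l • (r - q f).1 - (r - q f).2 = 0 := by
      rw [Prod.fst_sub, Prod.snd_sub, smul_sub, sub_sub_sub_comm, h, hf, sub_self]
    rw [h2, norm_zero, mul_zero] at h1
    exact sub_eq_zero.1 (norm_le_zero_iff.1 h1)
  let R : H →ₗ[ℝ] H :=
    { toFun := fun f => (q f).1
      map_add' := fun f f' => by
        refine (huniq (f + f') (q f + q f') (G.add_mem (hq f) (hq f')) ?_).symm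
        conv_rhs => rw [← hf f, ← hf f']
        simp only [Prod.fst_add, Prod.snd_add, smul_add]
        abel
      map_smul' := fun c f => by
        refine (huniq (c • f) (c • q f) (G.smul_mem c (hq f)) ?_).symm
        conv_rhs => rw [← hf f]
        simp only [Prod.smul_fst, Prod.smul_snd, smul_sub, smul_comm c l] }
  have hb : ∀ f, ‖R f‖ ≤ (l - γ)⁻¹ * ‖f‖ := fun f => by
    have := hG.norm_le hl (hq f)
    rwa [hf f] at this
  refine ⟨R.mkContinuous _ hb, fun f => ?_, hb⟩
  have h2 : l • (q f).1 - f = (q f).2 := by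
    rw [sub_eq_iff_eq_add, ← sub_eq_iff_eq_add', hf f]
  change ((q f).1, l • (q f).1 - f) ∈ G
  rw [h2]
  exact hq f

/-- A choice of the resolvent `(l - A)⁻¹`. -/
def resolvent (hG : IsQuasiMDissipative G γ) {l : ℝ} (hl : γ < l) : H →L[ℝ] H :=
  (hG.exists_resolvent hl).choose

theorem resolvent_mem (hG : IsQuasiMDissipative G γ) {l : ℝ} (hl : γ < l) (f : H) :
    (hG.resolvent hl f, l • hG.resolvent hl f - f) ∈ G :=
  (hG.exists_resolvent hl).choose_spec.1 f

theorem norm_resolvent_le (hG : IsQuasiMDissipative G γ) {l : ℝ} (hl : γ < l) (f : H) :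
    ‖hG.resolvent hl f‖ ≤ (l - γ)⁻¹ * ‖f‖ :=
  (hG.exists_resolvent hl).choose_spec.2 f

theorem eq_resolvent (hG : IsQuasiMDissipative G γ) {l : ℝ} (hl : γ < l) {x y : H}
    (h : (x, y) ∈ G) : hG.resolvent hl (l • x - y) = x := by
  set f := l • x - y with hf
  have h1 := hG.norm_le hl (G.sub_mem h (hG.resolvent_mem hl f))
  have h2 : l • ((x, y) - (hG.resolvent hl f, l • hG.resolvent hl f - f)).1
      - ((x, y) - (hG.resolvent hl f, l • hG.resolvent hl f - f)).2 = 0 := by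
    simp only [Prod.mk_sub_mk, hf, smul_sub]
    abel
  rw [h2, norm_zero, mul_zero] at h1
  exact (sub_eq_zero.1 (norm_le_zero_iff.1 h1)).symm

theorem resolvent_comm (hG : IsQuasiMDissipative G γ) {l k : ℝ} (hl : γ < l) (hk : γ < k) :
    Commute (hG.resolvent hl) (hG.resolvent hk) := by
  rcases eq_or_ne l k with rfl | hne
  · exact Commute.refl _
  -- The resolvent identity. Exchanging l and k changes the sign of its right-hand side, which
  -- forces the two products to agree.
  have key : ∀ {l k : ℝ} (hl : γ < l) (hk : γ < k) (f : H),
      (l - k) • hG.resolvent hl (hG.resolvent hk f) =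
        hG.resolvent hk f - hG.resolvent hl f := by
    intro l k hl hk f
    have h := hG.eq_resolvent hl (hG.resolvent_mem hk f)
    rw [eq_sub_iff_add_eq, ← map_smul, ← map_add]
    conv_rhs => rw [← h]
    congr 1
    rw [sub_smul]; abel
  ext f
  have h1 := key hl hk f
  have h2 := key hk hl f
  have h3 : (l - k) • hG.resolvent hl (hG.resolvent hk f) =
      (l - k) • hG.resolvent hk (hG.resolvent hl f) := by
    rw [h1, ← neg_sub k l, neg_smul, h2]; abel
  exact smul_right_injective H (sub_ne_zero.2 hne) h3

/-- Let y be orthogonal to the domain and solve (γ + 1) x - A x = y. Pairing with x gives 0 ≥ ‖x‖²,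
so x = 0, and single-valuedness gives y = 0. -/
theorem dense_domain [CompleteSpace H] (hG : IsQuasiMDissipative G γ) :
    Dense ((G.map (LinearMap.fst ℝ H H) : Submodule ℝ H) : Set H) := by
  rw [Submodule.dense_iff_topologicalClosure_eq_top, Submodule.topologicalClosure_eq_top_iff,
    Submodule.eq_bot_iff]
  intro y hy
  obtain ⟨q, hq, h⟩ := hG.surj (γ + 1) (by linarith) y
  have h0 : inner ℝ q.1 y = (0 : ℝ) := hy q.1 ⟨q, hq, rfl⟩
  rw [← h, inner_sub_right, real_inner_smul_right, real_inner_self_eq_norm_sq] at h0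
  have h1 := hG.inner_le q hq
  rw [real_inner_comm] at h1
  have h2 : ‖q.1‖ ^ 2 ≤ 0 := by linarith
  have h3 : q.1 = 0 := by
    rw [← norm_eq_zero]; exact pow_eq_zero_iff two_ne_zero |>.1 (le_antisymm h2 (sq_nonneg _))
  have h4 : q.2 = 0 := hG.single q.2 (by rw [← h3]; exact hq)
  rw [← h, h3, h4]; simp

/-- The parameter of the `k`-th Yosida approximation. -/
def yosidaParam (γ : ℝ) (k : ℕ) : ℝ := 2 * γ + k + 1

theorem lt_yosidaParam (hγ : 0 ≤ γ) (k : ℕ) : γ < yosidaParam γ k := by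
  have : (0 : ℝ) ≤ k := k.cast_nonneg
  unfold yosidaParam; linarith

end IsQuasiMDissipative

/-- The function s ↦ e^{-2Ks} ‖e^{sB} x‖² has nonpositive derivative. -/
theorem norm_exp_smul_apply_le [CompleteSpace H] {B : H →L[ℝ] H} {K : ℝ}
    (hB : ∀ x, inner ℝ (B x) x ≤ K * ‖x‖ ^ 2) {t : ℝ} (ht : 0 ≤ t) (x : H) :
    ‖NormedSpace.exp (t • B) x‖ ≤ Real.exp (K * t) * ‖x‖ := by
  have hu : ∀ s : ℝ, HasDerivAt (fun s : ℝ => NormedSpace.exp (s • B) x)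
      (B (NormedSpace.exp (s • B) x)) s := fun s =>
    (hasDerivAt_exp_smul_const' B s).clm_apply (hasDerivAt_const s x) |>.congr_deriv (by simp)
  have hf : ∀ s : ℝ, HasDerivAt
      (fun s : ℝ => Real.exp (-(2 * K) * s) * ‖NormedSpace.exp (s • B) x‖ ^ 2)
      (Real.exp (-(2 * K) * s) * (2 * inner ℝ (B (NormedSpace.exp (s • B) x))
        (NormedSpace.exp (s • B) x) - 2 * K * ‖NormedSpace.exp (s • B) x‖ ^ 2)) s := by
    intro s
    have h1 : HasDerivAt (fun s : ℝ => Real.exp (-(2 * K) * s))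
        (Real.exp (-(2 * K) * s) * (-(2 * K))) s := by
      simpa using ((hasDerivAt_id s).const_mul (-(2 * K))).exp
    have h2 := h1.mul (hu s).norm_sq
    refine h2.congr_deriv ?_
    rw [real_inner_comm]
    ring
  have hanti := antitone_of_hasDerivAt_nonpos hf fun s => by
    refine mul_nonpos_of_nonneg_of_nonpos (Real.exp_pos _).le ?_
    have := hB (NormedSpace.exp (s • B) x)
    linarith
  have h0 := hanti ht
  simp only [mul_zero, Real.exp_zero, zero_smul, NormedSpace.exp_zero,
    one_apply_eq_self, one_mul] at h0
  refine le_of_sq_le_sq ?_ (by positivity)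
  rw [mul_pow, ← Real.exp_nat_mul]
  have h3 : Real.exp (((2 : ℕ) : ℝ) * (K * t)) * Real.exp (-(2 * K) * t) = 1 := by
    rw [← Real.exp_add, ← Real.exp_zero]; congr 1; push_cast; ring
  calc ‖NormedSpace.exp (t • B) x‖ ^ 2
      = Real.exp (((2 : ℕ) : ℝ) * (K * t)) * (Real.exp (-(2 * K) * t) *
          ‖NormedSpace.exp (t • B) x‖ ^ 2) := by rw [← mul_assoc, h3, one_mul]
    _ ≤ _ := by gcongr

/-- The curve s ↦ e^{(t-s)C} e^{sB} x joins the two exponentials. As B and C commute, its velocity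
is e^{(t-s)C} e^{sB} (B x - C x), and only ‖B x - C x‖, not ‖B - C‖, enters the bound. -/
theorem norm_exp_smul_sub_le [CompleteSpace H] {B C : H →L[ℝ] H} {K : ℝ} (hBC : Commute B C)
    (hB : ∀ x, inner ℝ (B x) x ≤ K * ‖x‖ ^ 2) (hC : ∀ x, inner ℝ (C x) x ≤ K * ‖x‖ ^ 2)
    {t : ℝ} (ht : 0 ≤ t) (x : H) :
    ‖NormedSpace.exp (t • B) x - NormedSpace.exp (t • C) x‖ ≤
      t * Real.exp (K * t) * ‖B x - C x‖ := by
  have hd : ∀ s : ℝ, HasDerivAt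
      (fun s : ℝ => NormedSpace.exp ((t - s) • C) (NormedSpace.exp (s • B) x))
      (NormedSpace.exp ((t - s) • C) (NormedSpace.exp (s • B) (B x - C x))) s := by
    intro s
    have h1 : HasDerivAt (fun s : ℝ => NormedSpace.exp (s • B) x)
        (NormedSpace.exp (s • B) (B x)) s :=
      (hasDerivAt_exp_smul_const B s).clm_apply (hasDerivAt_const s x) |>.congr_deriv (by simp)
    have h2 : HasDerivAt (fun s : ℝ => NormedSpace.exp ((t - s) • C))
        (-(NormedSpace.exp ((t - s) • C) * C)) s := by
      have := (hasDerivAt_exp_smul_const C (t - s)).scomp s ((hasDerivAt_id s).const_sub t)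
      simpa [Function.comp_def] using this
    refine (h2.clm_apply h1).congr_deriv ?_
    have h3 : C (NormedSpace.exp (s • B) x) = NormedSpace.exp (s • B) (C x) := by
      have : Commute C (NormedSpace.exp (s • B)) := (hBC.symm.smul_right s).exp_right
      exact congrArg (fun T : H →L[ℝ] H => T x) this.eq
    simp only [neg_apply, mul_apply_eq_comp, h3, map_sub]
    abel
  have hbound : ∀ s ∈ Set.Ico 0 t,
      ‖NormedSpace.exp ((t - s) • C) (NormedSpace.exp (s • B) (B x - C x))‖ ≤
        Real.exp (K * t) * ‖B x - C x‖ := by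
    intro s hs
    refine (norm_exp_smul_apply_le hC (sub_nonneg.2 hs.2.le) _).trans ?_
    calc _ ≤ Real.exp (K * (t - s)) * (Real.exp (K * s) * ‖B x - C x‖) := by
          gcongr; exact norm_exp_smul_apply_le hB hs.1 _
      _ = _ := by rw [← mul_assoc, ← Real.exp_add]; congr 2; ring
  have := norm_image_sub_le_of_norm_deriv_le_segment' (fun s _ => (hd s).hasDerivWithinAt) hbound
    t (right_mem_Icc.2 ht)
  simp only [sub_self, zero_smul, NormedSpace.exp_zero, one_apply_eq_self,
    sub_zero] at this
  linarith

/-! ### Yosida approximations -/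

namespace IsQuasiMDissipative

variable {G : Submodule ℝ (H × H)} {γ : ℝ}

/-- The Yosida approximation `l² (l - A)⁻¹ - l`. -/
def yosida (hG : IsQuasiMDissipative G γ) (k : ℕ) : H →L[ℝ] H :=
  yosidaParam γ k ^ 2 • hG.resolvent (lt_yosidaParam hG.nonneg k)
    - yosidaParam γ k • ContinuousLinearMap.id ℝ H

theorem yosida_inner_le (hG : IsQuasiMDissipative G γ) (k : ℕ) (x : H) :
    inner ℝ (hG.yosida k x) x ≤ 2 * γ * ‖x‖ ^ 2 := by
  have hγ := hG.nonneg
  have hl := lt_yosidaParam hG.nonneg k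
  have hl2 : 2 * γ ≤ yosidaParam γ k := by
    have : (0 : ℝ) ≤ k := k.cast_nonneg
    unfold yosidaParam; linarith
  have hR : inner ℝ (hG.resolvent hl x) x ≤ (yosidaParam γ k - γ)⁻¹ * ‖x‖ ^ 2 := by
    refine (real_inner_le_norm _ _).trans ?_
    have := hG.norm_resolvent_le hl x
    nlinarith [norm_nonneg x]
  set l := yosidaParam γ k with hldef
  have hpos : 0 < l - γ := sub_pos.2 hl
  have e : inner ℝ (hG.yosida k x) x = l ^ 2 * inner ℝ (hG.resolvent hl x) x - l * ‖x‖ ^ 2 := by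
    simp [yosida, inner_sub_left, real_inner_smul_left, ← hldef]
  -- The left side is l γ / (l - γ), and l ≥ 2γ makes l / (l - γ) ≤ 2. This is why the parameter
  -- starts above 2γ.
  have h2 : l ^ 2 * (l - γ)⁻¹ - l ≤ 2 * γ := by
    rw [← div_eq_mul_inv, sub_le_iff_le_add, div_le_iff₀ hpos]
    nlinarith
  rw [e]
  calc _ ≤ l ^ 2 * ((l - γ)⁻¹ * ‖x‖ ^ 2) - l * ‖x‖ ^ 2 := by gcongr
    _ = (l ^ 2 * (l - γ)⁻¹ - l) * ‖x‖ ^ 2 := by ring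
    _ ≤ _ := by gcongr

theorem yosida_comm (hG : IsQuasiMDissipative G γ) (k j : ℕ) :
    Commute (hG.yosida k) (hG.yosida j) := by
  have h1 := hG.resolvent_comm (lt_yosidaParam hG.nonneg k) (lt_yosidaParam hG.nonneg j)
  have h2 : ∀ B : H →L[ℝ] H, Commute B (ContinuousLinearMap.id ℝ H) := fun B => Commute.one_right B
  unfold yosida
  exact (((h1.smul_right _).sub_right ((h2 _).smul_right _)).smul_left _).sub_left
    ((h2 _).symm.smul_left _)

/-- On the domain the approximation is l (l - A)⁻¹ applied to A x; its convergence to A x thus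
reduces to strong convergence of l (l - A)⁻¹ to the identity. -/
theorem yosida_apply (hG : IsQuasiMDissipative G γ) (k : ℕ) {x y : H} (h : (x, y) ∈ G) :
    hG.yosida k x =
      yosidaParam γ k • hG.resolvent (lt_yosidaParam hG.nonneg k) y := by
  have h1 := hG.eq_resolvent (lt_yosidaParam hG.nonneg k) h
  rw [map_sub, map_smul, sub_eq_iff_eq_add] at h1
  simp only [yosida, sub_apply, smul_apply,
    ContinuousLinearMap.id_apply]
  rw [pow_two, mul_smul, h1, smul_add]
  abel

theorem tendsto_yosidaParam (γ : ℝ) : Tendsto (yosidaParam γ) atTop atTop := by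
  unfold yosidaParam
  exact tendsto_atTop_add_const_right _ _
    (tendsto_atTop_add_const_left _ _ tendsto_natCast_atTop_atTop)

theorem norm_smul_resolvent_le (hG : IsQuasiMDissipative G γ) (k : ℕ) (y : H) :
    ‖yosidaParam γ k • hG.resolvent (lt_yosidaParam hG.nonneg k) y‖ ≤ 2 * ‖y‖ := by
  have hγ := hG.nonneg
  have hl := lt_yosidaParam hG.nonneg k
  have hl2 : 2 * γ ≤ yosidaParam γ k := by
    have : (0 : ℝ) ≤ k := k.cast_nonneg
    unfold yosidaParam; linarith
  have hl0 : 0 < yosidaParam γ k := hγ.trans_lt hl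
  rw [norm_smul, Real.norm_of_nonneg hl0.le]
  have hpos : 0 < yosidaParam γ k - γ := sub_pos.2 hl
  have := hG.norm_resolvent_le hl y
  calc _ ≤ yosidaParam γ k * ((yosidaParam γ k - γ)⁻¹ * ‖y‖) := by gcongr
    _ = yosidaParam γ k / (yosidaParam γ k - γ) * ‖y‖ := by ring
    _ ≤ 2 * ‖y‖ := by
      gcongr
      rw [div_le_iff₀ hpos]; linarith

/-- For x in the domain, l (l - A)⁻¹ x - x = (l - A)⁻¹ A x is of order 1/(l - γ). Density and the
uniform bound 2 give the rest; replacing y by x costs at most (2 + 1) ‖y - x‖, hence the choice ε/6.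
-/
theorem tendsto_smul_resolvent [CompleteSpace H] (hG : IsQuasiMDissipative G γ) (y : H) :
    Tendsto (fun k => yosidaParam γ k • hG.resolvent (lt_yosidaParam hG.nonneg k) y) atTop
      (𝓝 y) := by
  rw [Metric.tendsto_atTop]
  intro ε hε
  obtain ⟨y', ⟨q, hq, rfl⟩, hy'⟩ := hG.dense_domain.exists_dist_lt y (by positivity : 0 < ε / 6)
  change dist y q.1 < ε / 6 at hy'
  have hlim : Tendsto (fun k => (yosidaParam γ k - γ)⁻¹ * ‖q.2‖) atTop (𝓝 0) := by
    have h1 := tendsto_atTop_add_const_right atTop (-γ) (tendsto_yosidaParam γ)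
    simpa [sub_eq_add_neg] using (tendsto_inv_atTop_zero.comp h1).mul_const ‖q.2‖
  obtain ⟨N, hN⟩ := ((tendsto_order.1 hlim).2 (ε / 2) (by positivity)).exists_forall_of_atTop
  refine ⟨N, fun k hk => ?_⟩
  have hl := lt_yosidaParam hG.nonneg k
  have e1 : yosidaParam γ k • hG.resolvent hl q.1 - q.1 = hG.resolvent hl q.2 := by
    have h1 := hG.eq_resolvent hl (x := q.1) (y := q.2) hq
    rw [map_sub, map_smul] at h1
    rw [sub_eq_iff_eq_add, ← sub_eq_iff_eq_add', h1]
  have e2 : yosidaParam γ k • hG.resolvent hl y - y =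
      yosidaParam γ k • hG.resolvent hl (y - q.1) + (hG.resolvent hl q.2) + (q.1 - y) := by
    rw [← e1, map_sub, smul_sub]; abel
  rw [dist_eq_norm, e2]
  have b1 := hG.norm_smul_resolvent_le k (y - q.1)
  have b2 := hG.norm_resolvent_le hl q.2
  have b3 := hN k hk
  rw [dist_eq_norm] at hy'
  have b4 : ‖q.1 - y‖ = ‖y - q.1‖ := norm_sub_rev _ _
  have := norm_add₃_le (a := yosidaParam γ k • hG.resolvent hl (y - q.1))
    (b := hG.resolvent hl q.2) (c := q.1 - y)
  linarith

theorem tendsto_yosida [CompleteSpace H] (hG : IsQuasiMDissipative G γ) {x y : H}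
    (h : (x, y) ∈ G) : Tendsto (fun k => hG.yosida k x) atTop (𝓝 y) := by
  simpa only [hG.yosida_apply _ h] using hG.tendsto_smul_resolvent y

end IsQuasiMDissipative

end Generation

end MGT

end

/-! ### The limit semigroup and its generator -/

noncomputable section

namespace MGT

section Generation

variable {H : Type*} [NormedAddCommGroup H] [InnerProductSpace ℝ H] [CompleteSpace H]

namespace IsQuasiMDissipative

variable {G : Submodule ℝ (H × H)} {γ : ℝ}

theorem norm_exp_yosida_le (hG : IsQuasiMDissipative G γ) (k : ℕ) {t : ℝ} (ht : 0 ≤ t) (x : H) :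
    ‖NormedSpace.exp (t • hG.yosida k) x‖ ≤ Real.exp (2 * γ * t) * ‖x‖ :=
  norm_exp_smul_apply_le (hG.yosida_inner_le k) ht x

theorem norm_exp_yosida_sub_self_le (hG : IsQuasiMDissipative G γ) (k : ℕ) {t : ℝ} (ht : 0 ≤ t)
    (x : H) : ‖NormedSpace.exp (t • hG.yosida k) x - x‖ ≤
      t * Real.exp (2 * γ * t) * ‖hG.yosida k x‖ := by
  -- Comparison with C = 0, whose exponential is the identity.
  have := norm_exp_smul_sub_le (C := 0) (Commute.zero_right _) (hG.yosida_inner_le k)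
    (fun x => by simpa using mul_nonneg (mul_nonneg zero_le_two hG.nonneg) (sq_nonneg ‖x‖)) ht x
  simpa using this

/-- On the domain the exponentials differ by at most t M times the difference of the approximations,
which converge there. The common bound M extends this to all x by density; the two errors of size M
‖x - x'‖ account for the 4M. -/
theorem cauchySeq_exp_yosida (hG : IsQuasiMDissipative G γ) {t : ℝ} (ht : 0 ≤ t) (x : H) :
    CauchySeq fun k => NormedSpace.exp (t • hG.yosida k) x := by
  rw [Metric.cauchySeq_iff]
  intro ε hε
  set M := Real.exp (2 * γ * t)
  have hM : 0 < M := Real.exp_pos _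
  obtain ⟨x', ⟨q, hq, rfl⟩, hx'⟩ :=
    hG.dense_domain.exists_dist_lt x (by positivity : 0 < ε / (4 * M))
  change dist x q.1 < _ at hx'
  rw [dist_eq_norm, lt_div_iff₀ (by positivity)] at hx'
  obtain ⟨N, hN⟩ := Metric.cauchySeq_iff.1 (hG.tendsto_yosida (x := q.1) (y := q.2) hq).cauchySeq
    (ε / (2 * (t * M + 1))) (by positivity)
  refine ⟨N, fun j hj k hk => ?_⟩
  have h1 := hN j hj k hk
  rw [dist_eq_norm, lt_div_iff₀ (by positivity)] at h1
  have h2 := norm_exp_smul_sub_le (hG.yosida_comm j k) (hG.yosida_inner_le j)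
    (hG.yosida_inner_le k) ht q.1
  have h3 := hG.norm_exp_yosida_le j ht (x - q.1)
  have h4 := hG.norm_exp_yosida_le k ht (q.1 - x)
  rw [norm_sub_rev q.1 x] at h4
  have e : NormedSpace.exp (t • hG.yosida j) x - NormedSpace.exp (t • hG.yosida k) x =
      NormedSpace.exp (t • hG.yosida j) (x - q.1) + (NormedSpace.exp (t • hG.yosida j) q.1
        - NormedSpace.exp (t • hG.yosida k) q.1) + NormedSpace.exp (t • hG.yosida k) (q.1 - x) := by
    simp only [map_sub]; abel
  rw [dist_eq_norm, e]
  refine (norm_add₃_le).trans_lt ?_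
  nlinarith [norm_nonneg (hG.yosida j q.1 - hG.yosida k q.1)]

theorem exists_limit_semigroup (hG : IsQuasiMDissipative G γ) :
    ∃ S : ℝ≥0 → H →L[ℝ] H, ∀ (t : ℝ≥0) (x : H),
      Tendsto (fun k => NormedSpace.exp ((t : ℝ) • hG.yosida k) x) atTop (𝓝 (S t x)) := by
  have h : ∀ (t : ℝ≥0) (x : H), ∃ y,
      Tendsto (fun k => NormedSpace.exp ((t : ℝ) • hG.yosida k) x) atTop (𝓝 y) := fun t x =>
    cauchySeq_tendsto_of_complete (hG.cauchySeq_exp_yosida t.2 x)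
  choose f hf using h
  exact ⟨fun t => continuousLinearMapOfTendsto (fun k => NormedSpace.exp ((t : ℝ) • hG.yosida k))
    (tendsto_pi_nhds.2 (hf t)), fun t x => hf t x⟩

/-- One δ must serve all approximations, so that strong continuity at 0 passes to the limit in k. On
the domain this holds because ‖A_k x‖ ≤ 2 ‖A x‖. -/
theorem exists_uniform_continuity (hG : IsQuasiMDissipative G γ) (y : H) {ε : ℝ} (hε : 0 < ε) :
    ∃ δ > 0, ∀ k : ℕ, ∀ s : ℝ, 0 ≤ s → s ≤ δ →
      ‖NormedSpace.exp (s • hG.yosida k) y - y‖ ≤ ε := by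
  set M := Real.exp (2 * γ)
  have hM : 0 < M := Real.exp_pos _
  obtain ⟨y', ⟨q, hq, rfl⟩, hy'⟩ :=
    hG.dense_domain.exists_dist_lt y (by positivity : 0 < ε / (2 * (M + 1)))
  change dist y q.1 < _ at hy'
  rw [dist_eq_norm, lt_div_iff₀ (by positivity)] at hy'
  refine ⟨min 1 (ε / (2 * (M * (2 * ‖q.2‖) + 1))), by positivity, fun k s hs hsδ => ?_⟩
  have hs1 : s ≤ 1 := hsδ.trans (min_le_left _ _)
  have hs2 := hsδ.trans (min_le_right _ _)
  rw [le_div_iff₀ (by positivity)] at hs2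
  have hMs : Real.exp (2 * γ * s) ≤ M :=
    Real.exp_le_exp.2 (mul_le_of_le_one_right (by have := hG.nonneg; linarith) hs1)
  have h1 : ‖NormedSpace.exp (s • hG.yosida k) (y - q.1)‖ ≤ M * ‖y - q.1‖ :=
    (hG.norm_exp_yosida_le k hs _).trans (by gcongr)
  have h2 : ‖NormedSpace.exp (s • hG.yosida k) q.1 - q.1‖ ≤ s * M * (2 * ‖q.2‖) := by
    refine (hG.norm_exp_yosida_sub_self_le k hs _).trans ?_
    have := hG.norm_smul_resolvent_le k q.2
    rw [← hG.yosida_apply k (x := q.1) hq] at this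
    gcongr
  have e : NormedSpace.exp (s • hG.yosida k) y - y = NormedSpace.exp (s • hG.yosida k) (y - q.1) +
      (NormedSpace.exp (s • hG.yosida k) q.1 - q.1) + (q.1 - y) := by
    simp only [map_sub]; abel
  rw [e]
  refine (norm_add₃_le).trans ?_
  rw [norm_sub_rev q.1 y]
  nlinarith

/-- A first-order expansion with δ independent of k: for fixed t one may let k → ∞, and if A_k x → y
the last term disappears. The velocity of e^{s A_k} x - s A_k x is compared with e^{s A_k} y - y. -/
theorem exists_uniform_deriv (hG : IsQuasiMDissipative G γ) (x y : H) {ε : ℝ}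
    (hε : 0 < ε) : ∃ δ > 0, ∀ t : ℝ, 0 ≤ t → t ≤ δ → ∀ k : ℕ,
      ‖NormedSpace.exp (t • hG.yosida k) x - x - t • hG.yosida k x‖ ≤
        t * (ε + (Real.exp (2 * γ) + 1) * ‖hG.yosida k x - y‖) := by
  obtain ⟨δ, hδ, hu⟩ := hG.exists_uniform_continuity y hε
  refine ⟨min 1 δ, by positivity, fun t ht htδ k => ?_⟩
  have hd : ∀ s : ℝ, HasDerivAt
      (fun s : ℝ => NormedSpace.exp (s • hG.yosida k) x - s • hG.yosida k x)
      (NormedSpace.exp (s • hG.yosida k) (hG.yosida k x) - hG.yosida k x) s := by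
    intro s
    have h1 : HasDerivAt (fun s : ℝ => NormedSpace.exp (s • hG.yosida k) x)
        (NormedSpace.exp (s • hG.yosida k) (hG.yosida k x)) s :=
      (hasDerivAt_exp_smul_const (hG.yosida k) s).clm_apply (hasDerivAt_const s x)
        |>.congr_deriv (by simp)
    simpa using h1.fun_sub ((hasDerivAt_id s).smul_const (hG.yosida k x))
  have hb : ∀ s ∈ Set.Ico 0 t,
      ‖NormedSpace.exp (s • hG.yosida k) (hG.yosida k x) - hG.yosida k x‖ ≤
        ε + (Real.exp (2 * γ) + 1) * ‖hG.yosida k x - y‖ := by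
    intro s hs
    have hst : s ≤ min 1 δ := hs.2.le.trans htδ
    have h1 := hu k s hs.1 (hst.trans (min_le_right _ _))
    have hMs : Real.exp (2 * γ * s) ≤ Real.exp (2 * γ) :=
      Real.exp_le_exp.2 (mul_le_of_le_one_right (by have := hG.nonneg; linarith)
        (hst.trans (min_le_left _ _)))
    have h2 : ‖NormedSpace.exp (s • hG.yosida k) (hG.yosida k x - y)‖ ≤
        Real.exp (2 * γ) * ‖hG.yosida k x - y‖ :=
      (hG.norm_exp_yosida_le k hs.1 _).trans (by gcongr)
    have e : NormedSpace.exp (s • hG.yosida k) (hG.yosida k x) - hG.yosida k x =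
        NormedSpace.exp (s • hG.yosida k) (hG.yosida k x - y) +
          (NormedSpace.exp (s • hG.yosida k) y - y) + (y - hG.yosida k x) := by
      simp only [map_sub]; abel
    rw [e]
    refine (norm_add₃_le).trans ?_
    rw [norm_sub_rev y]
    linarith
  have := norm_image_sub_le_of_norm_deriv_le_segment' (fun s _ => (hd s).hasDerivWithinAt) hb
    t (right_mem_Icc.2 ht)
  simp only [zero_smul, NormedSpace.exp_zero, one_apply_eq_self, sub_zero] at this
  rw [show NormedSpace.exp (t • hG.yosida k) x - x - t • hG.yosida k x =
    NormedSpace.exp (t • hG.yosida k) x - t • hG.yosida k x - x by abel]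
  linarith

/-- The graph of a quasi-m-dissipative operator is that of a generator. -/
theorem exists_semigroup (hG : IsQuasiMDissipative G γ) :
    ∃ S : C0Semigroup H, S.IsGenerator {x | ∃ y, (x, y) ∈ G} (fun x y => (x, y) ∈ G) := by
  obtain ⟨T, hT⟩ := hG.exists_limit_semigroup
  have hbound : ∀ (t : ℝ≥0) (x : H), ‖T t x‖ ≤ Real.exp (2 * γ * t) * ‖x‖ := fun t x =>
    le_of_tendsto (hT t x).norm (Eventually.of_forall fun k => hG.norm_exp_yosida_le k t.2 x)
  let S : C0Semigroup H :=
    { op := T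
      op_zero := by
        ext x
        refine tendsto_nhds_unique (hT 0 x) ?_
        simp
      op_add := by
        intro s t
        ext x
        refine tendsto_nhds_unique (hT (s + t) x) ?_
        -- Both the operator and its argument vary with k; the first summand vanishes in the limit
        -- because the exponentials are uniformly bounded.
        have h1 : ∀ k : ℕ, NormedSpace.exp (((s + t : ℝ≥0) : ℝ) • hG.yosida k) x =
            NormedSpace.exp ((s : ℝ) • hG.yosida k)
              (NormedSpace.exp ((t : ℝ) • hG.yosida k) x - T t x)
            + NormedSpace.exp ((s : ℝ) • hG.yosida k) (T t x) := by
          intro k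
          have hc : Commute ((s : ℝ) • hG.yosida k) ((t : ℝ) • hG.yosida k) :=
            ((Commute.refl (hG.yosida k)).smul_right _).smul_left _
          let _ := NormedAlgebra.restrictScalars ℚ ℝ (H →L[ℝ] H)
          rw [NNReal.coe_add, add_smul, NormedSpace.exp_add_of_commute hc, map_sub]
          simp
        simp only [h1]
        have h2 : Tendsto (fun k => NormedSpace.exp ((s : ℝ) • hG.yosida k)
            (NormedSpace.exp ((t : ℝ) • hG.yosida k) x - T t x)) atTop (𝓝 0) := by
          have h3 : Tendsto (fun k => Real.exp (2 * γ * s) *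
              ‖NormedSpace.exp ((t : ℝ) • hG.yosida k) x - T t x‖) atTop (𝓝 0) := by
            simpa using ((hT t x).sub_const (T t x)).norm.const_mul (Real.exp (2 * γ * s))
          exact squeeze_zero_norm (fun k => hG.norm_exp_yosida_le k s.2 _) h3
        simpa using h2.add (hT s (T t x))
      tendsto_zero := by
        intro x
        rw [Metric.tendsto_nhds]
        intro ε hε
        obtain ⟨δ, hδ, hu⟩ := hG.exists_uniform_continuity x (half_pos hε)
        filter_upwards [Iio_mem_nhds (show (0 : ℝ≥0) < ⟨δ, hδ.le⟩ from hδ)] with t ht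
        have h1 : ‖T t x - x‖ ≤ ε / 2 := le_of_tendsto ((hT t x).sub_const x).norm
          (Eventually.of_forall fun k => hu k t t.2 (le_of_lt (show (t : ℝ) < δ from ht)))
        rw [dist_eq_norm]
        linarith }
  have hpos : ∀ᶠ t : ℝ≥0 in 𝓝[>] 0, (0 : ℝ) < t := by
    filter_upwards [self_mem_nhdsWithin] with t ht using ht
  have hfwd : ∀ x y, (x, y) ∈ G → S.HasDerivZero x y := by
    intro x y h
    unfold C0Semigroup.HasDerivZero
    rw [Metric.tendsto_nhds]
    intro ε hε
    obtain ⟨δ, hδ, hu⟩ := hG.exists_uniform_deriv x y (half_pos hε)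
    have hnear : ∀ᶠ t : ℝ≥0 in 𝓝[>] 0, t < ⟨δ, hδ.le⟩ :=
      nhdsWithin_le_nhds (Iio_mem_nhds (show (0 : ℝ≥0) < ⟨δ, hδ.le⟩ from hδ))
    filter_upwards [hpos, hnear] with t ht htδ
    have hl := hG.tendsto_yosida h
    have l1 : Tendsto (fun k => ‖NormedSpace.exp ((t : ℝ) • hG.yosida k) x - x
        - (t : ℝ) • hG.yosida k x‖) atTop (𝓝 ‖T t x - x - (t : ℝ) • y‖) :=
      (((hT t x).sub_const x).sub (hl.const_smul (t : ℝ))).norm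
    have l2 : Tendsto (fun k => (t : ℝ) * (ε / 2 + (Real.exp (2 * γ) + 1) * ‖hG.yosida k x - y‖))
        atTop (𝓝 ((t : ℝ) * (ε / 2 + (Real.exp (2 * γ) + 1) * ‖y - y‖))) :=
      (((hl.sub_const y).norm.const_mul _).const_add _).const_mul _
    have h1 := le_of_tendsto_of_tendsto' l1 l2 fun k =>
      hu t ht.le (le_of_lt (show (t : ℝ) < δ from htδ)) k
    simp only [sub_self, norm_zero, mul_zero, add_zero] at h1
    have e : (t : ℝ)⁻¹ • (T t x - x) - y = (t : ℝ)⁻¹ • (T t x - x - (t : ℝ) • y) := by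
      rw [smul_sub _ _ ((t : ℝ) • y), inv_smul_smul₀ ht.ne']
    rw [dist_eq_norm]
    change ‖(t : ℝ)⁻¹ • (T t x - x) - y‖ < ε
    rw [e, norm_smul, norm_inv, Real.norm_of_nonneg ht.le, inv_mul_lt_iff₀ ht]
    nlinarith
  -- The generator cannot be larger than A. Solve (2γ + 1) x' - A x' = (2γ + 1) x - y with x' in the
  -- domain; then u = x - x' has right derivative (2γ + 1) u. Growth of at most e^{2γt} gives (2γ +
  -- 1) ‖u‖² ≤ 2γ ‖u‖², so u = 0.
  have hbwd : ∀ x y, S.HasDerivZero x y → (x, y) ∈ G := by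
    intro x y h
    have hl : γ < 2 * γ + 1 := by have := hG.nonneg; linarith
    have hm := hG.resolvent_mem hl ((2 * γ + 1) • x - y)
    set x' := hG.resolvent hl ((2 * γ + 1) • x - y) with hx'
    set y' := (2 * γ + 1) • x' - ((2 * γ + 1) • x - y) with hy'
    have hu : S.HasDerivZero (x - x') ((2 * γ + 1) • (x - x')) := by
      have h1 := h.sub (hfwd x' y' hm)
      unfold C0Semigroup.HasDerivZero
      have e1 : (2 * γ + 1) • (x - x') = y - y' := by rw [hy', smul_sub]; abel
      rw [e1]
      refine h1.congr fun t => ?_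
      rw [← smul_sub, map_sub]
      congr 1; abel
    have hzero : x - x' = 0 := by
      set u := x - x'
      have hγ := hG.nonneg
      have l1 : Tendsto (fun t : ℝ≥0 => inner ℝ ((t : ℝ)⁻¹ • (S.op t u - u)) u) (𝓝[>] 0)
          (𝓝 (inner ℝ ((2 * γ + 1) • u) u)) := hu.inner tendsto_const_nhds
      have l2 : Tendsto (fun t : ℝ≥0 => (t : ℝ)⁻¹ * (Real.exp (2 * γ * t) - 1) * ‖u‖ ^ 2)
          (𝓝[>] 0) (𝓝 (2 * γ * ‖u‖ ^ 2)) := by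
        refine Tendsto.mul_const _ ?_
        have hd : HasDerivAt (fun t : ℝ => Real.exp (2 * γ * t)) (2 * γ) 0 := by
          simpa using ((hasDerivAt_id (0 : ℝ)).const_mul (2 * γ)).exp
        have h3 := hd.tendsto_slope_zero
        simp only [zero_add, mul_zero, Real.exp_zero, smul_eq_mul] at h3
        refine h3.comp ?_
        refine tendsto_nhdsWithin_iff.2 ⟨?_, ?_⟩
        · exact (NNReal.continuous_coe.tendsto' 0 0 rfl).mono_left nhdsWithin_le_nhds
        · filter_upwards [hpos] with t ht using ht.ne'
      have h4 := le_of_tendsto_of_tendsto l1 l2 (by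
        filter_upwards [hpos] with t ht
        rw [real_inner_smul_left, inner_sub_left, real_inner_self_eq_norm_sq, mul_assoc]
        gcongr
        have h5 := real_inner_le_norm (S.op t u) u
        have h6 : ‖S.op t u‖ ≤ _ := hbound t u
        nlinarith [norm_nonneg u])
      rw [real_inner_smul_left, real_inner_self_eq_norm_sq] at h4
      have h7 : ‖u‖ ^ 2 ≤ 0 := by linarith
      exact norm_eq_zero.1 (pow_eq_zero_iff two_ne_zero |>.1 (le_antisymm h7 (sq_nonneg _)))
    have hxx : x = x' := sub_eq_zero.1 hzero
    have hyy : y' = y := by rw [hy', ← hxx]; abel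
    rwa [← hxx, hyy] at hm
  exact ⟨S, fun x => ⟨fun ⟨y, h⟩ => ⟨y, hfwd x y h⟩, fun ⟨y, h⟩ => ⟨y, hbwd x y h⟩⟩,
    fun x _ y => ⟨hfwd x y, hbwd x y⟩⟩

end IsQuasiMDissipative

/-- Transport of a generator along an isomorphism. -/
theorem exists_semigroup_of_equiv {X Y : Type*} [NormedAddCommGroup X] [NormedSpace ℝ X]
    [NormedAddCommGroup Y] [NormedSpace ℝ Y] (e : X ≃L[ℝ] Y) (S : C0Semigroup Y)
    {D : Set Y} {A : Y → Y → Prop} (hS : S.IsGenerator D A) :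
    ∃ S' : C0Semigroup X, S'.IsGenerator (e ⁻¹' D) (fun x y => A (e x) (e y)) := by
  let S' : C0Semigroup X :=
    { op := fun t => (e.symm : Y →L[ℝ] X).comp ((S.op t).comp (e : X →L[ℝ] Y))
      op_zero := by ext x; simp [S.op_zero]
      op_add := fun s t => by ext x; simp [S.op_add]
      tendsto_zero := fun x => by
        have := (e.symm.continuous.tendsto (e x)).comp (S.tendsto_zero (e x))
        simpa [Function.comp_def] using this }
  have key : ∀ x y, S'.HasDerivZero x y ↔ S.HasDerivZero (e x) (e y) := by
    intro x y
    unfold C0Semigroup.HasDerivZero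
    rw [e.toHomeomorph.isInducing.tendsto_nhds_iff]
    refine iff_of_eq (congrArg (fun f => Tendsto f _ _) ?_)
    funext t
    simp [S', map_sub]
  refine ⟨S', fun x => ?_, fun x hx y => ?_⟩
  · rw [mem_preimage, hS.1]
    refine ⟨fun ⟨y, hy⟩ => ⟨e.symm y, (key _ _).2 (by simpa using hy)⟩,
      fun ⟨y, hy⟩ => ⟨e y, (key _ _).1 hy⟩⟩
  · rw [key]
    exact hS.2 _ hx _

end Generation

end MGT

end

noncomputable section

namespace MGT

/-! ## Calculus of weak derivatives -/

section Weak

variable {n : ℕ}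

/-- The classical partial derivative `∂_j φ`. -/
def pd (j : Fin n) (φ : E n → ℝ) (x : E n) : ℝ := fderiv ℝ φ x (EuclideanSpace.single j 1)

theorem contDiff_pd (j : Fin n) {φ : E n → ℝ} (h : ContDiff ℝ ∞ φ) : ContDiff ℝ ∞ (pd j φ) :=
  (h.fderiv_right (m := ∞) (by norm_cast)).clm_apply contDiff_const

theorem hasCompactSupport_pd (j : Fin n) {φ : E n → ℝ} (h : HasCompactSupport φ) :
    HasCompactSupport (pd j φ) := h.fderiv_apply ℝ _

theorem partialD_nil (α : Fin 0 → Fin n) (φ : E n → ℝ) : partialD α φ = φ := by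
  funext x; simp [partialD]

theorem contDiff_partialD {k : ℕ} (α : Fin k → Fin n) {φ : E n → ℝ} (h : ContDiff ℝ ∞ φ) :
    ContDiff ℝ ∞ (partialD α φ) := by
  have h1 : ContDiff ℝ ∞ (iteratedFDeriv ℝ k φ) :=
    h.iteratedFDeriv_right (m := ∞) (by norm_cast)
  exact (ContinuousMultilinearMap.apply ℝ (fun _ : Fin k => E n) ℝ
    (fun i => EuclideanSpace.single (α i) 1)).contDiff.comp h1

theorem partialD_cons {k : ℕ} (j : Fin n) (α : Fin k → Fin n) {φ : E n → ℝ}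
    (h : ContDiff ℝ ∞ φ) :
    partialD (Fin.cons j α : Fin (k + 1) → Fin n) φ = pd j (partialD α φ) := by
  funext x
  have h1 : DifferentiableAt ℝ (iteratedFDeriv ℝ k φ) x :=
    (h.differentiable_iteratedFDeriv (by norm_cast; exact WithTop.coe_lt_top _)) x
  unfold partialD pd
  rw [iteratedFDeriv_succ_apply_left]
  have h2 := ((ContinuousMultilinearMap.apply ℝ (fun _ : Fin k => E n) ℝ
    (fun i => EuclideanSpace.single (α i) 1)).hasFDerivAt.comp x h1.hasFDerivAt).fderiv
  have h3 := congrArg (fun T : E n →L[ℝ] ℝ => T (EuclideanSpace.single j 1)) h2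
  have h4 : (Fin.tail fun i : Fin (k + 1) => (EuclideanSpace.single
      ((Fin.cons j α : Fin (k + 1) → Fin n) i) 1 : E n)) =
      fun i => EuclideanSpace.single (α i) 1 := by
    funext i; simp [Fin.tail]
  rw [h4]
  simpa [Function.comp_def] using h3.symm

theorem pd_comm (i j : Fin n) {φ : E n → ℝ} (h : ContDiff ℝ ∞ φ) :
    pd i (pd j φ) = pd j (pd i φ) := by
  funext x
  have h1 : IsSymmSndFDerivAt ℝ φ x :=
    h.contDiffAt.isSymmSndFDerivAt (by simp; norm_cast)
  have hd : DifferentiableAt ℝ (fderiv ℝ φ) x :=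
    ((h.fderiv_right (m := ∞) (by norm_cast)).differentiable (by simp)) x
  have key : ∀ i j : Fin n, pd i (pd j φ) x =
      fderiv ℝ (fderiv ℝ φ) x (EuclideanSpace.single i 1) (EuclideanSpace.single j 1) := by
    intro i j
    unfold pd
    rw [fderiv_clm_apply hd (differentiableAt_const _)]
    simp
  rw [key, key, h1.eq]

theorem partialD_pd {k : ℕ} (j : Fin n) (α : Fin k → Fin n) {φ : E n → ℝ} (h : ContDiff ℝ ∞ φ) :
    partialD α (pd j φ) = pd j (partialD α φ) := by
  induction k with
  | zero => simp only [partialD_nil]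
  | succ k ih =>
    rw [← Fin.cons_self_tail α, partialD_cons _ _ (contDiff_pd j h), partialD_cons _ _ h, ih,
      pd_comm _ _ (contDiff_partialD _ h)]

theorem partialD_one (α : Fin 1 → Fin n) {φ : E n → ℝ} (h : ContDiff ℝ ∞ φ) :
    partialD α φ = pd (α 0) φ := by
  rw [← Fin.cons_self_tail α, partialD_cons _ _ h, partialD_nil]
  rfl

/-- `f` is the weak derivative `∂_j u`. -/
def HasWeakPD (j : Fin n) (u f : E n → ℝ) : Prop := HasWeakDeriv (fun _ : Fin 1 => j) u f

theorem hasWeakPD_iff {j : Fin n} {u f : E n → ℝ} : HasWeakPD j u f ↔ LocallyIntegrable u ∧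
    LocallyIntegrable f ∧ ∀ φ : E n → ℝ, ContDiff ℝ ∞ φ → HasCompactSupport φ →
      ∫ x, u x * pd j φ x = -∫ x, f x * φ x := by
  constructor
  · intro h
    refine ⟨h.1, h.2, fun φ hφ hc => ?_⟩
    have := h.3 φ hφ hc
    rwa [partialD_one _ hφ, pow_one, neg_one_mul] at this
  · rintro ⟨h1, h2, h3⟩
    refine ⟨h1, h2, fun φ hφ hc => ?_⟩
    rw [partialD_one _ hφ, pow_one, neg_one_mul]
    exact h3 φ hφ hc

theorem HasWeakPD.integral_eq {j : Fin n} {u f : E n → ℝ} (h : HasWeakPD j u f) {φ : E n → ℝ}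
    (hφ : ContDiff ℝ ∞ φ) (hc : HasCompactSupport φ) :
    ∫ x, u x * pd j φ x = -∫ x, f x * φ x := (hasWeakPD_iff.1 h).2.2 φ hφ hc

theorem hasWeakDeriv_nil (α : Fin 0 → Fin n) {u : E n → ℝ} (hu : LocallyIntegrable u) :
    HasWeakDeriv α u u := ⟨hu, hu, fun φ _ _ => by simp [partialD_nil]⟩

/-- Together with the next three lemmas: since derivatives of test functions commute, the letter j
may be attached or removed both as the last and as the first derivative taken of u. -/
theorem HasWeakDeriv.cons {k : ℕ} {j : Fin n} {α : Fin k → Fin n} {u f f' : E n → ℝ}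
    (h : HasWeakDeriv α u f) (h' : HasWeakPD j f f') :
    HasWeakDeriv (Fin.cons j α : Fin (k + 1) → Fin n) u f' := by
  refine ⟨h.1, h'.2, fun φ hφ hc => ?_⟩
  rw [partialD_cons _ _ hφ, ← partialD_pd _ _ hφ, h.3 _ (contDiff_pd j hφ)
    (hasCompactSupport_pd j hc), h'.integral_eq hφ hc, pow_succ]
  ring

theorem HasWeakDeriv.pd_of_cons {k : ℕ} {j : Fin n} {α : Fin k → Fin n} {u f f' : E n → ℝ}
    (h : HasWeakDeriv α u f) (h' : HasWeakDeriv (Fin.cons j α : Fin (k + 1) → Fin n) u f') :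
    HasWeakPD j f f' := by
  refine hasWeakPD_iff.2 ⟨h.2, h'.2, fun φ hφ hc => ?_⟩
  have h1 := h'.3 φ hφ hc
  rw [partialD_cons _ _ hφ, ← partialD_pd _ _ hφ, h.3 _ (contDiff_pd j hφ)
    (hasCompactSupport_pd j hc), pow_succ] at h1
  have h2 : ((-1 : ℝ) ^ k) ≠ 0 := pow_ne_zero _ (by norm_num)
  apply mul_left_cancel₀ h2
  rw [h1]; ring

theorem HasWeakPD.trans {k : ℕ} {j : Fin n} {α : Fin k → Fin n} {u f f' : E n → ℝ}
    (h : HasWeakPD j u f) (h' : HasWeakDeriv α f f') :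
    HasWeakDeriv (Fin.cons j α : Fin (k + 1) → Fin n) u f' := by
  refine ⟨h.1, h'.2, fun φ hφ hc => ?_⟩
  rw [partialD_cons _ _ hφ, h.integral_eq (contDiff_partialD _ hφ)
    (hasCompactSupport_partialD _ hc), h'.3 _ hφ hc, pow_succ]
  ring

theorem HasWeakPD.of_cons {k : ℕ} {j : Fin n} {α : Fin k → Fin n} {u f f' : E n → ℝ}
    (h : HasWeakPD j u f) (h' : HasWeakDeriv (Fin.cons j α : Fin (k + 1) → Fin n) u f') :
    HasWeakDeriv α f f' := by
  refine ⟨h.2, h'.2, fun φ hφ hc => ?_⟩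
  have h1 := h'.3 φ hφ hc
  rw [partialD_cons _ _ hφ, h.integral_eq (contDiff_partialD _ hφ)
    (hasCompactSupport_partialD _ hc), pow_succ] at h1
  linarith

theorem ae_eq_of_integral_mul_eq {f f' : E n → ℝ} (hf : LocallyIntegrable f)
    (hf' : LocallyIntegrable f') (h : ∀ φ : E n → ℝ, ContDiff ℝ ∞ φ → HasCompactSupport φ →
      ∫ x, f x * φ x = ∫ x, f' x * φ x) : f =ᵐ[volume] f' := by
  have h1 := ae_eq_zero_of_integral_contDiff_smul_eq_zero (μ := volume) (hf.sub hf') (by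
    intro φ hφ hc
    have := h φ hφ hc
    simp only [Pi.sub_apply, smul_eq_mul, mul_sub]
    rw [integral_sub]
    · simp only [mul_comm (φ _)]
      rw [this, sub_self]
    · simpa only [mul_comm] using integrable_mul_test hf hφ.continuous hc
    · simpa only [mul_comm] using integrable_mul_test hf' hφ.continuous hc)
  filter_upwards [h1] with x hx
  simpa [sub_eq_zero] using hx

theorem HasWeakDeriv.unique {k : ℕ} {α : Fin k → Fin n} {u f f' : E n → ℝ}
    (h : HasWeakDeriv α u f) (h' : HasWeakDeriv α u f') : f =ᵐ[volume] f' := by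
  refine ae_eq_of_integral_mul_eq h.2 h'.2 fun φ hφ hc => ?_
  have h2 : ((-1 : ℝ) ^ k) ≠ 0 := pow_ne_zero _ (by norm_num)
  apply mul_left_cancel₀ h2
  rw [← h.3 φ hφ hc, ← h'.3 φ hφ hc]

theorem HasWeakDeriv.unique_L2 {k : ℕ} {α : Fin k → Fin n} {u : E n → ℝ} {f f' : L2 n}
    (h : HasWeakDeriv α u f) (h' : HasWeakDeriv α u f') : f = f' := Lp.ext (h.unique h')

theorem locallyIntegrable_L2 (u : L2 n) : LocallyIntegrable u volume :=
  (Lp.memLp u).locallyIntegrable (by norm_num)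

theorem memLp_test {χ : E n → ℝ} (hχ : Continuous χ) (hc : HasCompactSupport χ) (q : ℝ≥0∞) :
    MemLp χ q volume := hχ.memLp_of_hasCompactSupport hc

/-- A continuous function with compact support as an element of `L²`. -/
def testL2 {χ : E n → ℝ} (hχ : Continuous χ) (hc : HasCompactSupport χ) : L2 n :=
  (memLp_test hχ hc 2).toLp χ

theorem inner_testL2 {χ : E n → ℝ} (hχ : Continuous χ) (hc : HasCompactSupport χ) (u : L2 n) :
    inner ℝ (testL2 hχ hc) u = ∫ x, u x * χ x := by
  rw [L2.inner_def]
  refine integral_congr_ae ?_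
  filter_upwards [(memLp_test hχ hc 2).coeFn_toLp] with x hx
  simp only [testL2, hx, RCLike.inner_apply, conj_trivial]

theorem continuous_integral_test {χ : E n → ℝ} (hχ : Continuous χ) (hc : HasCompactSupport χ) :
    Continuous fun u : L2 n => ∫ x, u x * χ x := by
  simp only [← inner_testL2 hχ hc]
  fun_prop

/-- For L² functions local integrability is automatic, and each test function imposes one equation
between L²-continuous functionals. -/
theorem isClosed_hasWeakDeriv {k : ℕ} (α : Fin k → Fin n) :
    IsClosed {q : L2 n × L2 n | HasWeakDeriv α q.1 q.2} := by
  have : {q : L2 n × L2 n | HasWeakDeriv α q.1 q.2} = ⋂ (φ : E n → ℝ) (_ : ContDiff ℝ ∞ φ)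
      (_ : HasCompactSupport φ), {q : L2 n × L2 n |
        ∫ x, q.1 x * partialD α φ x = (-1) ^ k * ∫ x, q.2 x * φ x} := by
    ext q
    simp only [mem_ofPred_eq, mem_iInter]
    exact ⟨fun h => h.3, fun h => ⟨locallyIntegrable_L2 _, locallyIntegrable_L2 _, h⟩⟩
  rw [this]
  refine isClosed_iInter fun φ => isClosed_iInter fun hφ => isClosed_iInter fun hc => ?_
  refine isClosed_eq ?_ ?_
  · exact (continuous_integral_test (continuous_partialD α hφ)
      (hasCompactSupport_partialD α hc)).comp continuous_fst
  · exact continuous_const.mul ((continuous_integral_test hφ.continuous hc).comp continuous_snd)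

/-- Integration by parts for test functions. -/
theorem integral_mul_pd {φ χ : E n → ℝ} (hφ : ContDiff ℝ ∞ φ) (hχ : ContDiff ℝ ∞ χ)
    (hc : HasCompactSupport χ) (j : Fin n) :
    ∫ x, φ x * pd j χ x = -∫ x, pd j φ x * χ x := by
  unfold pd
  have hd : ∀ {f : E n → ℝ}, ContDiff ℝ ∞ f → Continuous fun x =>
      fderiv ℝ f x (EuclideanSpace.single j 1) := fun hf => (contDiff_pd j hf).continuous
  refine integral_mul_fderiv_eq_neg_fderiv_mul_of_integrable ?_ ?_ ?_
    (fun x _ => hφ.differentiable (by simp) x) (fun x _ => hχ.differentiable (by simp) x)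
  · exact ((hd hφ).mul hχ.continuous).integrable_of_hasCompactSupport hc.mul_left
  · exact (hφ.continuous.mul (hd hχ)).integrable_of_hasCompactSupport
      (hasCompactSupport_pd j hc).mul_left
  · exact (hφ.continuous.mul hχ.continuous).integrable_of_hasCompactSupport hc.mul_left

theorem hasWeakPD_of_contDiff {φ : E n → ℝ} (hφ : ContDiff ℝ ∞ φ) (j : Fin n) :
    HasWeakPD j φ (pd j φ) :=
  hasWeakPD_iff.2 ⟨hφ.continuous.locallyIntegrable, (contDiff_pd j hφ).continuous.locallyIntegrable,
    fun _ hχ hc => integral_mul_pd hφ hχ hc j⟩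

/-- Product rule with a smooth factor. -/
theorem HasWeakPD.smooth_mul {j : Fin n} {u f χ : E n → ℝ} (h : HasWeakPD j u f)
    (hχ : ContDiff ℝ ∞ χ) :
    HasWeakPD j (fun x => χ x * u x) (fun x => χ x * f x + pd j χ x * u x) := by
  have hli : ∀ {χ v : E n → ℝ}, Continuous χ → LocallyIntegrable v →
      LocallyIntegrable fun x => χ x * v x := fun hχ hv =>
    locallyIntegrableOn_univ.1 (LocallyIntegrableOn.continuousOn_mul
      (locallyIntegrableOn_univ.2 hv) hχ.continuousOn isOpen_univ.isLocallyClosed)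
  have hpχ := (contDiff_pd j hχ).continuous
  refine hasWeakPD_iff.2 ⟨hli hχ.continuous h.1,
    (hli hχ.continuous h.2).add (hli hpχ h.1), fun φ hφ hc => ?_⟩
  have h1 := h.integral_eq (hχ.mul hφ) hc.mul_left
  have h2 : ∀ x, pd j (fun x => χ x * φ x) x = χ x * pd j φ x + pd j χ x * φ x := by
    intro x
    have := fderiv_fun_mul (hχ.differentiable (by simp) x) (hφ.differentiable (by simp) x)
    simp only [pd, this, add_apply, smul_apply, smul_eq_mul]
    ring
  have i1 : Integrable fun x => u x * (χ x * pd j φ x) :=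
    integrable_mul_test h.1 (hχ.continuous.mul (contDiff_pd j hφ).continuous)
      (hasCompactSupport_pd j hc).mul_left
  have i2 : Integrable fun x => u x * (pd j χ x * φ x) :=
    integrable_mul_test h.1 (hpχ.mul hφ.continuous) hc.mul_left
  have i3 : Integrable fun x => f x * (χ x * φ x) :=
    integrable_mul_test h.2 (hχ.continuous.mul hφ.continuous) hc.mul_left
  have e1 : ∫ x, u x * pd j (fun x => χ x * φ x) x =
      (∫ x, u x * (χ x * pd j φ x)) + ∫ x, u x * (pd j χ x * φ x) := by
    rw [← integral_add i1 i2]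
    exact integral_congr_ae (Eventually.of_forall fun x => by simp only [h2]; ring)
  have e2 : ∫ x, (χ x * f x + pd j χ x * u x) * φ x =
      (∫ x, f x * (χ x * φ x)) + ∫ x, u x * (pd j χ x * φ x) := by
    rw [← integral_add i3 i2]
    exact integral_congr_ae (Eventually.of_forall fun x => by ring)
  have e3 : ∫ x, χ x * u x * pd j φ x = ∫ x, u x * (χ x * pd j φ x) :=
    integral_congr_ae (Eventually.of_forall fun x => by ring)
  rw [e2, e3]
  rw [e1] at h1
  linarith

end Weak

end MGT

end

noncomputable section

namespace MGT

/-! ## Translations and mollification in `L²` -/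

section Mollify

variable {n : ℕ}

/-- The translation `u ↦ u(· + y)` of `L²(ℝⁿ)`. -/
def shift (y : E n) : L2 n →ₗᵢ[ℝ] L2 n :=
  Lp.compMeasurePreservingₗᵢ ℝ (fun x => x + y) (measurePreserving_add_right volume y)

theorem coeFn_shift (y : E n) (u : L2 n) : shift y u =ᵐ[volume] fun x => u (x + y) :=
  Lp.coeFn_compMeasurePreserving u (measurePreserving_add_right volume y)

theorem continuous_shift (u : L2 n) : Continuous fun y => shift y u := by
  have hg : Continuous fun y : E n => (⟨fun x => x + y, by fun_prop⟩ : C(E n, E n)) :=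
    ContinuousMap.continuous_of_continuous_uncurry _ (by
      simp only [Function.uncurry_def, ContinuousMap.coe_mk]; fun_prop)
  exact Continuous.compMeasurePreservingLp (p := 2) (f := fun _ : E n => u) continuous_const hg
    (fun y => measurePreserving_add_right volume y) (by norm_num)

theorem shift_zero (u : L2 n) : shift 0 u = u := by
  refine Lp.ext ?_
  filter_upwards [coeFn_shift 0 u] with x hx
  rw [hx, add_zero]

theorem shift_shift (y z : E n) (u : L2 n) : shift y (shift z u) = shift (y + z) u := by
  refine Lp.ext ?_
  have h := (measurePreserving_add_right (volume : Measure (E n)) y).quasiMeasurePreserving.ae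
    (coeFn_shift z u)
  filter_upwards [coeFn_shift y (shift z u), coeFn_shift (y + z) u, h] with x h1 h2 h3
  rw [h1, h2, h3, add_assoc]

theorem integral_shift_mul (y : E n) (u : L2 n) (χ : E n → ℝ) :
    ∫ x, shift y u x * χ x = ∫ x, u x * χ (x - y) := by
  have h1 : ∫ x, shift y u x * χ x = ∫ x, u (x + y) * χ (x + y - y) := by
    refine integral_congr_ae ?_
    filter_upwards [coeFn_shift y u] with x hx
    rw [hx, add_sub_cancel_right]
  rw [h1]
  exact integral_add_right_eq_self (fun x => u x * χ (x - y)) y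

theorem inner_shift_left (y : E n) (u v : L2 n) :
    inner ℝ (shift y u) v = inner ℝ u (shift (-y) v) := by
  rw [← (shift (-y)).inner_map_map (shift y u) v, shift_shift, neg_add_cancel, shift_zero]

/-- Convolution of `u` with the kernel `ρ`. -/
def moll (ρ u : E n → ℝ) : E n → ℝ :=
  convolution u ρ (ContinuousLinearMap.lsmul ℝ ℝ) volume

theorem moll_apply (ρ u : E n → ℝ) (x : E n) : moll ρ u x = ∫ t, u t * ρ (x - t) := rfl

theorem moll_apply' (ρ u : E n → ℝ) (x : E n) : moll ρ u x = ∫ t, ρ t * u (x - t) := by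
  unfold moll
  rw [convolution_lsmul_swap]
  simp only [smul_eq_mul, mul_comm]

theorem contDiff_moll {ρ u : E n → ℝ} (hρ : ContDiff ℝ ∞ ρ) (hc : HasCompactSupport ρ)
    (hu : LocallyIntegrable u) : ContDiff ℝ ∞ (moll ρ u) :=
  hc.contDiff_convolution_right _ hu hρ

/-- The derivative falls on ρ, and t ↦ ρ(x - t) is a test function; the sign from reflecting ρ
cancels the sign in the definition of the weak derivative. -/
theorem pd_moll {ρ u f : E n → ℝ} {j : Fin n} (hρ : ContDiff ℝ ∞ ρ) (hc : HasCompactSupport ρ)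
    (h : HasWeakPD j u f) : pd j (moll ρ u) = moll ρ f := by
  funext x
  have hρ1 : ContDiff ℝ 1 ρ := hρ.of_le (by norm_cast)
  have h1 : pd j (moll ρ u) x = ∫ t, u t * pd j ρ (x - t) := by
    have hd := hc.hasFDerivAt_convolution_right (ContinuousLinearMap.lsmul ℝ ℝ) h.1 hρ1 x
    unfold pd moll
    rw [hd.fderiv, convolution_precompR_apply _ h.1 (hc.fderiv ℝ)
      (hρ1.continuous_fderiv one_ne_zero)]
    rfl
  have hχ : ContDiff ℝ ∞ fun t => ρ (x - t) := hρ.comp (contDiff_const.sub contDiff_id)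
  have hχc : HasCompactSupport fun t => ρ (x - t) := hc.comp_homeomorph (Homeomorph.subLeft x)
  have h2 : ∀ t, pd j (fun t => ρ (x - t)) t = -pd j ρ (x - t) := by
    intro t
    have hd : HasFDerivAt (fun t => ρ (x - t))
        ((fderiv ℝ ρ (x - t)).comp (-ContinuousLinearMap.id ℝ (E n))) t :=
      ((hρ.differentiable (by simp) (x - t)).hasFDerivAt).comp t
        ((hasFDerivAt_id t).const_sub x)
    unfold pd
    rw [hd.fderiv]
    simp
  have h3 := h.integral_eq hχ hχc
  simp only [h2, mul_neg, integral_neg, neg_inj] at h3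
  rw [h1, h3, moll_apply]

theorem integrable_smul_shift {ρ : E n → ℝ} (hρ : Continuous ρ) (hc : HasCompactSupport ρ)
    (u : L2 n) : Integrable fun t => ρ t • shift (-t) u := by
  refine Continuous.integrable_of_hasCompactSupport ?_ hc.smul_right
  exact hρ.smul ((continuous_shift u).comp continuous_neg)

/-- Identifies the pointwise convolution with a Bochner average of translates, so that strong
continuity of translations in L² controls the mollification error. Integrability of u justifies
Fubini's theorem, after testing with φ. -/
theorem coeFn_integral_smul_shift {ρ : E n → ℝ} (hρ : Continuous ρ) (hc : HasCompactSupport ρ)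
    (u : L2 n) (hu : Integrable u) :
    (∫ t, ρ t • shift (-t) u : L2 n) =ᵐ[volume] moll ρ u := by
  have hρi : Integrable ρ := hρ.integrable_of_hasCompactSupport hc
  have hconv := hρi.convolution_integrand (ContinuousLinearMap.lsmul ℝ ℝ) hu
  have hm : moll ρ u = convolution ρ u (ContinuousLinearMap.lsmul ℝ ℝ) volume := by
    funext x; rw [moll_apply']; rfl
  refine ae_eq_of_integral_mul_eq (locallyIntegrable_L2 _) ?_ fun φ hφ hφc => ?_
  · rw [hm]
    exact (hρi.integrable_convolution _ hu).locallyIntegrable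
  rw [← inner_testL2 hφ.continuous hφc,
    ← integral_inner (integrable_smul_shift hρ hc u) (testL2 hφ.continuous hφc)]
  simp only [real_inner_smul_right, inner_testL2, integral_shift_mul, moll_apply']
  obtain ⟨C, hC⟩ := hφ.continuous.bounded_above_of_compact_support hφc
  have h_int : Integrable (fun q : E n × E n => (ρ q.2 * u (q.1 - q.2)) * φ q.1)
      (volume.prod volume) := by
    have := hconv.bdd_mul (c := C) (f := fun q : E n × E n => φ q.1)
      (hφ.continuous.comp continuous_fst).aestronglyMeasurable
      (Eventually.of_forall fun q => hC q.1)
    refine this.congr (Eventually.of_forall fun q => ?_)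
    simp [mul_comm]
  have hsw := integral_integral_swap (f := fun x t => (ρ t * u (x - t)) * φ x) h_int
  simp only [integral_mul_const] at hsw
  rw [hsw]
  refine integral_congr_ae (Eventually.of_forall fun t => ?_)
  simp only [mul_assoc, integral_const_mul]
  congr 1
  have := integral_sub_right_eq_self (fun x => u x * φ (x + t)) t (μ := volume)
  simp only [sub_add_cancel] at this
  simp only [this, sub_neg_eq_add]

/-- The mollification is an average of translates of u by vectors shorter than `φ.rOut`, each of
them within ε of u. -/
theorem exists_moll_close (u : L2 n) (hu : Integrable u) {ε : ℝ} (hε : 0 < ε) :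
    ∃ δ > 0, ∀ φ : ContDiffBump (0 : E n), φ.rOut < δ →
      eLpNorm (moll (φ.normed volume) u - (u : E n → ℝ)) 2 volume ≤ ENNReal.ofReal ε := by
  have hcont : Tendsto (fun t : E n => shift (-t) u) (𝓝 0) (𝓝 u) := by
    have := ((continuous_shift u).comp continuous_neg).tendsto (0 : E n)
    simpa [Function.comp_def, shift_zero] using this
  obtain ⟨δ, hδ, hb⟩ := Metric.tendsto_nhds_nhds.1 hcont ε hε
  refine ⟨δ, hδ, fun φ hφ => ?_⟩
  have hρ := φ.continuous_normed (μ := (volume : Measure (E n)))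
  have hc := φ.hasCompactSupport_normed (μ := (volume : Measure (E n)))
  set ρ := φ.normed (volume : Measure (E n)) with hρdef
  set w : L2 n := ∫ t, ρ t • shift (-t) u with hw
  have hρi : Integrable ρ := hρ.integrable_of_hasCompactSupport hc
  have hρ1 : ∫ t, ρ t = 1 := φ.integral_normed
  have hwu : w - u = ∫ t, ρ t • (shift (-t) u - u) := by
    simp only [smul_sub]
    rw [integral_sub (integrable_smul_shift hρ hc u) (hρi.smul_const u), integral_smul_const, hρ1,
      one_smul]
  have hnorm : ‖w - u‖ ≤ ε := by
    rw [hwu]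
    calc _ ≤ ∫ t, ρ t * ε := by
          refine norm_integral_le_of_norm_le (hρi.mul_const ε) (Eventually.of_forall fun t => ?_)
          have h0 : 0 ≤ ρ t := φ.nonneg_normed t
          rw [norm_smul, Real.norm_of_nonneg h0]
          by_cases ht : t ∈ Metric.ball (0 : E n) φ.rOut
          · refine mul_le_mul_of_nonneg_left ?_ h0
            rw [← dist_eq_norm]
            exact (hb (lt_trans (by simpa using ht) hφ)).le
          · have : ρ t = 0 := by
              rw [← φ.support_normed_eq (μ := (volume : Measure (E n)))] at ht
              simpa using ht
            simp [this]
      _ = ε := by rw [integral_mul_const, hρ1, one_mul]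
  have hae : moll ρ u - (u : E n → ℝ) =ᵐ[volume] (w - u : L2 n) := by
    filter_upwards [coeFn_integral_smul_shift hρ hc u hu, Lp.coeFn_sub w u] with x h1 h2
    rw [h2, Pi.sub_apply, Pi.sub_apply, h1]
  rw [eLpNorm_congr_ae hae, ← Lp.enorm_def, ← ofReal_norm]
  exact ENNReal.ofReal_le_ofReal hnorm

theorem moll_congr {ρ u u' : E n → ℝ} (h : u =ᵐ[volume] u') : moll ρ u = moll ρ u' := by
  funext x
  rw [moll_apply, moll_apply]
  exact integral_congr_ae (h.mono fun t ht => by simp only [ht])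

theorem exists_moll_close_of_memLp {u : E n → ℝ} (hu : Integrable u) (hu2 : MemLp u 2) {ε : ℝ}
    (hε : 0 < ε) : ∃ δ > 0, ∀ φ : ContDiffBump (0 : E n), φ.rOut < δ →
      eLpNorm (moll (φ.normed volume) u - u) 2 volume ≤ ENNReal.ofReal ε := by
  obtain ⟨δ, hδ, h⟩ := exists_moll_close (hu2.toLp u) (hu.congr hu2.coeFn_toLp.symm) hε
  refine ⟨δ, hδ, fun φ hφ => ?_⟩
  have := h φ hφ
  rw [moll_congr hu2.coeFn_toLp] at this
  refine le_of_eq_of_le (eLpNorm_congr_ae ?_) this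
  filter_upwards [hu2.coeFn_toLp] with x hx
  simp [hx]

/-- Approximation of a compactly supported function and its gradient by test functions. -/
theorem exists_test_close_of_hasCompactSupport {u : E n → ℝ} {f : Fin n → E n → ℝ}
    (hc : HasCompactSupport u) (hu : Integrable u) (hu2 : MemLp u 2)
    (hf : ∀ j, Integrable (f j)) (hf2 : ∀ j, MemLp (f j) 2) (h : ∀ j, HasWeakPD j u (f j))
    {ε : ℝ} (hε : 0 < ε) :
    ∃ φ : E n → ℝ, ContDiff ℝ ∞ φ ∧ HasCompactSupport φ ∧
      eLpNorm (φ - u) 2 volume ≤ ENNReal.ofReal ε ∧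
      ∀ j, eLpNorm (pd j φ - f j) 2 volume ≤ ENNReal.ofReal ε := by
  obtain ⟨δ, hδ, h0⟩ := exists_moll_close_of_memLp hu hu2 hε
  choose δ' hδ' h1 using fun j => exists_moll_close_of_memLp (hf j) (hf2 j) hε
  obtain ⟨r, hr, hrδ, hrδ'⟩ : ∃ r > 0, r < δ ∧ ∀ j, r < δ' j := by
    have h2 : ∀ᶠ r : ℝ in 𝓝[>] 0, 0 < r ∧ r < δ ∧ ∀ j, r < δ' j := by
      refine eventually_and.2 ⟨self_mem_nhdsWithin, eventually_and.2 ⟨?_, eventually_all.2 ?_⟩⟩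
      · exact nhdsWithin_le_nhds (Iio_mem_nhds hδ)
      · exact fun j => nhdsWithin_le_nhds (Iio_mem_nhds (hδ' j))
    obtain ⟨r, h3⟩ := h2.exists
    exact ⟨r, h3⟩
  let φ : ContDiffBump (0 : E n) := ⟨r / 2, r, half_pos hr, half_lt_self hr⟩
  have hφ : ContDiff ℝ ∞ (φ.normed (volume : Measure (E n))) := φ.contDiff_normed
  have hφc := φ.hasCompactSupport_normed (μ := (volume : Measure (E n)))
  refine ⟨moll (φ.normed volume) u, contDiff_moll hφ hφc hu.locallyIntegrable,
    HasCompactSupport.convolution _ hc hφc, h0 φ hrδ, fun j => ?_⟩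
  rw [pd_moll hφ hφc (h j)]
  exact h1 j φ (hrδ' j)

end Mollify

end MGT

end

noncomputable section

namespace MGT

/-! ## Density of test functions and the Sobolev inequality -/

section Density

variable {n : ℕ}

/-- The standard bump function. -/
def bump (n : ℕ) : ContDiffBump (0 : E n) := ⟨1, 2, one_pos, one_lt_two⟩

/-- The cutoff at scale `r`: equal to `1` on the ball of radius `r`, and to `0` outside that of
radius `2 r`. -/
def cutoff (n : ℕ) (r : ℝ) (x : E n) : ℝ := bump n (r⁻¹ • x)

theorem contDiff_cutoff (r : ℝ) : ContDiff ℝ ∞ (cutoff n r) :=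
  (bump n).contDiff.comp (contDiff_id.const_smul r⁻¹)

theorem hasCompactSupport_cutoff {r : ℝ} (hr : 0 < r) : HasCompactSupport (cutoff n r) :=
  (bump n).hasCompactSupport.comp_homeomorph (Homeomorph.smulOfNeZero r⁻¹ (inv_ne_zero hr.ne'))

theorem cutoff_nonneg (r : ℝ) (x : E n) : 0 ≤ cutoff n r x := (bump n).nonneg

theorem cutoff_le_one (r : ℝ) (x : E n) : cutoff n r x ≤ 1 := (bump n).le_one

theorem cutoff_eq_one {r : ℝ} (hr : 0 < r) {x : E n} (hx : ‖x‖ ≤ r) : cutoff n r x = 1 := by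
  refine (bump n).one_of_mem_closedBall ?_
  rw [mem_closedBall_zero_iff, norm_smul, norm_inv, Real.norm_of_nonneg hr.le]
  change r⁻¹ * ‖x‖ ≤ 1
  rwa [inv_mul_le_iff₀ hr, mul_one]

theorem cutoff_eq_zero {r : ℝ} (hr : 0 < r) {x : E n} (hx : 2 * r ≤ ‖x‖) : cutoff n r x = 0 := by
  refine (bump n).zero_of_le_dist ?_
  rw [dist_zero_right, norm_smul, norm_inv, Real.norm_of_nonneg hr.le]
  change 2 ≤ r⁻¹ * ‖x‖
  rw [le_inv_mul_iff₀ hr]; linarith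

theorem pd_cutoff (r : ℝ) (j : Fin n) (x : E n) :
    pd j (cutoff n r) x = r⁻¹ * pd j (bump n) (r⁻¹ • x) := by
  have h : HasFDerivAt (cutoff n r)
      ((fderiv ℝ (bump n) (r⁻¹ • x)).comp (r⁻¹ • ContinuousLinearMap.id ℝ (E n))) x :=
    (((bump n).contDiff (n := 1)).differentiable one_ne_zero _).hasFDerivAt.comp x
      ((hasFDerivAt_id x).const_smul r⁻¹)
  unfold pd
  rw [h.fderiv]
  simp

theorem exists_pd_cutoff_le (n : ℕ) :
    ∃ C : ℝ, 0 ≤ C ∧ ∀ r > 0, ∀ (j : Fin n) (x : E n), |pd j (cutoff n r) x| ≤ C * r⁻¹ := by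
  have h : ∀ j : Fin n, ∃ C : ℝ, ∀ x, ‖pd j (bump n) x‖ ≤ C := fun j =>
    (contDiff_pd j (bump n).contDiff).continuous.bounded_above_of_compact_support
      (hasCompactSupport_pd j (bump n).hasCompactSupport)
  choose C hC using h
  refine ⟨∑ j, |C j|, Finset.sum_nonneg fun _ _ => abs_nonneg _, fun r hr j x => ?_⟩
  rw [pd_cutoff, abs_mul, abs_of_pos (inv_pos.2 hr), mul_comm]
  gcongr
  calc |pd j (bump n) (r⁻¹ • x)| ≤ |C j| := (hC j _).trans (le_abs_self _)
    _ ≤ _ := Finset.single_le_sum (f := fun j => |C j|) (fun _ _ => abs_nonneg _)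
      (Finset.mem_univ j)

theorem pd_cutoff_eq_zero_of_lt {r : ℝ} (hr : 0 < r) (j : Fin n) {x : E n} (hx : ‖x‖ < r) :
    pd j (cutoff n r) x = 0 := by
  have h : cutoff n r =ᶠ[𝓝 x] fun _ => 1 := by
    filter_upwards [(isOpen_lt continuous_norm continuous_const).mem_nhds hx] with y hy
    exact cutoff_eq_one hr (le_of_lt hy)
  unfold pd
  rw [h.fderiv_eq]
  simp

theorem pd_cutoff_eq_zero_of_gt {r : ℝ} (hr : 0 < r) (j : Fin n) {x : E n} (hx : 2 * r < ‖x‖) :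
    pd j (cutoff n r) x = 0 := by
  have h : cutoff n r =ᶠ[𝓝 x] fun _ => 0 := by
    filter_upwards [(isOpen_lt continuous_const continuous_norm).mem_nhds hx] with y hy
    exact cutoff_eq_zero hr (le_of_lt hy)
  unfold pd
  rw [h.fderiv_eq]
  simp

theorem tendsto_eLpNorm_tail {q : ℝ≥0∞} (hq : q ≠ ⊤) {f : E n → ℝ}
    (hf : MemLp f q) :
    Tendsto (fun k : ℕ => eLpNorm ({x | (k : ℝ) + 1 ≤ ‖x‖}.indicator f) q volume) atTop (𝓝 0) := by
  refine ENNReal.tendsto_atTop_zero.2 fun ε hε => ?_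
  obtain ⟨g, hgc, hg, hgcont, -⟩ := hf.exists_hasCompactSupport_eLpNorm_sub_le hq hε.ne'
  obtain ⟨R, hR⟩ := hgc.isCompact.isBounded.exists_norm_le
  obtain ⟨N, hN⟩ := exists_nat_gt R
  refine ⟨N, fun k hk => ?_⟩
  have e : {x : E n | (k : ℝ) + 1 ≤ ‖x‖}.indicator f =
      {x : E n | (k : ℝ) + 1 ≤ ‖x‖}.indicator (f - g) := by
    funext x
    by_cases hx : (k : ℝ) + 1 ≤ ‖x‖
    · have : g x = 0 := by
        by_contra h0
        have h1 := hR x (subset_closure (Function.mem_support.2 h0))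
        have h2 : (N : ℝ) ≤ k := by exact_mod_cast hk
        linarith
      simp [indicator, hx, this]
    · simp [indicator, hx]
  rw [e]
  exact (eLpNorm_indicator_le _).trans hg

theorem tendsto_eLpNorm_cutoff_mul_sub {f : E n → ℝ} (hf : MemLp f 2) :
    Tendsto (fun k : ℕ => eLpNorm (fun x => cutoff n (k + 1) x * f x - f x) 2 volume)
      atTop (𝓝 0) := by
  refine tendsto_of_tendsto_of_tendsto_of_le_of_le tendsto_const_nhds
    (tendsto_eLpNorm_tail (by norm_num) hf) (fun _ => zero_le) fun k => ?_
  refine eLpNorm_mono fun x => ?_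
  have hk : (0 : ℝ) < k + 1 := by positivity
  by_cases hx : (k : ℝ) + 1 ≤ ‖x‖
  · have e : cutoff n (k + 1) x * f x - f x = (cutoff n (k + 1) x - 1) * f x := by ring
    rw [e, norm_mul, indicator_of_mem (by exact hx)]
    refine mul_le_of_le_one_left (norm_nonneg _) ?_
    rw [Real.norm_eq_abs, abs_le]
    constructor <;> linarith [cutoff_nonneg (n := n) ((k : ℝ) + 1) x,
      cutoff_le_one (n := n) ((k : ℝ) + 1) x]
  · rw [cutoff_eq_one hk (not_le.1 hx).le]
    simp

theorem MemLp.cutoff_mul {f : E n → ℝ} (hf : MemLp f 2) (r : ℝ) :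
    MemLp (fun x => cutoff n r x * f x) 2 := by
  refine hf.of_le (((contDiff_cutoff r).continuous.aestronglyMeasurable).mul hf.1)
    (Eventually.of_forall fun x => ?_)
  rw [norm_mul]
  refine mul_le_of_le_one_left (norm_nonneg _) ?_
  rw [Real.norm_eq_abs, abs_le]
  constructor <;> linarith [cutoff_nonneg (n := n) r x, cutoff_le_one (n := n) r x]

/-- Approximation by test functions after a cutoff. -/
theorem eventually_exists_test_close {u : E n → ℝ} {f : Fin n → E n → ℝ}
    (hu : ∀ k : ℕ, MemLp (fun x => cutoff n (k + 1) x * u x) 2)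
    (hf : ∀ j, MemLp (f j) 2) (h : ∀ j, HasWeakPD j u (f j)) (hul : LocallyIntegrable u)
    (hlim : ∀ j, Tendsto (fun k : ℕ => eLpNorm (fun x => pd j (cutoff n (k + 1)) x * u x) 2 volume)
      atTop (𝓝 0)) {ε : ℝ} (hε : 0 < ε) :
    ∀ᶠ k : ℕ in atTop, ∃ φ : E n → ℝ, ContDiff ℝ ∞ φ ∧ HasCompactSupport φ ∧
      eLpNorm (fun x => φ x - cutoff n (k + 1) x * u x) 2 volume ≤ ENNReal.ofReal ε ∧
      ∀ j, eLpNorm (fun x => pd j φ x - f j x) 2 volume ≤ ENNReal.ofReal ε := by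
  have hε3 : 0 < ε / 3 := by positivity
  have h1 : ∀ᶠ k : ℕ in atTop, ∀ j,
      eLpNorm (fun x => pd j (cutoff n (k + 1)) x * u x) 2 volume ≤ ENNReal.ofReal (ε / 3) :=
    eventually_all.2 fun j => (ENNReal.tendsto_nhds_zero.1 (hlim j)) _ (ENNReal.ofReal_pos.2 hε3)
  have h2 : ∀ᶠ k : ℕ in atTop, ∀ j,
      eLpNorm (fun x => cutoff n (k + 1) x * f j x - f j x) 2 volume ≤ ENNReal.ofReal (ε / 3) :=
    eventually_all.2 fun j => (ENNReal.tendsto_nhds_zero.1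
      (tendsto_eLpNorm_cutoff_mul_sub (hf j))) _ (ENNReal.ofReal_pos.2 hε3)
  filter_upwards [h1, h2] with k hk1 hk2
  have hk : (0 : ℝ) < k + 1 := by positivity
  have hχ := contDiff_cutoff (n := n) ((k : ℝ) + 1)
  have hχc := hasCompactSupport_cutoff (n := n) hk
  have hm1 : ∀ j, MemLp (fun x => pd j (cutoff n (k + 1)) x * u x) 2 := fun j =>
    ⟨((contDiff_pd j hχ).continuous.aestronglyMeasurable).mul hul.aestronglyMeasurable,
      (hk1 j).trans_lt ENNReal.ofReal_lt_top⟩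
  have hm2 : ∀ j, MemLp (fun x => cutoff n (k + 1) x * f j x) 2 := fun j => MemLp.cutoff_mul (hf j) _
  obtain ⟨φ, hφ, hφc, hφ1, hφ2⟩ := exists_test_close_of_hasCompactSupport
    (u := fun x => cutoff n (k + 1) x * u x)
    (f := fun j x => cutoff n (k + 1) x * f j x + pd j (cutoff n (k + 1)) x * u x)
    hχc.mul_right
    (by simpa only [mul_comm] using integrable_mul_test hul hχ.continuous hχc) (hu k)
    (fun j => by
      have i1 := integrable_mul_test (h j).2 hχ.continuous hχc
      have i2 := integrable_mul_test hul (contDiff_pd j hχ).continuous (hasCompactSupport_pd j hχc)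
      refine (i1.add i2).congr (Eventually.of_forall fun x => ?_)
      simp only [Pi.add_apply, mul_comm])
    (fun j => (hm2 j).add (hm1 j)) (fun j => (h j).smooth_mul hχ) hε3
  refine ⟨φ, hφ, hφc, hφ1.trans (ENNReal.ofReal_le_ofReal (by linarith)), fun j => ?_⟩
  -- Three errors, ε/3 each: mollification of the truncated function, truncation of the gradient,
  -- and the derivative falling on the cutoff.
  have e : (fun x => pd j φ x - f j x) = (pd j φ - fun x => cutoff n (k + 1) x * f j x
      + pd j (cutoff n (k + 1)) x * u x) + ((fun x => cutoff n (k + 1) x * f j x - f j x) +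
        fun x => pd j (cutoff n (k + 1)) x * u x) := by
    funext x
    simp only [Pi.add_apply, Pi.sub_apply]
    ring
  have m1 : AEStronglyMeasurable (pd j φ) volume :=
    (contDiff_pd j hφ).continuous.aestronglyMeasurable
  have hsum : ENNReal.ofReal ε = ENNReal.ofReal (ε / 3) +
      (ENNReal.ofReal (ε / 3) + ENNReal.ofReal (ε / 3)) := by
    rw [← ENNReal.ofReal_add hε3.le hε3.le, ← ENNReal.ofReal_add hε3.le (by positivity)]
    congr 1; ring
  rw [e, hsum]
  refine (eLpNorm_add_le (m1.sub ((hm2 j).add (hm1 j)).1)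
    (((hm2 j).1.sub (hf j).1).add (hm1 j).1) (by norm_num)).trans ?_
  refine add_le_add (hφ2 j) ((eLpNorm_add_le ((hm2 j).1.sub (hf j).1) (hm1 j).1
    (by norm_num)).trans (add_le_add (hk2 j) (hk1 j)))

/-- Test functions are dense in `H¹`. -/
theorem exists_test_close {u : E n → ℝ} {f : Fin n → E n → ℝ} (hu : MemLp u 2)
    (hf : ∀ j, MemLp (f j) 2) (h : ∀ j, HasWeakPD j u (f j)) {ε : ℝ} (hε : 0 < ε) :
    ∃ φ : E n → ℝ, ContDiff ℝ ∞ φ ∧ HasCompactSupport φ ∧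
      eLpNorm (fun x => φ x - u x) 2 volume ≤ ENNReal.ofReal ε ∧
      ∀ j, eLpNorm (fun x => pd j φ x - f j x) 2 volume ≤ ENNReal.ofReal ε := by
  have hul : LocallyIntegrable u := hu.locallyIntegrable (by norm_num)
  have hε2 : 0 < ε / 2 := half_pos hε
  obtain ⟨C, hC0, hC⟩ := exists_pd_cutoff_le n
  have hlim : ∀ j, Tendsto (fun k : ℕ =>
      eLpNorm (fun x => pd j (cutoff n (k + 1)) x * u x) 2 volume) atTop (𝓝 0) := by
    intro j
    have h0 : Tendsto (fun k : ℕ => ENNReal.ofReal (C * ((k : ℝ) + 1)⁻¹) * eLpNorm u 2 volume)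
        atTop (𝓝 0) := by
      have h1 : Tendsto (fun k : ℕ => C * ((k : ℝ) + 1)⁻¹) atTop (𝓝 0) := by
        simpa using (tendsto_one_div_add_atTop_nhds_zero_nat (𝕜 := ℝ)).const_mul C
      simpa using ENNReal.Tendsto.mul_const (ENNReal.tendsto_ofReal h1) (Or.inr hu.2.ne)
    refine tendsto_of_tendsto_of_tendsto_of_le_of_le tendsto_const_nhds h0
      (fun _ => zero_le) fun k => ?_
    refine eLpNorm_le_mul_eLpNorm_of_ae_le_mul (Eventually.of_forall fun x => ?_) 2
    rw [norm_mul]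
    gcongr
    exact hC _ (by positivity) j x
  have h1 := eventually_exists_test_close (fun k => MemLp.cutoff_mul hu _) hf h hul hlim hε2
  have h2 := (ENNReal.tendsto_nhds_zero.1 (tendsto_eLpNorm_cutoff_mul_sub hu)) _
    (ENNReal.ofReal_pos.2 hε2)
  obtain ⟨k, ⟨φ, hφ, hφc, hφ1, hφ2⟩, hk⟩ := (h1.and h2).exists
  refine ⟨φ, hφ, hφc, ?_, fun j => (hφ2 j).trans (ENNReal.ofReal_le_ofReal (by linarith))⟩
  have e : (fun x => φ x - u x) = (fun x => φ x - cutoff n (k + 1) x * u x) +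
      fun x => cutoff n (k + 1) x * u x - u x := by
    funext x; simp
  have hm := (MemLp.cutoff_mul hu ((k : ℝ) + 1)).1
  rw [e, ← add_halves ε, ENNReal.ofReal_add hε2.le hε2.le]
  exact (eLpNorm_add_le (hφ.continuous.aestronglyMeasurable.sub hm) (hm.sub hu.1)
    (by norm_num)).trans (add_le_add hφ1 hk)

end Density

end MGT

end

/-! ### The critical exponent, gradients of test functions and potentials -/

noncomputable section

namespace MGT

section Sobolev

variable {n : ℕ}

/-- The critical Sobolev exponent `2n/(n-2)`. -/
def critExp (n : ℕ) : ℝ≥0∞ := ENNReal.ofReal (2 * n / ((n : ℝ) - 2))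

theorem critExp_ne_top (n : ℕ) : critExp n ≠ ⊤ := ENNReal.ofReal_ne_top

theorem two_le_critExp (hn : 3 ≤ n) : 2 ≤ critExp n := by
  have h3 : (3 : ℝ) ≤ n := by exact_mod_cast hn
  have h2 : (2 : ℝ≥0∞) = ENNReal.ofReal 2 := by simp
  rw [critExp, h2]
  refine ENNReal.ofReal_le_ofReal ?_
  rw [le_div_iff₀ (by linarith)]
  linarith

theorem toReal_critExp (hn : 3 ≤ n) : (critExp n).toReal = 2 * n / ((n : ℝ) - 2) := by
  have h3 : (3 : ℝ) ≤ n := by exact_mod_cast hn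
  exact ENNReal.toReal_ofReal (div_nonneg (by positivity) (by linarith))

theorem half_sub_inv_critExp (hn : 3 ≤ n) :
    1 / (2 : ℝ≥0∞).toReal - 1 / (critExp n).toReal = (n : ℝ)⁻¹ := by
  have h3 : (3 : ℝ) ≤ n := by exact_mod_cast hn
  have h4 : (n : ℝ) - 2 ≠ 0 := by linarith
  rw [toReal_critExp hn]
  simp only [ENNReal.toReal_ofNat]
  field_simp
  ring

/-- Hölder's inequality on the ball of radius R. As 1/2 - (n-2)/(2n) = 1/n, the volume enters as
|B_R|^{1/n} = R |B_1|^{1/n}; this is exactly linear in R. -/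
theorem eLpNorm_two_le_of_support {f : E n → ℝ} (hn : 3 ≤ n) (hf : AEStronglyMeasurable f volume)
    {R : ℝ} (hR : 0 ≤ R) (h0 : ∀ x, R < ‖x‖ → f x = 0) :
    eLpNorm f 2 volume ≤ eLpNorm f (critExp n) volume *
      (ENNReal.ofReal R * volume (Metric.ball (0 : E n) 1) ^ (n : ℝ)⁻¹) := by
  have hn0 : (n : ℝ) ≠ 0 := by
    have h3 : (3 : ℝ) ≤ n := by exact_mod_cast hn
    linarith
  have hs : Function.support f ⊆ Metric.closedBall 0 R := by
    intro x hx
    rw [mem_closedBall_zero_iff]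
    by_contra h
    exact hx (h0 x (not_le.1 h))
  have h1 := eLpNorm_le_eLpNorm_mul_rpow_measure_univ (two_le_critExp hn)
    (hf.restrict (s := Metric.closedBall 0 R))
  rw [half_sub_inv_critExp hn, Measure.restrict_apply_univ,
    Measure.addHaar_closedBall volume _ hR, finrank_euclideanSpace_fin,
    ENNReal.mul_rpow_of_nonneg _ _ (by positivity), ENNReal.ofReal_rpow_of_nonneg (by positivity)
      (by positivity), Real.pow_rpow_inv_natCast hR (by omega)] at h1
  rw [eLpNorm_restrict_eq_of_support_subset hs, eLpNorm_restrict_eq_of_support_subset hs] at h1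
  exact h1

/-- Gradients of test functions are dense among the square integrable gradients of functions in
`L^{2n/(n-2)}`. -/
theorem exists_test_grad_close (hn : 3 ≤ n) {ψ : E n → ℝ} {f : Fin n → E n → ℝ}
    (hψ : MemLp ψ (critExp n)) (hf : ∀ j, MemLp (f j) 2) (h : ∀ j, HasWeakPD j ψ (f j)) {ε : ℝ}
    (hε : 0 < ε) :
    ∃ φ : E n → ℝ, ContDiff ℝ ∞ φ ∧ HasCompactSupport φ ∧
      ∀ j, eLpNorm (fun x => pd j φ x - f j x) 2 volume ≤ ENNReal.ofReal ε := by
  have hψl : LocallyIntegrable ψ := hψ.locallyIntegrable (le_trans (by norm_num) (two_le_critExp hn))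
  obtain ⟨C, hC0, hC⟩ := exists_pd_cutoff_le n
  set V : ℝ≥0∞ := volume (Metric.ball (0 : E n) 1) ^ (n : ℝ)⁻¹ with hV
  have hVtop : V ≠ ⊤ := ENNReal.rpow_ne_top_of_nonneg (by positivity)
    (measure_ball_lt_top).ne
  have hcut : ∀ k : ℕ, MemLp (fun x => cutoff n (k + 1) x * ψ x) 2 := by
    intro k
    have hk : (0 : ℝ) < k + 1 := by positivity
    have hm : AEStronglyMeasurable (fun x => cutoff n (k + 1) x * ψ x) volume :=
      ((contDiff_cutoff ((k : ℝ) + 1)).continuous.aestronglyMeasurable).mul hψ.1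
    refine ⟨hm, (eLpNorm_two_le_of_support hn hm (R := 2 * (k + 1)) (by positivity)
      fun x hx => ?_).trans_lt ?_⟩
    · rw [cutoff_eq_zero hk hx.le, zero_mul]
    · refine ENNReal.mul_lt_top ?_ (ENNReal.mul_lt_top ENNReal.ofReal_lt_top hVtop.lt_top)
      refine lt_of_le_of_lt (eLpNorm_mono fun x => ?_) hψ.2
      rw [norm_mul]
      refine mul_le_of_le_one_left (norm_nonneg _) ?_
      rw [Real.norm_eq_abs, abs_le]
      constructor <;> linarith [cutoff_nonneg (n := n) ((k : ℝ) + 1) x,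
        cutoff_le_one (n := n) ((k : ℝ) + 1) x]
  have hlim : ∀ j, Tendsto (fun k : ℕ =>
      eLpNorm (fun x => pd j (cutoff n (k + 1)) x * ψ x) 2 volume) atTop (𝓝 0) := by
    intro j
    have h0 : Tendsto (fun k : ℕ => eLpNorm ({x | (k : ℝ) + 1 ≤ ‖x‖}.indicator ψ) (critExp n) volume
        * (ENNReal.ofReal (2 * C) * V)) atTop (𝓝 0) := by
      have h1 := ENNReal.Tendsto.mul_const (b := ENNReal.ofReal (2 * C) * V)
        (tendsto_eLpNorm_tail (critExp_ne_top n) hψ)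
        (Or.inr (ENNReal.mul_ne_top ENNReal.ofReal_ne_top hVtop))
      rwa [zero_mul] at h1
    refine tendsto_of_tendsto_of_tendsto_of_le_of_le tendsto_const_nhds h0
      (fun _ => zero_le) fun k => ?_
    have hk : (0 : ℝ) < k + 1 := by positivity
    have hm : AEStronglyMeasurable (fun x => pd j (cutoff n (k + 1)) x * ψ x) volume :=
      ((contDiff_pd j (contDiff_cutoff ((k : ℝ) + 1))).continuous.aestronglyMeasurable).mul hψ.1
    have h1 := eLpNorm_two_le_of_support hn hm (R := 2 * (k + 1)) (by positivity)
      fun x hx => by rw [pd_cutoff_eq_zero_of_gt hk j hx, zero_mul]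
    have h2 : eLpNorm (fun x => pd j (cutoff n (k + 1)) x * ψ x) (critExp n) volume ≤
        ENNReal.ofReal (C * ((k : ℝ) + 1)⁻¹) *
          eLpNorm ({x | (k : ℝ) + 1 ≤ ‖x‖}.indicator ψ) (critExp n) volume := by
      refine eLpNorm_le_mul_eLpNorm_of_ae_le_mul (Eventually.of_forall fun x => ?_) _
      by_cases hx : (k : ℝ) + 1 ≤ ‖x‖
      · rw [indicator_of_mem (by exact hx), norm_mul]
        gcongr
        exact hC _ hk j x
      · rw [pd_cutoff_eq_zero_of_lt hk j (not_le.1 hx), zero_mul, norm_zero]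
        positivity
    refine h1.trans ((mul_le_mul_left h2 _).trans (le_of_eq ?_))
    -- The decay C/(k+1) of the cutoff's gradient exactly offsets the factor 2(k+1) from Hölder's
    -- inequality on its support. The smallness comes only from the L^{2n/(n-2)} tail of ψ outside
    -- the ball of radius k+1.
    have h3 : ENNReal.ofReal (2 * C) = ENNReal.ofReal (C * ((k : ℝ) + 1)⁻¹) *
        ENNReal.ofReal (2 * (k + 1)) := by
      rw [← ENNReal.ofReal_mul (by positivity)]
      congr 1
      field_simp
    rw [h3]
    ring
  obtain ⟨k, φ, hφ, hφc, -, hφ2⟩ :=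
    (eventually_exists_test_close hcut hf h hψl hlim hε).exists
  exact ⟨φ, hφ, hφc, hφ2⟩

theorem norm_fderiv_le_sum (φ : E n → ℝ) (x : E n) : ‖fderiv ℝ φ x‖ ≤ ∑ j, ‖pd j φ x‖ := by
  refine ContinuousLinearMap.opNorm_le_bound _ (Finset.sum_nonneg fun _ _ => norm_nonneg _)
    fun y => ?_
  have hy : y = ∑ j, y j • (EuclideanSpace.single j 1 : E n) := by
    ext i; simp [Finset.sum_apply, Pi.single_apply]
  conv_lhs => rw [hy]
  rw [map_sum, Finset.sum_mul]
  refine (norm_sum_le _ _).trans (Finset.sum_le_sum fun j _ => ?_)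
  rw [map_smul, norm_smul, mul_comm]
  exact mul_le_mul_of_nonneg_left (PiLp.norm_apply_le y j) (norm_nonneg _)

/-- The Sobolev inequality for test functions. -/
theorem exists_sobolev_const (hn : 3 ≤ n) : ∃ C : ℝ≥0, ∀ φ : E n → ℝ, ContDiff ℝ ∞ φ →
    HasCompactSupport φ →
      eLpNorm φ (critExp n) volume ≤ C * ∑ j, eLpNorm (pd j φ) 2 volume := by
  have h3 : (3 : ℝ) ≤ n := by exact_mod_cast hn
  refine ⟨SNormLESNormFDerivOfEqConst ℝ (volume : Measure (E n)) (2 : ℝ≥0), fun φ hφ hc => ?_⟩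
  have h1 := eLpNorm_le_eLpNorm_fderiv_of_eq (μ := (volume : Measure (E n)))
    (hφ.of_le (m := 1) (by norm_cast)) hc (p := 2)
    (p' := (2 * n / ((n : ℝ) - 2)).toNNReal) (by norm_num)
    (by rw [finrank_euclideanSpace_fin]; omega) (by
      rw [finrank_euclideanSpace_fin, Real.coe_toNNReal _ (div_nonneg (by positivity)
        (by linarith))]
      have h4 : (n : ℝ) - 2 ≠ 0 := by linarith
      rw [inv_div]
      push_cast
      field_simp)
  refine h1.trans (mul_le_mul_right ?_ _)
  have hm : ∀ j, AEStronglyMeasurable (fun x => ‖pd j φ x‖) volume := fun j =>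
    (contDiff_pd j hφ).continuous.norm.aestronglyMeasurable
  calc eLpNorm (fderiv ℝ φ) ((2 : ℝ≥0) : ℝ≥0∞) volume
      ≤ eLpNorm (∑ j, fun x => ‖pd j φ x‖) 2 volume := by
        refine eLpNorm_mono_real (fun x => ?_)
        simpa using norm_fderiv_le_sum φ x
    _ ≤ ∑ j, eLpNorm (fun x => ‖pd j φ x‖) 2 volume :=
        eLpNorm_sum_le (fun j _ => hm j) (by norm_num)
    _ = _ := by simp only [eLpNorm_norm]

theorem tendsto_integral_mul_test {q : ℝ≥0∞} (hq : 1 ≤ q) {u : ℕ → E n → ℝ} {v χ : E n → ℝ}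
    (hu : ∀ k, MemLp (u k) q) (hv : MemLp v q)
    (h : Tendsto (fun k => eLpNorm (fun x => u k x - v x) q volume) atTop (𝓝 0))
    (hχ : Continuous χ) (hc : HasCompactSupport χ) :
    Tendsto (fun k => ∫ x, u k x * χ x) atTop (𝓝 (∫ x, v x * χ x)) := by
  refine tendsto_integral_of_L1' _
    (integrable_mul_test (hv.locallyIntegrable hq) hχ hc).1
    (Eventually.of_forall fun k => integrable_mul_test ((hu k).locallyIntegrable hq) hχ hc) ?_
  have : ENNReal.HolderConjugate q (ENNReal.conjExponent q) :=
    ENNReal.HolderConjugate.conjExponent hq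
  have h0 : Tendsto (fun k => eLpNorm (fun x => u k x - v x) q volume *
      eLpNorm χ (ENNReal.conjExponent q) volume) atTop (𝓝 0) := by
    simpa using ENNReal.Tendsto.mul_const h (Or.inr (memLp_test hχ hc _).2.ne)
  refine tendsto_of_tendsto_of_tendsto_of_le_of_le tendsto_const_nhds h0
    (fun _ => zero_le) fun k => ?_
  have := eLpNorm_smul_le_mul_eLpNorm (p := q) (q := ENNReal.conjExponent q) (r := 1)
    (f := χ) (φ := fun x => u k x - v x) (μ := volume) hχ.aestronglyMeasurable
    ((hu k).1.sub hv.1)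
  refine le_trans (le_of_eq (congrArg (fun F => eLpNorm F 1 volume) ?_)) this
  funext x
  simp only [Pi.sub_apply, Pi.smul_apply', smul_eq_mul, sub_mul]

/-- If the gradients of test functions converge in `L²`, then the functions converge in
`L^{2n/(n-2)}`, and the limit has the limit of the gradients as its weak gradient. -/
theorem exists_potential_of_tendsto (hn : 3 ≤ n) {φ : ℕ → E n → ℝ} {f : Fin n → E n → ℝ}
    (hφ : ∀ k, ContDiff ℝ ∞ (φ k)) (hc : ∀ k, HasCompactSupport (φ k)) (hf : ∀ j, MemLp (f j) 2)
    (h : ∀ j, Tendsto (fun k => eLpNorm (fun x => pd j (φ k) x - f j x) 2 volume) atTop (𝓝 0)) :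
    ∃ ψ : E n → ℝ, MemLp ψ (critExp n) ∧
      Tendsto (fun k => eLpNorm (fun x => φ k x - ψ x) (critExp n) volume) atTop (𝓝 0) ∧
      ∀ j, HasWeakPD j ψ (f j) := by
  obtain ⟨C, hC⟩ := exists_sobolev_const hn
  have hq1 : 1 ≤ critExp n := le_trans (by norm_num) (two_le_critExp hn)
  have : Fact (1 ≤ critExp n) := ⟨hq1⟩
  have hm : ∀ k, MemLp (φ k) (critExp n) volume := fun k => memLp_test (hφ k).continuous (hc k) _
  have hpm : ∀ k j, MemLp (pd j (φ k)) 2 volume := fun k j =>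
    memLp_test (contDiff_pd j (hφ k)).continuous (hasCompactSupport_pd j (hc k)) _
  set F : ℕ → Lp ℝ (critExp n) (volume : Measure (E n)) := fun k => (hm k).toLp (φ k)
  -- The Sobolev inequality for φ_k - φ_l turns convergence of gradients into the Cauchy property at
  -- the critical exponent.
  have hpair : ∀ k l, edist (F k) (F l) ≤ C * ∑ j, (eLpNorm (fun x => pd j (φ k) x - f j x) 2 volume
      + eLpNorm (fun x => pd j (φ l) x - f j x) 2 volume) := by
    intro k l
    rw [Lp.edist_toLp_toLp]
    refine (hC _ ((hφ k).sub (hφ l)) ((hc k).sub (hc l))).trans ?_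
    refine mul_le_mul_right (Finset.sum_le_sum fun j _ => ?_) _
    have e : pd j (φ k - φ l) = (fun x => pd j (φ k) x - f j x) - fun x => pd j (φ l) x - f j x := by
      funext x
      simp only [pd, Pi.sub_apply]
      rw [fderiv_sub ((hφ k).differentiable (by simp) x) ((hφ l).differentiable (by simp) x)]
      simp
    change eLpNorm (pd j (φ k - φ l)) 2 volume ≤ _
    rw [e]
    exact eLpNorm_sub_le ((hpm k j).1.sub (hf j).1) ((hpm l j).1.sub (hf j).1) (by norm_num)
  have hlim : Tendsto (fun k => ∑ j, eLpNorm (fun x => pd j (φ k) x - f j x) 2 volume) atTop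
      (𝓝 0) := by
    simpa using tendsto_finsetSum Finset.univ fun j _ => h j
  have hcau : CauchySeq F := by
    rw [EMetric.cauchySeq_iff]
    intro ε hε
    have h1 : Tendsto (fun q : ℕ × ℕ => (C : ℝ≥0∞) * ∑ j,
        (eLpNorm (fun x => pd j (φ q.1) x - f j x) 2 volume
        + eLpNorm (fun x => pd j (φ q.2) x - f j x) 2 volume)) atTop (𝓝 0) := by
      have h2 := (hlim.comp tendsto_fst).add (hlim.comp (tendsto_snd (f := (atTop : Filter ℕ))
        (g := (atTop : Filter ℕ))))
      have h3 := ENNReal.Tendsto.const_mul (a := (C : ℝ≥0∞)) h2 (Or.inr ENNReal.coe_ne_top)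
      rw [prod_atTop_atTop_eq] at h3
      simpa [Finset.sum_add_distrib, Function.comp_def] using h3
    have h4 := (tendsto_order.1 h1).2 ε hε
    obtain ⟨⟨N, N'⟩, hN⟩ := eventually_atTop.1 h4
    refine ⟨max N N', fun k hk l hl => (hpair k l).trans_lt (hN (k, l) ?_)⟩
    exact ⟨(le_max_left _ _).trans hk, (le_max_right _ _).trans hl⟩
  obtain ⟨ψ, hψ⟩ := cauchySeq_tendsto_of_complete hcau
  have hconv : Tendsto (fun k => eLpNorm (fun x => φ k x - ψ x) (critExp n) volume) atTop
      (𝓝 0) := by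
    have h1 := (tendsto_iff_edist_tendsto_0.1 hψ)
    refine h1.congr fun k => ?_
    rw [Lp.edist_def]
    refine eLpNorm_congr_ae ?_
    filter_upwards [(hm k).coeFn_toLp] with x hx
    simp only [F, Pi.sub_apply, hx]
  refine ⟨ψ, Lp.memLp ψ, hconv, fun j => hasWeakPD_iff.2
    ⟨(Lp.memLp ψ).locallyIntegrable hq1, (hf j).locallyIntegrable (by norm_num),
      fun χ hχ hχc => ?_⟩⟩
  have t1 := tendsto_integral_mul_test hq1 hm (Lp.memLp ψ) hconv (contDiff_pd j hχ).continuous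
    (hasCompactSupport_pd j hχc)
  have t2 := (tendsto_integral_mul_test (by norm_num) (fun k => hpm k j) (hf j) (h j)
    hχ.continuous hχc).neg
  exact tendsto_nhds_unique t1 (t2.congr fun k => (integral_mul_pd (hφ k) hχ hχc j).symm)

end Sobolev

end MGT

end

noncomputable section

namespace MGT

/-! ## The Sobolev spaces -/

section Spaces

variable {n : ℕ}

/-- The test functions with their gradients. -/
def testGraph (n : ℕ) : Set (L2 n × (Fin n → L2 n)) :=
  {q | ∃ (φ : E n → ℝ) (hφ : ContDiff ℝ ∞ φ) (hc : HasCompactSupport φ),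
    q = (testL2 hφ.continuous hc,
      fun j => testL2 (contDiff_pd j hφ).continuous (hasCompactSupport_pd j hc))}

theorem edist_testL2 {χ : E n → ℝ} (hχ : Continuous χ) (hc : HasCompactSupport χ) (u : L2 n) :
    edist (testL2 hχ hc) u = eLpNorm (fun x => χ x - u x) 2 volume := by
  rw [Lp.edist_def]
  refine eLpNorm_congr_ae ?_
  filter_upwards [(memLp_test hχ hc 2).coeFn_toLp] with x hx
  simp only [testL2, Pi.sub_apply, hx]

theorem mem_closure_testGraph {u : L2 n} {g : Fin n → L2 n} (h : ∀ j, HasWeakPD j u (g j)) :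
    (u, g) ∈ closure (testGraph n) := by
  rw [EMetric.mem_closure_iff]
  intro ε hε
  obtain ⟨r, hr0, hrε⟩ := ENNReal.lt_iff_exists_nnreal_btwn.1 hε
  have hr : 0 < (r : ℝ) := by exact_mod_cast hr0
  obtain ⟨φ, hφ, hc, h1, h2⟩ := exists_test_close (Lp.memLp u) (fun j => Lp.memLp (g j)) h hr
  refine ⟨_, ⟨φ, hφ, hc, rfl⟩, lt_of_le_of_lt ?_ hrε⟩
  rw [ENNReal.ofReal_coe_nnreal] at h1 h2
  rw [edist_comm, Prod.edist_eq, max_le_iff, edist_pi_le_iff]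
  refine ⟨?_, fun j => ?_⟩
  · change edist (testL2 hφ.continuous hc) u ≤ r
    rwa [edist_testL2]
  · change edist (testL2 (contDiff_pd j hφ).continuous (hasCompactSupport_pd j hc)) (g j) ≤ r
    rw [edist_testL2]
    exact h2 j

/-- A weak divergence may be tested with functions in `H¹`. -/
theorem IsWeakDiv.inner_eq {F : Fin n → L2 n} {f : L2 n} (h : IsWeakDiv F f) {u : L2 n}
    {g : Fin n → L2 n} (hu : ∀ j, HasWeakPD j u (g j)) :
    inner ℝ u f = -∑ j, inner ℝ (g j) (F j) := by
  have hcl : IsClosed {q : L2 n × (Fin n → L2 n) |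
      (inner ℝ q.1 f : ℝ) = -∑ j, inner ℝ (q.2 j) (F j)} := by
    refine isClosed_eq (by fun_prop) ?_
    refine Continuous.neg (continuous_finsetSum _ fun j _ => ?_)
    exact Continuous.inner ((continuous_apply j).comp continuous_snd) continuous_const
  refine closure_minimal ?_ hcl (mem_closure_testGraph hu)
  rintro _ ⟨φ, hφ, hc, rfl⟩
  simp only [mem_ofPred_eq, inner_testL2]
  exact h φ hφ hc

theorem exists_test_seq {u : E n → ℝ} {f : Fin n → E n → ℝ} (hu : MemLp u 2)
    (hf : ∀ j, MemLp (f j) 2) (h : ∀ j, HasWeakPD j u (f j)) :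
    ∃ φ : ℕ → E n → ℝ, (∀ k, ContDiff ℝ ∞ (φ k)) ∧ (∀ k, HasCompactSupport (φ k)) ∧
      Tendsto (fun k => eLpNorm (fun x => φ k x - u x) 2 volume) atTop (𝓝 0) ∧
      ∀ j, Tendsto (fun k => eLpNorm (fun x => pd j (φ k) x - f j x) 2 volume) atTop (𝓝 0) := by
  choose φ hφ hc h1 h2 using fun k : ℕ =>
    exists_test_close hu hf h (Nat.one_div_pos_of_nat (α := ℝ) (n := k))
  have h0 : Tendsto (fun k : ℕ => ENNReal.ofReal (1 / ((k : ℝ) + 1))) atTop (𝓝 0) := by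
    simpa using ENNReal.tendsto_ofReal (tendsto_one_div_add_atTop_nhds_zero_nat (𝕜 := ℝ))
  exact ⟨φ, hφ, hc, tendsto_of_tendsto_of_tendsto_of_le_of_le tendsto_const_nhds h0
    (fun _ => zero_le) h1, fun j => tendsto_of_tendsto_of_tendsto_of_le_of_le
      tendsto_const_nhds h0 (fun _ => zero_le) fun k => h2 k j⟩

/-- The Sobolev embedding of `H¹`. -/
theorem memLp_critExp (hn : 3 ≤ n) {u : E n → ℝ} {f : Fin n → E n → ℝ} (hu : MemLp u 2)
    (hf : ∀ j, MemLp (f j) 2) (h : ∀ j, HasWeakPD j u (f j)) : MemLp u (critExp n) := by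
  obtain ⟨φ, hφ, hc, h1, h2⟩ := exists_test_seq hu hf h
  obtain ⟨ψ, hψ, h3, -⟩ := exists_potential_of_tendsto hn hφ hc hf h2
  have hq1 : 1 ≤ critExp n := le_trans (by norm_num) (two_le_critExp hn)
  -- The same test functions converge to ψ at the critical exponent and to u in L²; both limits have
  -- the same integrals against test functions.
  have hae : ψ =ᵐ[volume] u := by
    refine ae_eq_of_integral_mul_eq (hψ.locallyIntegrable hq1)
      (hu.locallyIntegrable (by norm_num)) fun χ hχ hχc => ?_
    exact tendsto_nhds_unique
      (tendsto_integral_mul_test hq1 (fun k => memLp_test (hφ k).continuous (hc k) _) hψ h3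
        hχ.continuous hχc)
      (tendsto_integral_mul_test (by norm_num) (fun k => memLp_test (hφ k).continuous (hc k) _)
        hu h1 hχ.continuous hχc)
  exact (memLp_congr_ae hae).1 hψ

theorem isClosed_sobSubmodule (n m : ℕ) :
    IsClosed (sobSubmodule n m : Set (PiLp 2 (fun _ : Word n m => L2 n))) := by
  have : (sobSubmodule n m : Set (PiLp 2 (fun _ : Word n m => L2 n))) =
      ⋂ α : Word n m, (fun U : PiLp 2 (fun _ : Word n m => L2 n) => (U (Word.nil n m), U α)) ⁻¹'
        {q : L2 n × L2 n | HasWeakDeriv α.2 q.1 q.2} := by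
    ext U
    simp only [mem_iInter]
    rfl
  rw [this]
  exact isClosed_iInter fun α => (isClosed_hasWeakDeriv α.2).preimage (by fun_prop)

instance (n m : ℕ) : CompleteSpace (Sob n m) :=
  (isClosed_sobSubmodule n m).completeSpace_coe

theorem IsPotential.hasWeakPD {p : ℕ} {U : PiLp 2 (fun _ : HomWord n (p + 1) => L2 n)}
    {ψ : E n → ℝ} (h : IsPotential U ψ) (j : Fin n) : HasWeakPD j ψ (U (HomWord.single p j)) :=
  h.2 (HomWord.single p j)

theorem IsPotential.hasWeakDeriv_tail {p : ℕ} {U : PiLp 2 (fun _ : HomWord n (p + 1) => L2 n)}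
    {ψ : E n → ℝ} (h : IsPotential U ψ) (α : HomWord n (p + 1)) :
    HasWeakDeriv (Fin.tail α.2) (U (HomWord.single p (α.2 0))) (U α) := by
  refine (h.hasWeakPD (α.2 0)).of_cons ?_
  rw [Fin.cons_self_tail]
  exact h.2 α

/-- The stored family does not contain ψ, so a limit family needs a new potential. Its first-order
members are limits of gradients of test functions, and `exists_potential_of_tendsto` supplies ψ. The
higher members are derivatives of the first-order ones, a closed relation within L². -/
theorem isClosed_homSobSubmodule (hn : 3 ≤ n) (p : ℕ) :
    IsClosed (homSobSubmodule n (p + 1) : Set (PiLp 2 (fun _ : HomWord n (p + 1) => L2 n))) := by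
  refine isClosed_of_closure_subset fun U hU => ?_
  have htail : ∀ α : HomWord n (p + 1),
      HasWeakDeriv (Fin.tail α.2) (U (HomWord.single p (α.2 0))) (U α) := by
    intro α
    have hcl : IsClosed ((fun V : PiLp 2 (fun _ : HomWord n (p + 1) => L2 n) =>
        (V (HomWord.single p (α.2 0)), V α)) ⁻¹'
          {q : L2 n × L2 n | HasWeakDeriv (Fin.tail α.2) q.1 q.2}) :=
      (isClosed_hasWeakDeriv _).preimage (by fun_prop)
    refine closure_minimal ?_ hcl hU
    rintro V ⟨ψ, hψ⟩
    exact hψ.hasWeakDeriv_tail α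
  have happ : ∀ k : ℕ, ∃ φ : E n → ℝ, ContDiff ℝ ∞ φ ∧ HasCompactSupport φ ∧
      ∀ j, eLpNorm (fun x => pd j φ x - U (HomWord.single p j) x) 2 volume ≤
        ENNReal.ofReal (1 / ((k : ℝ) + 1)) + ENNReal.ofReal (1 / ((k : ℝ) + 1)) := by
    intro k
    have hk : (0 : ℝ) < 1 / ((k : ℝ) + 1) := Nat.one_div_pos_of_nat
    obtain ⟨V, ⟨ψ, hψ⟩, hV⟩ := Metric.mem_closure_iff.1 hU _ hk
    obtain ⟨φ, hφ, hc, h1⟩ := exists_test_grad_close hn hψ.1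
      (fun j => Lp.memLp (V (HomWord.single p j))) hψ.hasWeakPD hk
    refine ⟨φ, hφ, hc, fun j => ?_⟩
    rw [← edist_testL2 (contDiff_pd j hφ).continuous (hasCompactSupport_pd j hc)]
    refine (edist_triangle _ (V (HomWord.single p j)) _).trans (add_le_add ?_ ?_)
    · rw [edist_testL2]; exact h1 j
    · rw [edist_comm, edist_dist]
      refine ENNReal.ofReal_le_ofReal (le_trans ?_ hV.le)
      rw [dist_eq_norm, dist_eq_norm]
      exact PiLp.norm_apply_le (U - V) _
  choose φ hφ hc h1 using happ
  have h0 : Tendsto (fun k : ℕ => ENNReal.ofReal (1 / ((k : ℝ) + 1)) +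
      ENNReal.ofReal (1 / ((k : ℝ) + 1))) atTop (𝓝 0) := by
    have := ENNReal.tendsto_ofReal (tendsto_one_div_add_atTop_nhds_zero_nat (𝕜 := ℝ))
    simpa using this.add this
  obtain ⟨ψ, hψ, -, h3⟩ := exists_potential_of_tendsto hn hφ hc
    (f := fun j => U (HomWord.single p j)) (fun j => Lp.memLp _)
    (fun j => tendsto_of_tendsto_of_tendsto_of_le_of_le tendsto_const_nhds h0
      (fun _ => zero_le) fun k => h1 k j)
  refine ⟨ψ, hψ, fun α => ?_⟩
  have := (h3 (α.2 0)).trans (htail α)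
  rwa [Fin.cons_self_tail] at this

theorem completeSpace_homSob (hn : 3 ≤ n) (p : ℕ) : CompleteSpace (HomSob n (p + 1)) :=
  (isClosed_homSobSubmodule hn p).completeSpace_coe

/-- A word of positive length as a word. -/
def HomWord.toWord {m : ℕ} (α : HomWord n m) : Word n m :=
  ⟨⟨α.1 + 1, Nat.succ_lt_succ α.1.2⟩, α.2⟩

theorem Sob.hasWeakDeriv {m : ℕ} (u : Sob n m) (α : Word n m) : HasWeakDeriv α.2 u.fn (u.d α) :=
  u.2 α

theorem Sob.ext_fn {m : ℕ} {u v : Sob n m} (h : u.fn = v.fn) : u = v := by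
  refine Subtype.ext (PiLp.ext fun α => ?_)
  have h1 := u.hasWeakDeriv α
  rw [h] at h1
  exact h1.unique_L2 (v.hasWeakDeriv α)

theorem HomSob.ext_d {m : ℕ} {u v : HomSob n m} (h : ∀ α, u.d α = v.d α) : u = v :=
  Subtype.ext (PiLp.ext h)

theorem IsPotential.ext {m : ℕ} {u v : HomSob n m} {ψ : E n → ℝ} (hu : IsPotential u.1 ψ)
    (hv : IsPotential v.1 ψ) : u = v :=
  HomSob.ext_d fun α => (hu.2 α).unique_L2 (hv.2 α)

/-- Splits off the zeroth order: the H^{p+1} inner product is the L² one plus that of the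
homogeneous space. -/
theorem sum_word {p : ℕ} (F : Word n (p + 1) → ℝ) :
    ∑ α, F α = F (Word.nil n (p + 1)) + ∑ α : HomWord n (p + 1), F α.toWord := by
  rw [Fintype.sum_sigma, Fin.sum_univ_succ, Fintype.sum_sigma]
  congr 1
  have : ∀ a : Fin ((0 : Fin (p + 1 + 1)) : ℕ) → Fin n, a = Fin.elim0 := fun a => funext fun i =>
    i.elim0
  exact Fintype.sum_eq_single _ fun a ha => absurd (this a) ha

theorem Sob.inner_def {m : ℕ} (u v : Sob n m) : inner ℝ u v = ∑ α, inner ℝ (u.d α) (v.d α) :=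
  PiLp.inner_apply u.1 v.1

theorem HomSob.inner_def {m : ℕ} (u v : HomSob n m) :
    inner ℝ u v = ∑ α, inner ℝ (u.d α) (v.d α) :=
  PiLp.inner_apply u.1 v.1

/-- The derivative `∂_α` as a bounded operator. -/
def Sob.dL {m : ℕ} (α : Word n m) : Sob n m →L[ℝ] L2 n :=
  (PiLp.proj 2 (fun _ : Word n m => L2 n) α).comp (sobSubmodule n m).subtypeL

/-- The derivative `∂_α` as a bounded operator. -/
def HomSob.dL {m : ℕ} (α : HomWord n m) : HomSob n m →L[ℝ] L2 n :=
  (PiLp.proj 2 (fun _ : HomWord n m => L2 n) α).comp (homSobSubmodule n m).subtypeL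

theorem HomSob.dL_apply {m : ℕ} (α : HomWord n m) (u : HomSob n m) : HomSob.dL α u = u.d α := rfl

theorem Sob.isPotential (hn : 3 ≤ n) {p : ℕ} (u : Sob n (p + 1)) :
    IsPotential (WithLp.toLp 2 fun α : HomWord n (p + 1) => u.d α.toWord) u.fn :=
  ⟨memLp_critExp hn (Lp.memLp u.fn) (fun j => Lp.memLp (u.d (HomWord.single p j).toWord))
    fun j => u.hasWeakDeriv (HomWord.single p j).toWord, fun α => u.hasWeakDeriv α.toWord⟩

/-- The inclusion of `H^{p+1}` in the homogeneous space. -/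
def Sob.toHom (hn : 3 ≤ n) (p : ℕ) : Sob n (p + 1) →L[ℝ] HomSob n (p + 1) :=
  LinearMap.mkContinuous
    { toFun := fun u => (⟨WithLp.toLp 2 fun α : HomWord n (p + 1) => u.d α.toWord, u.fn,
        u.isPotential hn⟩ : homSobSubmodule n (p + 1))
      map_add' := fun _ _ => rfl
      map_smul' := fun _ _ => rfl } 1 fun u => by
    rw [one_mul]
    refine le_of_sq_le_sq ?_ (norm_nonneg _)
    have h1 := Sob.inner_def u u
    rw [real_inner_self_eq_norm_sq, sum_word] at h1
    rw [← real_inner_self_eq_norm_sq, HomSob.inner_def, h1]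
    exact le_add_of_nonneg_left real_inner_self_nonneg

theorem Sob.isPotential_toHom (hn : 3 ≤ n) {p : ℕ} (u : Sob n (p + 1)) :
    IsPotential (Sob.toHom hn p u).1 u.fn := u.isPotential hn

theorem Sob.inner_eq (hn : 3 ≤ n) {p : ℕ} (u v : Sob n (p + 1)) :
    inner ℝ u v = inner ℝ u.fn v.fn + inner ℝ (Sob.toHom hn p u) (Sob.toHom hn p v) := by
  rw [Sob.inner_def, sum_word, HomSob.inner_def]
  rfl

/-- The word `j α`. -/
def Word.cons {p : ℕ} (j : Fin n) (α : Word n p) : HomWord n (p + 1) :=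
  ⟨α.1, Fin.cons j α.2⟩

/-- Groups words by their first letter, so that the homogeneous inner product becomes the H^p inner
product of the gradients. -/
theorem sum_homWord {p : ℕ} (F : HomWord n (p + 1) → ℝ) :
    ∑ α, F α = ∑ α : Word n p, ∑ j, F (Word.cons j α) := by
  rw [Fintype.sum_sigma, Fintype.sum_sigma]
  refine Finset.sum_congr rfl fun k _ => ?_
  rw [← (Fin.consEquiv fun _ : Fin ((k : ℕ) + 1) => Fin n).sum_comp, Fintype.sum_prod_type,
    Finset.sum_comm]
  rfl

/-- The divergence identity is tested with ∂_α φ, and the factor (-1)^{|α|} appears on both sides.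
-/
theorem isWeakDiv_word {p : ℕ} {z : HomSob n (p + 1)} {f : Sob n p}
    (h : IsWeakDiv (fun j => z.d (HomWord.single p j)) f.fn) (α : Word n p) :
    IsWeakDiv (fun j => z.d (Word.cons j α)) (f.d α) := by
  obtain ⟨ψ, hψ⟩ := z.2
  intro φ hφ hc
  have h1 := (f.hasWeakDeriv α).3 φ hφ hc
  have h2 := h _ (contDiff_partialD α.2 hφ) (hasCompactSupport_partialD α.2 hc)
  have h3 : ∀ j, ∫ x, z.d (HomWord.single p j) x * pd j (partialD α.2 φ) x =
      (-1) ^ (α.1 : ℕ) * ∫ x, z.d (Word.cons j α) x * pd j φ x := by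
    intro j
    rw [← partialD_pd j α.2 hφ]
    exact ((hψ.hasWeakPD j).of_cons (hψ.2 (Word.cons j α))).3 _ (contDiff_pd j hφ)
      (hasCompactSupport_pd j hc)
  change _ = -∑ j, ∫ x, z.d (HomWord.single p j) x * pd j (partialD α.2 φ) x at h2
  simp only [h3, ← Finset.mul_sum] at h2
  rw [h2] at h1
  have h4 : ((-1 : ℝ) ^ (α.1 : ℕ)) ≠ 0 := pow_ne_zero _ (by norm_num)
  apply mul_left_cancel₀ h4
  rw [← h1, mul_neg]
  rfl

/-- Green's formula: `⟨Δz, w⟩ = -⟨∇z, ∇w⟩` in `H^p`. -/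
theorem inner_div_eq (hn : 3 ≤ n) {p : ℕ} {z : HomSob n (p + 1)} {f w : Sob n p}
    {w' : Sob n (p + 1)} (hw : w'.fn = w.fn)
    (h : IsWeakDiv (fun j => z.d (HomWord.single p j)) f.fn) :
    inner ℝ w f = -inner ℝ (Sob.toHom hn p w') z := by
  rw [Sob.inner_def, HomSob.inner_def, sum_homWord, ← Finset.sum_neg_distrib]
  refine Finset.sum_congr rfl fun α _ => ?_
  refine (isWeakDiv_word h α).inner_eq fun j => ?_
  have h1 := w.hasWeakDeriv α
  rw [← hw] at h1
  exact h1.pd_of_cons (w'.hasWeakDeriv (Word.cons j α).toWord)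

end Spaces

end MGT

end

noncomputable section

namespace MGT

/-! ## Elliptic regularity by translation invariance -/

section Elliptic

variable {n : ℕ}

/-- Mean value inequality for s ↦ φ(x + s e) - s ∂_k φ(x), using a global Lipschitz constant of ∂_k
φ. -/
theorem exists_second_order_bound {φ : E n → ℝ} (hφ : ContDiff ℝ ∞ φ) (hc : HasCompactSupport φ)
    (k : Fin n) : ∃ C : ℝ, 0 ≤ C ∧ ∀ (t : ℝ) (x : E n),
      |φ (x + t • EuclideanSpace.single k 1) - φ x - t * pd k φ x| ≤ C * |t| ^ 2 := by
  obtain ⟨C, hC⟩ := ((contDiff_pd k hφ).of_le (m := 1)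
    (by norm_cast)).lipschitzWith_of_hasCompactSupport (hasCompactSupport_pd k hc) one_ne_zero
  refine ⟨C, C.2, fun t x => ?_⟩
  set e : E n := EuclideanSpace.single k 1
  have he : ‖e‖ = 1 := by simp [e]
  have hd : ∀ s : ℝ, HasDerivAt (fun s : ℝ => φ (x + s • e) - s * pd k φ x)
      (pd k φ (x + s • e) - pd k φ x) s := by
    intro s
    have h1 : HasDerivAt (fun s : ℝ => x + s • e) e s := by
      simpa using ((hasDerivAt_id s).smul_const e).const_add x
    have h2 := (hφ.differentiable (by simp) (x + s • e)).hasFDerivAt.comp_hasDerivAt s h1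
    have h3 := h2.fun_sub ((hasDerivAt_id s).mul_const (pd k φ x))
    rw [one_mul] at h3
    exact h3
  have hb : ∀ s ∈ Metric.closedBall (0 : ℝ) |t|,
      ‖pd k φ (x + s • e) - pd k φ x‖ ≤ C * |t| := by
    intro s hs
    rw [mem_closedBall_zero_iff, Real.norm_eq_abs] at hs
    have h1 := hC.dist_le_mul (x + s • e) x
    rw [dist_eq_norm, dist_eq_norm, add_sub_cancel_left, norm_smul, he, mul_one,
      Real.norm_eq_abs s] at h1
    exact h1.trans (by gcongr)
  have h2 := (convex_closedBall (0 : ℝ) |t|).norm_image_sub_le_of_norm_hasDerivWithin_le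
    (fun s _ => (hd s).hasDerivWithinAt) hb (Metric.mem_closedBall_self (abs_nonneg t))
    (y := t) (by simp)
  simp only [zero_smul, add_zero, zero_mul, sub_zero, Real.norm_eq_abs] at h2
  rw [sub_right_comm]
  calc _ ≤ C * |t| * |t| := h2
    _ = _ := by ring

theorem tendsto_diffQuot_test {φ : E n → ℝ} (hφ : ContDiff ℝ ∞ φ) (hc : HasCompactSupport φ)
    (k : Fin n) :
    Tendsto (fun t : ℝ => t⁻¹ • (shift (t • EuclideanSpace.single k 1) (testL2 hφ.continuous hc)
      - testL2 hφ.continuous hc)) (𝓝[≠] 0)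
      (𝓝 (testL2 (contDiff_pd k hφ).continuous (hasCompactSupport_pd k hc))) := by
  obtain ⟨C, hC0, hC⟩ := exists_second_order_bound hφ hc k
  set e : E n := EuclideanSpace.single k 1
  have he : ‖e‖ = 1 := by simp [e]
  -- For |t| ≤ 1 the difference quotient and the derivative vanish outside K, so the uniform bound
  -- yields an L² bound.
  set K := Metric.cthickening 1 (tsupport φ)
  have hK : IsCompact K := hc.isCompact.cthickening
  set V : ℝ≥0∞ := volume K ^ (1 / (2 : ℝ≥0∞).toReal)
  have hV : V ≠ ⊤ := ENNReal.rpow_ne_top_of_nonneg (by positivity) hK.measure_lt_top.ne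
  rw [tendsto_iff_edist_tendsto_0]
  have hlim : Tendsto (fun t : ℝ => ENNReal.ofReal (C * |t|) * V) (𝓝[≠] 0) (𝓝 0) := by
    have h1 : Tendsto (fun t : ℝ => C * |t|) (𝓝[≠] 0) (𝓝 0) :=
      ((continuous_const.mul continuous_abs).tendsto' 0 0 (by simp)).mono_left nhdsWithin_le_nhds
    simpa using ENNReal.Tendsto.mul_const (ENNReal.tendsto_ofReal h1) (Or.inr hV)
  have hsmall : ∀ᶠ t : ℝ in 𝓝[≠] 0, |t| ≤ 1 := nhdsWithin_le_nhds
    ((continuous_abs.tendsto' (0 : ℝ) 0 abs_zero).eventually_le_const one_pos)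
  refine tendsto_of_tendsto_of_tendsto_of_le_of_le' tendsto_const_nhds hlim
    (Eventually.of_forall fun _ => zero_le) ?_
  filter_upwards [hsmall, self_mem_nhdsWithin] with t ht ht0
  have ht0' : t ≠ 0 := ht0
  have hpt : ∀ x, ‖t⁻¹ * (φ (x + t • e) - φ x) - pd k φ x‖ ≤
      ‖K.indicator (fun _ => C * |t|) x‖ := by
    intro x
    by_cases hx : x ∈ K
    · rw [indicator_of_mem hx, Real.norm_of_nonneg (mul_nonneg hC0 (abs_nonneg t)),
        Real.norm_eq_abs]
      have e1 : t⁻¹ * (φ (x + t • e) - φ x) - pd k φ x =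
          t⁻¹ * (φ (x + t • e) - φ x - t * pd k φ x) := by field_simp
      rw [e1, abs_mul, abs_inv, inv_mul_le_iff₀ (abs_pos.2 ht0')]
      refine (hC t x).trans (le_of_eq (by ring))
    · have h1 : x ∉ tsupport φ := fun h => hx (Metric.self_subset_cthickening _ h)
      have h2 : x + t • e ∉ tsupport φ := by
        intro h
        refine hx (Metric.mem_cthickening_of_dist_le x (x + t • e) 1 _ h ?_)
        rw [dist_eq_norm, sub_add_cancel_left, norm_neg, norm_smul, he, mul_one]
        exact ht
      have h3 : pd k φ x = 0 := by
        by_contra h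
        exact h1 (tsupport_fderiv_subset ℝ (subset_closure (Function.mem_support.2
          fun h0 => h (by unfold pd; rw [h0]; rfl))))
      rw [image_eq_zero_of_notMem_tsupport h1, image_eq_zero_of_notMem_tsupport h2, h3]
      simp
  rw [Lp.edist_def]
  calc _ = eLpNorm (fun x => t⁻¹ * (φ (x + t • e) - φ x) - pd k φ x) 2 volume := by
        refine eLpNorm_congr_ae ?_
        have a1 := (memLp_test hφ.continuous hc 2).coeFn_toLp
        have a2 := (measurePreserving_add_right (volume : Measure (E n))
          (t • e)).quasiMeasurePreserving.ae a1
        filter_upwards [Lp.coeFn_smul t⁻¹ (shift (t • e) (testL2 hφ.continuous hc)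
          - testL2 hφ.continuous hc), Lp.coeFn_sub (shift (t • e) (testL2 hφ.continuous hc))
          (testL2 hφ.continuous hc), coeFn_shift (t • e) (testL2 hφ.continuous hc), a1, a2,
          (memLp_test (contDiff_pd k hφ).continuous (hasCompactSupport_pd k hc) 2).coeFn_toLp]
          with x b1 b2 b3 b4 b5 b6
        simp only [testL2] at *
        simp only [Pi.sub_apply, b1, Pi.smul_apply, b2, b3, b4, b5, b6, smul_eq_mul]
    _ ≤ eLpNorm (K.indicator fun _ => C * |t|) 2 volume := eLpNorm_mono hpt
    _ = ENNReal.ofReal (C * |t|) * V := by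
        rw [eLpNorm_indicator_const hK.measurableSet (by norm_num) (by norm_num),
          Real.enorm_of_nonneg (by positivity)]

/-- The adjoint of a translation is the opposite translation, so the difference quotient moves, with
step -t, onto the test function, where it converges in L². -/
theorem hasWeakPD_of_tendsto_diffQuot {u w : L2 n} {k : Fin n}
    (h : Tendsto (fun t : ℝ => t⁻¹ • (shift (t • EuclideanSpace.single k 1) u - u)) (𝓝[≠] 0)
      (𝓝 w)) : HasWeakPD k u w := by
  refine hasWeakPD_iff.2 ⟨locallyIntegrable_L2 _, locallyIntegrable_L2 _, fun χ hχ hχc => ?_⟩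
  rw [← inner_testL2 hχ.continuous hχc,
    ← inner_testL2 (contDiff_pd k hχ).continuous (hasCompactSupport_pd k hχc)]
  set e : E n := EuclideanSpace.single k 1
  have hneg : Tendsto (fun t : ℝ => -t) (𝓝[≠] 0) (𝓝[≠] 0) := by
    refine tendsto_nhdsWithin_iff.2 ⟨?_, ?_⟩
    · exact (continuous_neg.tendsto' (0 : ℝ) 0 neg_zero).mono_left nhdsWithin_le_nhds
    · filter_upwards [self_mem_nhdsWithin] with t ht using neg_ne_zero.2 ht
  have t1 := ((tendsto_diffQuot_test hχ hχc k).comp hneg).inner (𝕜 := ℝ)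
    (tendsto_const_nhds (x := u))
  have t2 := ((tendsto_const_nhds (x := testL2 hχ.continuous hχc)).inner (𝕜 := ℝ) h).neg
  refine tendsto_nhds_unique t1 (t2.congr fun t => ?_)
  simp only [Function.comp_def, inv_neg, neg_smul, inner_neg_left, real_inner_smul_left,
    real_inner_smul_right, inner_sub_left, inner_sub_right]
  rw [inner_shift_left, neg_neg]

/-- A translation invariant operator commutes with weak derivatives. -/
theorem HasWeakPD.map_of_shift {T : L2 n →L[ℝ] L2 n} (hT : ∀ y u, T (shift y u) = shift y (T u))
    {u : L2 n} {g : Fin n → L2 n} (h : ∀ k, HasWeakPD k u (g k)) (k : Fin n) :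
    HasWeakPD k (T u) (T (g k)) := by
  have hcl : IsClosed ((fun q : L2 n × (Fin n → L2 n) => (T q.1, T (q.2 k))) ⁻¹'
      {q : L2 n × L2 n | HasWeakPD k q.1 q.2}) :=
    (isClosed_hasWeakDeriv _).preimage (by fun_prop)
  refine closure_minimal ?_ hcl (mem_closure_testGraph h)
  rintro _ ⟨φ, hφ, hc, rfl⟩
  refine hasWeakPD_of_tendsto_diffQuot ?_
  refine ((T.continuous.tendsto _).comp (tendsto_diffQuot_test hφ hc k)).congr fun t => ?_
  simp only [Function.comp_def, map_smul, map_sub, hT]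

theorem HasWeakPD.shift_L2 {u f : L2 n} {j : Fin n} (h : HasWeakPD j u f) (y : E n) :
    HasWeakPD j (shift y u) (shift y f) := by
  refine hasWeakPD_iff.2 ⟨locallyIntegrable_L2 _, locallyIntegrable_L2 _, fun χ hχ hχc => ?_⟩
  rw [integral_shift_mul, integral_shift_mul]
  have h1 : ContDiff ℝ ∞ fun x => χ (x - y) := hχ.comp (contDiff_id.sub contDiff_const)
  have h2 : HasCompactSupport fun x => χ (x - y) := hχc.comp_homeomorph (Homeomorph.subRight y)
  have h3 := h.integral_eq h1 h2
  have h4 : ∀ x, pd j (fun x => χ (x - y)) x = pd j χ (x - y) := fun x => by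
    unfold pd
    rw [fderiv_comp_sub]
  simpa only [h4] using h3

/-- Right-hand sides `(h, G)` of elliptic equations. -/
abbrev EllData (n : ℕ) := PiLp 2 (fun _ : Option (Fin n) => L2 n)

/-- The pairs `(s φ, ∇φ)` with `φ ∈ H¹`. -/
def gradSubmodule (n : ℕ) (s : ℝ) : Submodule ℝ (EllData n) where
  carrier := {U | ∀ j, HasWeakPD j (U none) (s • U (some j) : L2 n)}
  zero_mem' := fun j => (HasWeakDeriv.zero _).congr (Lp.coeFn_zero _ _ _).symm
    (by simpa using (Lp.coeFn_zero ℝ 2 (volume : Measure (E n))).symm)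
  add_mem' := fun {U V} hU hV j => by
    have := HasWeakDeriv.congr ((hU j).add (hV j)) (Lp.coeFn_add _ _).symm (Lp.coeFn_add _ _).symm
    rw [← smul_add] at this
    exact this
  smul_mem' := fun r U hU j => by
    have := HasWeakDeriv.congr ((hU j).smul r) (Lp.coeFn_smul _ _).symm (Lp.coeFn_smul _ _).symm
    rw [smul_comm] at this
    exact this

theorem isClosed_gradSubmodule (n : ℕ) (s : ℝ) :
    IsClosed (gradSubmodule n s : Set (EllData n)) := by
  have : (gradSubmodule n s : Set (EllData n)) = ⋂ j : Fin n,
      (fun U : EllData n => (U none, s • U (some j))) ⁻¹'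
        {q : L2 n × L2 n | HasWeakPD j q.1 q.2} := by
    ext U
    simp only [mem_iInter]
    rfl
  rw [this]
  exact isClosed_iInter fun j => (isClosed_hasWeakDeriv _).preimage (by fun_prop)

instance (n : ℕ) (s : ℝ) : CompleteSpace (gradSubmodule n s) :=
  (isClosed_gradSubmodule n s).completeSpace_coe

/-- The orthogonal projection onto the pairs `(s φ, ∇φ)`: the solution operator of
`s² φ - Δφ = s h - div G`. -/
def ellSol (n : ℕ) (s : ℝ) : EllData n →L[ℝ] EllData n := (gradSubmodule n s).starProjection

/-- Translation of all components. -/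
def shiftData (y : E n) (U : EllData n) : EllData n := WithLp.toLp 2 fun i => shift y (U i)

theorem shiftData_mem {s : ℝ} {U : EllData n} (h : U ∈ gradSubmodule n s) (y : E n) :
    shiftData y U ∈ gradSubmodule n s := fun j => by
  have := (h j).shift_L2 y
  rwa [map_smul] at this

/-- Translations are orthogonal maps that preserve the subspace, hence commute with the projection
onto it. -/
theorem ellSol_shiftData (s : ℝ) (y : E n) (U : EllData n) :
    ellSol n s (shiftData y U) = shiftData y (ellSol n s U) := by
  refine Submodule.eq_starProjection_of_mem_of_inner_eq_zero
    (shiftData_mem (Submodule.starProjection_apply_mem _ U) y) fun V hV => ?_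
  have h0 := Submodule.starProjection_inner_eq_zero (K := gradSubmodule n s) U
    (shiftData (-y) V) (shiftData_mem hV _)
  rw [PiLp.inner_apply] at h0 ⊢
  rw [← h0]
  refine Finset.sum_congr rfl fun i _ => ?_
  change inner ℝ (shift y (U i) - shift y (ellSol n s U i)) (V i) = _
  rw [← map_sub, inner_shift_left]
  rfl

/-- The inclusion of the `i`-th component. -/
def dataSingle (i : Option (Fin n)) : L2 n →L[ℝ] EllData n :=
  ((PiLp.continuousLinearEquiv 2 ℝ (fun _ : Option (Fin n) => L2 n)).symm :
    (Option (Fin n) → L2 n) →L[ℝ] EllData n).comp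
      (ContinuousLinearMap.single ℝ (fun _ : Option (Fin n) => L2 n) i)

theorem sum_dataSingle (U : EllData n) : ∑ i, dataSingle i (U i) = U := by
  refine PiLp.ext fun l => ?_
  rw [WithLp.ofLp_sum, Finset.sum_apply]
  simp [dataSingle]

theorem dataSingle_shift (i : Option (Fin n)) (y : E n) (u : L2 n) :
    dataSingle i (shift y u) = shiftData y (dataSingle i u) := by
  refine PiLp.ext fun l => ?_
  by_cases h : l = i <;> simp [dataSingle, shiftData, h]

/-- Each component of the solution is a finite sum of translation-invariant operators on L² applied
to the components of the data, and such operators commute with weak derivatives. -/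
theorem hasWeakPD_ellSol (s : ℝ) {D : EllData n} {D' : Fin n → EllData n}
    (h : ∀ k i, HasWeakPD k (D i) (D' k i)) (k : Fin n) (l : Option (Fin n)) :
    HasWeakPD k (ellSol n s D l) (ellSol n s (D' k) l) := by
  let T : Option (Fin n) → L2 n →L[ℝ] L2 n := fun i =>
    (PiLp.proj 2 (fun _ : Option (Fin n) => L2 n) l).comp ((ellSol n s).comp (dataSingle i))
  have hT : ∀ i y u, T i (shift y u) = shift y (T i u) := by
    intro i y u
    change ellSol n s (dataSingle i (shift y u)) l = _
    rw [dataSingle_shift, ellSol_shiftData]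
    rfl
  have hsum : ∀ U : EllData n, ellSol n s U l = ∑ i, T i (U i) := by
    intro U
    conv_lhs => rw [← sum_dataSingle U]
    rw [map_sum, WithLp.ofLp_sum, Finset.sum_apply]
    rfl
  have h1 : ∀ t : Finset (Option (Fin n)), HasWeakPD k ((∑ i ∈ t, T i (D i) : L2 n))
      ((∑ i ∈ t, T i (D' k i) : L2 n)) := by
    classical
    intro t
    induction t using Finset.induction_on with
    | empty =>
      simp only [Finset.sum_empty]
      exact (HasWeakDeriv.zero _).congr (Lp.coeFn_zero _ _ _).symm (Lp.coeFn_zero _ _ _).symm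
    | insert i t hi ih =>
      rw [Finset.sum_insert hi, Finset.sum_insert hi]
      exact HasWeakDeriv.congr (HasWeakDeriv.add (HasWeakPD.map_of_shift (hT i)
        (g := fun k => D' k i) (fun k => h k i) k) ih)
        (Lp.coeFn_add _ _).symm (Lp.coeFn_add _ _).symm
  rw [hsum, hsum]
  exact h1 Finset.univ

end Elliptic

end MGT

end

/-! ### Solution of the elliptic equation in H^{p+1} -/

noncomputable section

namespace MGT

section EllipticSolution

variable {n : ℕ}

theorem HasWeakDeriv.smul_L2 {k : ℕ} {α : Fin k → Fin n} {u f : L2 n} (r : ℝ)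
    (h : HasWeakDeriv α u f) : HasWeakDeriv α (r • u : L2 n) (r • f : L2 n) :=
  (h.smul r).congr (Lp.coeFn_smul _ _).symm (Lp.coeFn_smul _ _).symm

theorem coeFn_testL2 {χ : E n → ℝ} (hχ : Continuous χ) (hc : HasCompactSupport χ) :
    testL2 hχ hc =ᵐ[volume] χ := (memLp_test hχ hc 2).coeFn_toLp

/-- The derivatives `∂_α` of the data `(s⁻¹ h, -G)`. -/
def ellData {p : ℕ} (s : ℝ) (h : Sob n p) (G : Fin n → Sob n p) (α : Word n p) : EllData n :=
  WithLp.toLp 2 fun i => i.elim (s⁻¹ • h.d α) fun j => -(G j).d α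

theorem Sob.hasWeakPD_d {p : ℕ} (u : Sob n p) {k : ℕ} (hk : k + 1 < p + 1) (a : Fin k → Fin n)
    (j : Fin n) : HasWeakPD j (u.d ⟨⟨k, by omega⟩, a⟩)
      (u.d ⟨⟨k + 1, hk⟩, (Fin.cons j a : Fin (k + 1) → Fin n)⟩) :=
  (u.hasWeakDeriv ⟨⟨k, by omega⟩, a⟩).pd_of_cons
    (u.hasWeakDeriv ⟨⟨k + 1, hk⟩, (Fin.cons j a : Fin (k + 1) → Fin n)⟩)

theorem hasWeakPD_ellData {p : ℕ} (s : ℝ) (h : Sob n p) (G : Fin n → Sob n p) {k : ℕ}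
    (hk : k + 1 < p + 1) (a : Fin k → Fin n) (j : Fin n) (i : Option (Fin n)) :
    HasWeakPD j (ellData s h G ⟨⟨k, by omega⟩, a⟩ i)
      (ellData s h G ⟨⟨k + 1, hk⟩, (Fin.cons j a : Fin (k + 1) → Fin n)⟩ i) := by
  cases i with
  | none => exact HasWeakDeriv.smul_L2 _ (h.hasWeakPD_d hk a j)
  | some l =>
    have := HasWeakDeriv.smul_L2 (-1) ((G l).hasWeakPD_d hk a j)
    rw [neg_one_smul, neg_one_smul] at this
    exact this

/-- The family of derivatives of the solution. -/
def ellFamily {p : ℕ} (s : ℝ) (h : Sob n p) (G : Fin n → Sob n p) : Word n (p + 1) → L2 n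
  | ⟨⟨0, _⟩, _⟩ => s⁻¹ • ellSol n s (ellData s h G (Word.nil n p)) none
  | ⟨⟨k + 1, hk⟩, a⟩ =>
    -- The first letter is supplied by the gradient component of the solution; only the remaining k
    -- ≤ p derivatives fall on the data. This is the gain of one derivative.
    ellSol n s (ellData s h G ⟨⟨k, Nat.lt_of_succ_lt_succ hk⟩, Fin.tail a⟩) (some (a 0))

theorem hasWeakPD_ellSol_none {s : ℝ} (hs : s ≠ 0) (D : EllData n) (j : Fin n) :
    HasWeakPD j (s⁻¹ • ellSol n s D none : L2 n) (ellSol n s D (some j)) := by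
  have h1 : ellSol n s D ∈ gradSubmodule n s := Submodule.starProjection_apply_mem _ D
  have h2 := HasWeakDeriv.smul_L2 s⁻¹ (h1 j)
  rwa [inv_smul_smul₀ hs] at h2

theorem hasWeakDeriv_ellSol {p : ℕ} (s : ℝ) (h : Sob n p) (G : Fin n → Sob n p) :
    ∀ (k : ℕ) (hk : k < p + 1) (a : Fin k → Fin n),
      HasWeakDeriv a (s⁻¹ • ellSol n s (ellData s h G (Word.nil n p)) none : L2 n)
        (s⁻¹ • ellSol n s (ellData s h G ⟨⟨k, hk⟩, a⟩) none : L2 n) := by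
  intro k
  induction k with
  | zero =>
    intro hk a
    have : (⟨⟨0, hk⟩, a⟩ : Word n p) = Word.nil n p := by
      unfold Word.nil
      congr
      exact funext fun i => i.elim0
    rw [this]
    exact hasWeakDeriv_nil a (locallyIntegrable_L2 _)
  | succ k ih =>
    intro hk a
    have h1 := ih (by omega) (Fin.tail a)
    have h2 := hasWeakPD_ellSol s (D := ellData s h G ⟨⟨k, by omega⟩, Fin.tail a⟩)
      (D' := fun j => ellData s h G ⟨⟨k + 1, hk⟩, (Fin.cons j (Fin.tail a) : Fin (k + 1) → Fin n)⟩)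
      (fun j i => hasWeakPD_ellData s h G hk (Fin.tail a) j i) (a 0) none
    have h3 := h1.cons (HasWeakDeriv.smul_L2 s⁻¹ h2)
    rw [Fin.cons_self_tail] at h3
    exact h3

theorem ellFamily_mem {p : ℕ} {s : ℝ} (hs : s ≠ 0) (h : Sob n p) (G : Fin n → Sob n p) :
    (WithLp.toLp 2 (ellFamily s h G) : PiLp 2 (fun _ : Word n (p + 1) => L2 n)) ∈
      sobSubmodule n (p + 1) := by
  rintro ⟨⟨k, hk⟩, a⟩
  cases k with
  | zero => exact hasWeakDeriv_nil a (locallyIntegrable_L2 _)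
  | succ k =>
    have h1 := (hasWeakDeriv_ellSol s h G k (Nat.lt_of_succ_lt_succ hk) (Fin.tail a)).cons
      (hasWeakPD_ellSol_none hs (ellData s h G ⟨⟨k, Nat.lt_of_succ_lt_succ hk⟩, Fin.tail a⟩) (a 0))
    rw [Fin.cons_self_tail] at h1
    exact h1

/-- Solution of `μ v - Δv = h + div G` in `H^{p+1}`, for `h` and `G` in `H^p`. -/
theorem exists_elliptic_solution {p : ℕ} {μ : ℝ} (hμ : 0 < μ) (h : Sob n p) (G : Fin n → Sob n p) :
    ∃ v : Sob n (p + 1),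
      IsWeakDiv (fun j => v.d (Word.single p j) + (G j).fn) (μ • v.fn - h.fn) := by
  set s := √μ
  have hs : s ≠ 0 := (Real.sqrt_pos.2 hμ).ne'
  have hss : s * s = μ := Real.mul_self_sqrt hμ.le
  let v : Sob n (p + 1) := (⟨_, ellFamily_mem hs h G⟩ : sobSubmodule n (p + 1))
  refine ⟨v, fun φ hφ hc => ?_⟩
  set D := ellData s h G (Word.nil n p) with hD
  have hvfn : v.fn = s⁻¹ • ellSol n s D none := rfl
  have hvd : ∀ j, v.d (Word.single p j) = ellSol n s D (some j) := by
    intro j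
    change ellSol n s (ellData s h G ⟨⟨0, _⟩, Fin.tail fun _ => j⟩) (some j) = _
    have : (⟨⟨0, Nat.succ_pos p⟩, Fin.tail fun _ : Fin 1 => j⟩ : Word n p) = Word.nil n p := by
      unfold Word.nil
      congr
      exact funext fun i => i.elim0
    rw [this]
  -- The residual of the projection is orthogonal to (s φ, ∇φ). With data (s⁻¹ h, -G) and s² = μ,
  -- this orthogonality is the weak equation.
  let Φ : EllData n := WithLp.toLp 2 fun i => i.elim (s • testL2 hφ.continuous hc)
    fun j => testL2 (contDiff_pd j hφ).continuous (hasCompactSupport_pd j hc)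
  have hΦ : Φ ∈ gradSubmodule n s := fun j => by
    refine HasWeakDeriv.smul_L2 s ?_
    exact HasWeakDeriv.congr (hasWeakPD_of_contDiff hφ j) (coeFn_testL2 _ _).symm
      (coeFn_testL2 (contDiff_pd j hφ).continuous (hasCompactSupport_pd j hc)).symm
  have h0 := Submodule.starProjection_inner_eq_zero (K := gradSubmodule n s) D Φ hΦ
  rw [PiLp.inner_apply, Fintype.sum_option] at h0
  change inner ℝ (s⁻¹ • h.fn - ellSol n s D none) (s • testL2 hφ.continuous hc) +
    ∑ j, inner ℝ (-(G j).fn - ellSol n s D (some j))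
      (testL2 (contDiff_pd j hφ).continuous (hasCompactSupport_pd j hc)) = 0 at h0
  have e1 : ∀ j, ∫ x, (v.d (Word.single p j) + (G j).fn) x *
      fderiv ℝ φ x (EuclideanSpace.single j 1) =
      -inner ℝ (-(G j).fn - ellSol n s D (some j))
        (testL2 (contDiff_pd j hφ).continuous (hasCompactSupport_pd j hc)) := by
    intro j
    rw [real_inner_comm, hvd, ← inner_neg_right, inner_testL2]
    congr 2
    funext x
    congr 3
    abel
  have e2 : ∫ x, (μ • v.fn - h.fn) x * φ x =
      -inner ℝ (s⁻¹ • h.fn - ellSol n s D none) (s • testL2 hφ.continuous hc) := by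
    rw [real_inner_smul_right, ← real_inner_smul_left, real_inner_comm, ← inner_neg_right,
      inner_testL2]
    congr 2
    funext x
    congr 3
    rw [hvfn, ← hss, smul_smul, mul_assoc, mul_inv_cancel₀ hs, mul_one, smul_sub, smul_smul,
      mul_inv_cancel₀ hs, one_smul]
    abel
  simp only [e1, e2, Finset.sum_neg_distrib, neg_neg]
  linarith

end EllipticSolution

end MGT

end

noncomputable section

namespace MGT

/-! ## The memory kernel and its measure -/

section Kernel

variable {c : ℝ} {g : ℝ → ℝ}

namespace IsMemoryKernel

theorem deriv_nonpos (hg : IsMemoryKernel c g) {s : ℝ} (hs : 0 < s) : deriv g s ≤ 0 := by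
  obtain ⟨ζ, hζ, h⟩ := hg.decay
  have := h s hs
  have := mul_nonneg hζ.le (hg.nonneg s hs)
  linarith

theorem continuousOn_deriv (hg : IsMemoryKernel c g) : ContinuousOn (deriv g) (Ioi 0) := by
  intro s hs
  have hs : 0 < s := hs
  have h := (hg.deriv_ac (s / 2) (s + 1) (by positivity) (by linarith)).continuousOn
  rw [uIcc_of_le (by linarith)] at h
  exact (h.continuousAt (Icc_mem_nhds (by linarith) (by linarith))).continuousWithinAt

theorem deriv_monotoneOn (hg : IsMemoryKernel c g) : MonotoneOn (deriv g) (Ioi 0) := by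
  intro s hs t _ hst
  have hs : 0 < s := hs
  have h := (hg.deriv_ac s t hs hst).integral_deriv_eq_sub
  have h2 : 0 ≤ ∫ x in s..t, deriv (deriv g) x := by
    refine intervalIntegral.integral_nonneg_of_ae_restrict hst ?_
    exact ae_restrict_of_ae_restrict_of_subset (fun x hx => hs.trans_le hx.1) hg.deriv2_nonneg
  linarith

theorem integral_Ioi_neg_deriv (hg : IsMemoryKernel c g) {s : ℝ} (hs : 0 < s) :
    ∫ r in Ioi s, -deriv g r = g s := by
  have hsub : Ioi s ⊆ Ioi (0 : ℝ) := Ioi_subset_Ioi hs.le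
  have hd : ∀ x ∈ Ici s, HasDerivAt g (deriv g x) x := fun x hx =>
    (hg.differentiable x (hs.trans_le hx)).hasDerivAt
  have h_int := hg.deriv_integrable.mono_set hsub
  have h0 := tendsto_zero_of_hasDerivAt_of_integrableOn_Ioi
    (fun x hx => hd x (Ioi_subset_Ici_self hx)) h_int (hg.integrable.mono_set hsub)
  rw [integral_neg, integral_Ioi_of_hasDerivAt_of_tendsto' hd h_int h0]
  ring

end IsMemoryKernel

theorem measurable_density (g : ℝ → ℝ) : Measurable fun s => ENNReal.ofReal (-deriv g s) :=
  (measurable_deriv g).neg.ennreal_ofReal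

theorem histMeasure_absolutelyContinuous (g : ℝ → ℝ) :
    histMeasure g ≪ volume.restrict (Ioi 0) :=
  withDensity_absolutelyContinuous _ _

/-- The weight -g' may vanish from some age on, for instance if g has compact support. Ages with g'
= 0 carry no information, and later arguments work only where g' < 0. -/
theorem ae_histMeasure_iff {P : ℝ → Prop} :
    (∀ᵐ s ∂(histMeasure g), P s) ↔ ∀ᵐ s : ℝ, 0 < s → deriv g s < 0 → P s := by
  rw [histMeasure, ae_withDensity_iff (measurable_density g), ae_restrict_iff' measurableSet_Ioi]
  refine eventually_congr (Eventually.of_forall fun s => ?_)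
  simp [ENNReal.ofReal_eq_zero]

theorem ae_histMeasure_pos : ∀ᵐ s ∂(histMeasure g), 0 < s ∧ deriv g s < 0 :=
  ae_histMeasure_iff.2 (ae_of_all _ fun _ h1 h2 => ⟨h1, h2⟩)

theorem isFiniteMeasure_histMeasure (hg : IsMemoryKernel c g) : IsFiniteMeasure (histMeasure g) := by
  refine isFiniteMeasure_withDensity_ofReal ?_
  exact hg.deriv_integrable.neg.2

theorem integral_histMeasure (hg : IsMemoryKernel c g) {V : Type*} [NormedAddCommGroup V]
    [NormedSpace ℝ V] (f : ℝ → V) :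
    ∫ s, f s ∂(histMeasure g) = ∫ s in Ioi (0 : ℝ), (-deriv g s) • f s := by
  rw [histMeasure, integral_withDensity_eq_integral_toReal_smul (measurable_density g)
    (ae_of_all _ fun _ => ENNReal.ofReal_lt_top)]
  refine setIntegral_congr_fun measurableSet_Ioi fun s hs => ?_
  simp only [ENNReal.toReal_ofReal (neg_nonneg.2 (hg.deriv_nonpos hs))]

theorem lintegral_histMeasure (f : ℝ → ℝ≥0∞) :
    ∫⁻ s, f s ∂(histMeasure g) = ∫⁻ s in Ioi (0 : ℝ), ENNReal.ofReal (-deriv g s) * f s := by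
  rw [histMeasure, lintegral_withDensity_eq_lintegral_mul_non_measurable _ (measurable_density g)
    (ae_of_all _ fun _ => ENNReal.ofReal_lt_top)]
  rfl

/-- Lebesgue measure on `(0, T]` is controlled by the history measure if `g'(T) < 0`. -/
theorem restrict_Ioc_le_histMeasure (hg : IsMemoryKernel c g) {T : ℝ} (hT : deriv g T < 0) :
    volume.restrict (Ioc 0 T) ≤ ENNReal.ofReal (-deriv g T)⁻¹ • histMeasure g := by
  have hpos : 0 < -deriv g T := by linarith
  refine Measure.le_iff.2 fun A hA => ?_
  rw [Measure.smul_apply, histMeasure, withDensity_apply _ hA, smul_eq_mul,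
    ← lintegral_const_mul _ (measurable_density g), Measure.restrict_restrict hA,
    Measure.restrict_apply hA, ← setLIntegral_one]
  calc ∫⁻ _ in A ∩ Ioc 0 T, 1
      ≤ ∫⁻ a in A ∩ Ioc 0 T, ENNReal.ofReal (-deriv g T)⁻¹ * ENNReal.ofReal (-deriv g a) := by
        refine setLIntegral_mono' (hA.inter measurableSet_Ioc) fun a ha => ?_
        have ha0 : 0 < a := ha.2.1
        have := hg.deriv_monotoneOn ha0 (ha0.trans_le ha.2.2) ha.2.2
        rw [← ENNReal.ofReal_mul (inv_nonneg.2 hpos.le), ← ENNReal.ofReal_one]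
        refine ENNReal.ofReal_le_ofReal ?_
        rw [inv_mul_eq_div, one_le_div hpos]
        linarith
    _ ≤ _ := lintegral_mono_set (inter_subset_inter_right _ fun x hx => hx.1)

end Kernel

end MGT

end

noncomputable section

namespace MGT

/-! ## Primitives and exponential convolutions -/

section Primitive

variable {V : Type*} [NormedAddCommGroup V] [NormedSpace ℝ V]

/-- Interchange of integrations over the triangle `{q < r}`. -/
theorem integral_smul_integral_Iio [CompleteSpace V] {ν : Measure ℝ} [SFinite ν] {a : ℝ → ℝ} {f : ℝ → V}
    (ha : Integrable a ν) (ha0 : 0 ≤ᵐ[ν] a) (hf : AEStronglyMeasurable f ν)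
    (h : Integrable (fun q => (∫ r in Ioi q, a r ∂ν) • f q) ν) :
    ∫ r, a r • (∫ q in Iio r, f q ∂ν) ∂ν = ∫ q, (∫ r in Ioi q, a r ∂ν) • f q ∂ν := by
  let F : ℝ × ℝ → V := {p : ℝ × ℝ | p.1 < p.2}.indicator fun p => a p.2 • f p.1
  have hFm : AEStronglyMeasurable F (ν.prod ν) :=
    (ha.aestronglyMeasurable.comp_snd.smul hf.comp_fst).indicator
      (measurableSet_lt measurable_fst measurable_snd)
  have e1 : ∀ q, (fun r => F (q, r)) = (Ioi q).indicator fun r => a r • f q := fun q => rfl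
  have e2 : ∀ r, (fun q => F (q, r)) = (Iio r).indicator fun q => a r • f q := fun r => rfl
  have e3 : ∀ q, ∫ r, F (q, r) ∂ν = (∫ r in Ioi q, a r ∂ν) • f q := fun q => by
    rw [e1, integral_indicator measurableSet_Ioi, integral_smul_const]
  have hF : Integrable F (ν.prod ν) := by
    refine (integrable_prod_iff hFm).2 ⟨ae_of_all _ fun q => ?_, ?_⟩
    · rw [e1]
      exact (ha.smul_const _).indicator measurableSet_Ioi
    · refine h.norm.congr (ae_of_all _ fun q => ?_)
      have : ∀ r, ‖F (q, r)‖ = (Ioi q).indicator (fun r => ‖a r • f q‖) r := fun r => by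
        rw [← norm_indicator_eq_indicator_norm, ← e1]
      simp only [this]
      rw [integral_indicator measurableSet_Ioi, norm_smul, Real.norm_eq_abs,
        abs_of_nonneg (integral_nonneg_of_ae (ae_restrict_of_ae ha0)), ← integral_mul_const]
      refine integral_congr_ae (ae_restrict_of_ae (ha0.mono fun r hr => ?_))
      simp only
      rw [norm_smul, Real.norm_eq_abs, abs_of_nonneg hr]
  have hsw := integral_integral_swap (f := fun q r => F (q, r)) hF
  simp only [e3] at hsw
  rw [hsw]
  refine integral_congr_ae (ae_of_all _ fun r => ?_)
  simp only
  rw [e2, integral_indicator measurableSet_Iio, integral_smul]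

/-- Integration by parts against a primitive of an integrable function. -/
theorem integral_smul_primitive_add [CompleteSpace V] {A a : ℝ → ℝ} (hA : ∀ r, HasDerivAt A (a r) r)
    (ha : Continuous a) (ha0 : ∀ r, 0 ≤ a r) {f : ℝ → V} {T : ℝ} (hT : 0 ≤ T)
    (hf : IntervalIntegrable f volume 0 T) :
    (∫ r in (0 : ℝ)..T, a r • ∫ q in (0 : ℝ)..r, f q) + ∫ q in (0 : ℝ)..T, A q • f q =
      A T • ∫ q in (0 : ℝ)..T, f q := by
  have hAc : Continuous A := continuous_iff_continuousAt.2 fun r => (hA r).continuousAt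
  have hAf : IntervalIntegrable (fun q => A q • f q) volume 0 T := hf.continuousOn_smul hAc.continuousOn
  have hAf' : IntervalIntegrable (fun q => (A T - A q) • f q) volume 0 T :=
    hf.continuousOn_smul (continuous_const.sub hAc).continuousOn
  let ν : Measure ℝ := volume.restrict (Ioc 0 T)
  have e1 : ∀ q ∈ Ioc (0 : ℝ) T, ∫ r in Ioi q, a r ∂ν = A T - A q := fun q hq => by
    rw [Measure.restrict_restrict measurableSet_Ioi,
      show Ioi q ∩ Ioc 0 T = Ioc q T by
        ext r; exact ⟨fun h => ⟨h.1, h.2.2⟩, fun h => ⟨h.1, hq.1.trans h.1, h.2⟩⟩,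
      ← intervalIntegral.integral_of_le hq.2]
    exact intervalIntegral.integral_eq_sub_of_hasDerivAt (fun r _ => hA r)
      (ha.intervalIntegrable _ _)
  have e2 : ∀ r ∈ Ioc (0 : ℝ) T, ∫ q in Iio r, f q ∂ν = ∫ q in (0 : ℝ)..r, f q := fun r hr => by
    rw [Measure.restrict_restrict measurableSet_Iio, intervalIntegral.integral_of_le hr.1.le,
      show Iio r ∩ Ioc 0 T = Ioo 0 r by
        ext q; exact ⟨fun h => ⟨h.2.1, h.1⟩, fun h => ⟨h.2, h.1, h.2.le.trans hr.2⟩⟩,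
      integral_Ioc_eq_integral_Ioo]
  rw [intervalIntegrable_iff_integrableOn_Ioc_of_le hT] at hAf'
  have main := integral_smul_integral_Iio (ν := ν) (a := a) (f := f)
    ((ha.intervalIntegrable 0 T).1) (ae_of_all _ ha0) hf.1.aestronglyMeasurable
    (hAf'.congr ((ae_restrict_iff' measurableSet_Ioc).2 (ae_of_all _ fun q hq => by
      simp only [e1 q hq])))
  have l1 : ∫ r, a r • (∫ q in Iio r, f q ∂ν) ∂ν = ∫ r in (0 : ℝ)..T, a r • ∫ q in (0 : ℝ)..r, f q := by
    rw [intervalIntegral.integral_of_le hT]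
    exact setIntegral_congr_fun measurableSet_Ioc fun r hr => by simp only [e2 r hr]
  have l2 : ∫ q, (∫ r in Ioi q, a r ∂ν) • f q ∂ν = ∫ q in (0 : ℝ)..T, (A T - A q) • f q := by
    rw [intervalIntegral.integral_of_le hT]
    exact setIntegral_congr_fun measurableSet_Ioc fun r hr => by simp only [e1 r hr]
  rw [l1, l2] at main
  rw [main]
  simp only [sub_smul]
  have hTf : IntervalIntegrable (fun q => A T • f q) volume 0 T := hf.smul (A T)
  rw [intervalIntegral.integral_sub hTf hAf, intervalIntegral.integral_smul,
    sub_add_cancel]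

/-- The convolution `∫₀^s e^{-l(s-q)} f(q) dq`. -/
def expConv (l : ℝ) (f : ℝ → V) (s : ℝ) : V :=
  Real.exp (-(l * s)) • ∫ q in (0 : ℝ)..s, Real.exp (l * q) • f q

/-- Convolution with e^{-ls} is the inverse of l + d/ds with zero initial value; this is the left
inverse property and `primitive_expConv` the right one. They are integrations by parts with A =
e^{lr} and A = -e^{-lr}. -/
theorem expConv_primitive [CompleteSpace V] {l : ℝ} (hl : 0 ≤ l) {f : ℝ → V} {T : ℝ} (hT : 0 ≤ T)
    (hf : IntervalIntegrable f volume 0 T) :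
    expConv l (fun r => l • (∫ q in (0 : ℝ)..r, f q) + f r) T = ∫ q in (0 : ℝ)..T, f q := by
  have hA : ∀ r, HasDerivAt (fun r => Real.exp (l * r)) (l * Real.exp (l * r)) r := fun r => by
    simpa [mul_comm] using ((hasDerivAt_id r).const_mul l).exp
  have h := integral_smul_primitive_add hA (by fun_prop) (fun r => by positivity) hT hf
  have hF : ContinuousOn (fun r => ∫ q in (0 : ℝ)..r, f q) (uIcc 0 T) :=
    intervalIntegral.continuousOn_primitive_interval' hf left_mem_uIcc
  unfold expConv
  simp only [smul_add, smul_smul]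
  rw [intervalIntegral.integral_add]
  · simp only [mul_comm l] at h
    simp only [mul_comm l]
    rw [h, smul_smul, ← Real.exp_add]
    simp
  · exact (ContinuousOn.smul (by fun_prop) hF).intervalIntegrable
  · exact hf.continuousOn_smul (by fun_prop)

theorem intervalIntegrable_expConv {l : ℝ} {f : ℝ → V} {T : ℝ}
    (hf : IntervalIntegrable f volume 0 T) : IntervalIntegrable (expConv l f) volume 0 T := by
  have h1 : IntervalIntegrable (fun q => Real.exp (l * q) • f q) volume 0 T :=
    hf.continuousOn_smul (by fun_prop)
  exact (ContinuousOn.smul (by fun_prop)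
    (intervalIntegral.continuousOn_primitive_interval' h1 left_mem_uIcc)).intervalIntegrable

theorem primitive_expConv [CompleteSpace V] {l : ℝ} (hl : 0 ≤ l) {f : ℝ → V} {T : ℝ} (hT : 0 ≤ T)
    (hf : IntervalIntegrable f volume 0 T) :
    ∫ r in (0 : ℝ)..T, (f r - l • expConv l f r) = expConv l f T := by
  have hA : ∀ r, HasDerivAt (fun r => -Real.exp (-(l * r))) (l * Real.exp (-(l * r))) r := fun r => by
    have := (((hasDerivAt_id r).const_mul l).fun_neg.exp).fun_neg
    convert! this using 1
    simp [mul_comm]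
  have h1 : IntervalIntegrable (fun q => Real.exp (l * q) • f q) volume 0 T :=
    hf.continuousOn_smul (by fun_prop)
  have h := integral_smul_primitive_add hA (by fun_prop) (fun r => by positivity) hT h1
  have hlf : IntervalIntegrable (fun r => l • expConv l f r) volume 0 T :=
    (intervalIntegrable_expConv hf).smul l
  rw [intervalIntegral.integral_sub hf hlf]
  have e : ∀ q, -Real.exp (-(l * q)) • Real.exp (l * q) • f q = -f q := fun q => by
    rw [smul_smul, neg_mul, ← Real.exp_add]
    simp
  simp only [e, intervalIntegral.integral_neg, mul_smul] at h
  unfold expConv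
  rw [neg_smul, ← sub_eq_add_neg, sub_eq_iff_eq_add] at h
  rw [h]
  abel

/-- Weighted Cauchy–Schwarz inequality. -/
theorem sq_lintegral_mul_le {α : Type*} [MeasurableSpace α] {μ : Measure α} {w f : α → ℝ≥0∞}
    (hw : AEMeasurable w μ) (hf : AEMeasurable f μ) :
    (∫⁻ x, w x * f x ∂μ) ^ 2 ≤ (∫⁻ x, w x ∂μ) * ∫⁻ x, w x * f x ^ 2 ∂μ := by
  have h := ENNReal.lintegral_mul_le_Lp_mul_Lq μ (p := 2) (q := 2)
    ((Real.holderConjugate_iff).2 (by norm_num)) (hw.pow_const (2⁻¹ : ℝ))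
    ((hw.pow_const (2⁻¹ : ℝ)).mul hf)
  have e0 : ∀ y : ℝ≥0∞, y ^ (2⁻¹ : ℝ) * y ^ (2⁻¹ : ℝ) = y := fun y => by
    rw [← ENNReal.rpow_add_of_nonneg _ _ (by norm_num) (by norm_num)]
    norm_num
  simp only [Pi.mul_apply, ENNReal.rpow_two, mul_pow, ← mul_assoc, e0] at h
  simp only [sq (_ ^ (2⁻¹ : ℝ)), e0] at h
  refine (pow_le_pow_left₀ zero_le h 2).trans_eq ?_
  simp only [mul_pow, one_div, sq ((_ : ℝ≥0∞) ^ (2⁻¹ : ℝ)), e0]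

theorem lintegral_exp_Iic {l : ℝ} (hl : 0 < l) (s : ℝ) :
    ∫⁻ q in Iic s, ENNReal.ofReal (Real.exp (-(l * (s - q)))) = ENNReal.ofReal l⁻¹ := by
  have e : ∀ q, Real.exp (-(l * (s - q))) = Real.exp (-(l * s)) * Real.exp (l * q) := fun q => by
    rw [← Real.exp_add]; ring_nf
  simp only [e]
  rw [← ofReal_integral_eq_lintegral_ofReal ((integrableOn_exp_mul_Iic hl s).const_mul _)
    (ae_of_all _ fun q => by positivity), integral_const_mul, integral_exp_mul_Iic hl, mul_div_assoc',
    ← Real.exp_add]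
  simp

theorem lintegral_exp_Ioi {l : ℝ} (hl : 0 < l) (q : ℝ) :
    ∫⁻ s in Ioi q, ENNReal.ofReal (Real.exp (-(l * (s - q)))) = ENNReal.ofReal l⁻¹ := by
  have e : ∀ s, Real.exp (-(l * (s - q))) = Real.exp (l * q) * Real.exp (-l * s) := fun s => by
    rw [← Real.exp_add]; ring_nf
  simp only [e]
  rw [← ofReal_integral_eq_lintegral_ofReal ((integrableOn_exp_mul_Ioi (neg_lt_zero.2 hl) q).const_mul _)
    (ae_of_all _ fun q => by positivity), integral_const_mul, integral_exp_mul_Ioi (neg_lt_zero.2 hl),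
    neg_div_neg_eq, mul_div_assoc', ← Real.exp_add]
  simp

/-- First half of Schur's test: Cauchy–Schwarz with respect to the kernel, whose mass is at most
1/l. -/
theorem enorm_expConv_sq_le {l : ℝ} (hl : 0 < l) {f : ℝ → V} (hf : StronglyMeasurable f) {s : ℝ}
    (hs : 0 ≤ s) : ‖expConv l f s‖ₑ ^ 2 ≤ ENNReal.ofReal l⁻¹ *
      ∫⁻ q in Ioc 0 s, ENNReal.ofReal (Real.exp (-(l * (s - q)))) * ‖f q‖ₑ ^ 2 := by
  have h1 : ‖expConv l f s‖ₑ ≤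
      ∫⁻ q in Ioc 0 s, ENNReal.ofReal (Real.exp (-(l * (s - q)))) * ‖f q‖ₑ := by
    rw [expConv, ← intervalIntegral.integral_smul, intervalIntegral.integral_of_le hs]
    refine (enorm_integral_le_lintegral_enorm _).trans_eq (lintegral_congr fun q => ?_)
    rw [smul_smul, ← Real.exp_add, enorm_smul, Real.enorm_of_nonneg (Real.exp_nonneg _)]
    congr 3
    ring
  have h2 : ∫⁻ q in Ioc 0 s, ENNReal.ofReal (Real.exp (-(l * (s - q)))) ≤ ENNReal.ofReal l⁻¹ :=
    (lintegral_mono_set Ioc_subset_Iic_self).trans_eq (lintegral_exp_Iic hl s)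
  calc ‖expConv l f s‖ₑ ^ 2 ≤ _ := pow_le_pow_left₀ zero_le h1 2
    _ ≤ _ := sq_lintegral_mul_le (by fun_prop) hf.enorm.aemeasurable
    _ ≤ _ := by gcongr

theorem stronglyMeasurable_setIntegral_Ioc {f : ℝ → V} (hf : StronglyMeasurable f) :
    StronglyMeasurable fun s => ∫ q in Ioc 0 s, f q := by
  have h : StronglyMeasurable fun p : ℝ × ℝ =>
      {p : ℝ × ℝ | 0 < p.2 ∧ p.2 ≤ p.1}.indicator (fun p => f p.2) p :=
    (hf.comp_measurable measurable_snd).indicator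
      ((measurableSet_lt measurable_const measurable_snd).inter
        (measurableSet_le measurable_snd measurable_fst))
  convert! h.integral_prod_right' (ν := volume) using 2 with s
  rw [← integral_indicator measurableSet_Ioc]
  rfl

end Primitive

end MGT

end

noncomputable section

namespace MGT

/-! ## Histories with values in a Hilbert space -/

section Histories

variable {c : ℝ} {g : ℝ → ℝ} {V : Type*} [NormedAddCommGroup V] [InnerProductSpace ℝ V]

theorem ae_Ioc_of_ae_histMeasure (hg : IsMemoryKernel c g) {P : ℝ → Prop}
    (h : ∀ᵐ s ∂(histMeasure g), P s) {T : ℝ} (hT : deriv g T < 0) :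
    ∀ᵐ s ∂(volume.restrict (Ioc 0 T)), P s :=
  ((restrict_Ioc_le_histMeasure hg hT).absolutelyContinuous.trans
    (Measure.smul_absolutelyContinuous)).ae_le h

theorem integrableOn_Ioc_of_memLp {F : Type*} [NormedAddCommGroup F] (hg : IsMemoryKernel c g)
    {f : ℝ → F}
    (hf : MemLp f 2 (histMeasure g)) {T : ℝ} (hT : deriv g T < 0) : IntegrableOn f (Ioc 0 T) := by
  have := isFiniteMeasure_histMeasure hg
  exact ((hf.integrable one_le_two).smul_measure ENNReal.ofReal_ne_top).mono_measure
    (restrict_Ioc_le_histMeasure hg hT)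

theorem intervalIntegrable_of_memLp {F : Type*} [NormedAddCommGroup F] (hg : IsMemoryKernel c g)
    {f : ℝ → F}
    (hf : MemLp f 2 (histMeasure g)) {T : ℝ} (hT0 : 0 ≤ T) (hT : deriv g T < 0) :
    IntervalIntegrable f volume 0 T :=
  (intervalIntegrable_iff_integrableOn_Ioc_of_le hT0).2 (integrableOn_Ioc_of_memLp hg hf hT)

/-- Makes primitives independent of representatives: up to an age T with g'(T) < 0, null sets of the
history measure are Lebesgue null. -/
theorem intervalIntegral_congr_histMeasure (hg : IsMemoryKernel c g) {f f' : ℝ → V}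
    (h : f =ᵐ[histMeasure g] f') {T : ℝ} (hT0 : 0 ≤ T) (hT : deriv g T < 0) :
    ∫ s in (0 : ℝ)..T, f s = ∫ s in (0 : ℝ)..T, f' s := by
  rw [intervalIntegral.integral_of_le hT0, intervalIntegral.integral_of_le hT0]
  exact integral_congr_ae (ae_Ioc_of_ae_histMeasure hg h hT)

/-- `η(s) = ∫₀^s ξ(r) dr` almost everywhere for the history measure. -/
def IsPrim (η ξ : Lp V 2 (histMeasure g)) : Prop :=
  ∀ᵐ s ∂(histMeasure g), η s = ∫ r in (0 : ℝ)..s, ξ r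

theorem isPrim_zero (hg : IsMemoryKernel c g) : IsPrim (0 : Lp V 2 (histMeasure g)) 0 := by
  filter_upwards [Lp.coeFn_zero V 2 (histMeasure g), ae_histMeasure_pos] with s hs h
  rw [hs, intervalIntegral_congr_histMeasure hg (Lp.coeFn_zero V 2 (histMeasure g)) h.1.le h.2]
  simp

theorem IsPrim.add (hg : IsMemoryKernel c g) {η ξ η' ξ' : Lp V 2 (histMeasure g)}
    (h : IsPrim η ξ) (h' : IsPrim η' ξ') : IsPrim (η + η') (ξ + ξ') := by
  filter_upwards [Lp.coeFn_add η η', ae_histMeasure_pos, h, h'] with s hs hp h h'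
  rw [hs, intervalIntegral_congr_histMeasure hg (Lp.coeFn_add ξ ξ') hp.1.le hp.2, Pi.add_apply, h, h']
  exact (intervalIntegral.integral_add (intervalIntegrable_of_memLp hg (Lp.memLp _) hp.1.le hp.2)
    (intervalIntegrable_of_memLp hg (Lp.memLp _) hp.1.le hp.2)).symm

theorem IsPrim.smul (hg : IsMemoryKernel c g) {η ξ : Lp V 2 (histMeasure g)} (a : ℝ)
    (h : IsPrim η ξ) : IsPrim (a • η) (a • ξ) := by
  filter_upwards [Lp.coeFn_smul a η, ae_histMeasure_pos, h] with s hs hp h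
  rw [hs, intervalIntegral_congr_histMeasure hg (Lp.coeFn_smul a ξ) hp.1.le hp.2, Pi.smul_apply, h]
  exact (intervalIntegral.integral_smul a _).symm

theorem eLpNorm_two_sq {α F : Type*} [MeasurableSpace α] {μ : Measure α} [NormedAddCommGroup F]
    (f : α → F) : eLpNorm f 2 μ ^ 2 = ∫⁻ x, ‖f x‖ₑ ^ 2 ∂μ := by
  have h := eLpNorm_nnreal_pow_eq_lintegral (μ := μ) (f := f) (p := 2) two_ne_zero
  simpa using h

theorem aestronglyMeasurable_expConv (l : ℝ) {f : ℝ → V} (hf : StronglyMeasurable f) :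
    AEStronglyMeasurable (expConv l f) (histMeasure g) := by
  have h1 : StronglyMeasurable fun q => Real.exp (l * q) • f q :=
    StronglyMeasurable.smul (by fun_prop : Continuous fun q => Real.exp (l * q)).stronglyMeasurable hf
  have h2 : StronglyMeasurable fun s => Real.exp (-(l * s)) • ∫ q in Ioc 0 s, Real.exp (l * q) • f q :=
    StronglyMeasurable.smul (by fun_prop : Continuous fun s => Real.exp (-(l * s))).stronglyMeasurable
      (stronglyMeasurable_setIntegral_Ioc h1)
  refine h2.aestronglyMeasurable.congr ?_
  filter_upwards [ae_histMeasure_pos] with s hs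
  rw [expConv, intervalIntegral.integral_of_le hs.1.le]

/-- Second half of Schur's test. For q ≤ s the weight satisfies -g'(s) ≤ -g'(q), so it can be moved
from the outer variable to the inner one before the order of integration is exchanged; the kernel
integrated in s again has mass 1/l. -/
theorem eLpNorm_expConv_le (hg : IsMemoryKernel c g) {l : ℝ} (hl : 0 < l) {f : ℝ → V}
    (hf : StronglyMeasurable f) :
    eLpNorm (expConv l f) 2 (histMeasure g) ≤
      ENNReal.ofReal l⁻¹ * eLpNorm f 2 (histMeasure g) := by
  refine (ENNReal.pow_le_pow_left_iff two_ne_zero).1 ?_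
  rw [mul_pow, eLpNorm_two_sq, eLpNorm_two_sq, lintegral_histMeasure, lintegral_histMeasure]
  set k : ℝ → ℝ≥0∞ := fun s => ENNReal.ofReal (-deriv g s)
  have hk : Measurable k := measurable_density g
  set e : ℝ → ℝ → ℝ≥0∞ := fun s q => ENNReal.ofReal (Real.exp (-(l * (s - q))))
  let G : ℝ → ℝ → ℝ≥0∞ := fun s q =>
    {p : ℝ × ℝ | p.2 ≤ p.1}.indicator (fun p => k p.2 * (e p.1 p.2 * ‖f p.2‖ₑ ^ 2)) (s, q)
  have hGm : Measurable (Function.uncurry G) := by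
    refine Measurable.indicator ?_ (measurableSet_le measurable_snd measurable_fst)
    have h1 : Measurable fun p : ℝ × ℝ => e p.1 p.2 := by fun_prop
    exact (hk.comp measurable_snd).mul (h1.mul ((hf.enorm.comp measurable_snd).pow_const 2))
  have step : ∀ s ∈ Ioi (0 : ℝ), k s * ‖expConv l f s‖ₑ ^ 2 ≤
      ENNReal.ofReal l⁻¹ * ∫⁻ q in Ioi 0, G s q := fun s hs => by
    have hs : 0 < s := hs
    refine (mul_le_mul_right (enorm_expConv_sq_le hl hf hs.le) _).trans ?_
    rw [mul_left_comm]
    refine mul_le_mul_right ?_ _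
    rw [← lintegral_const_mul' _ _ ENNReal.ofReal_ne_top]
    have hG : ∀ q, G s q = (Iic s).indicator (fun q => k q * (e s q * ‖f q‖ₑ ^ 2)) q := fun q => rfl
    simp only [hG]
    rw [lintegral_indicator measurableSet_Iic, Measure.restrict_restrict measurableSet_Iic,
      inter_comm, Ioi_inter_Iic]
    refine setLIntegral_mono' measurableSet_Ioc fun q hq => ?_
    refine mul_le_mul_left (ENNReal.ofReal_le_ofReal (neg_le_neg ?_)) _
    exact hg.deriv_monotoneOn hq.1 hs hq.2
  refine (setLIntegral_mono' measurableSet_Ioi step).trans ?_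
  rw [lintegral_const_mul' _ _ ENNReal.ofReal_ne_top, sq (ENNReal.ofReal _), mul_assoc,
    lintegral_lintegral_swap hGm.aemeasurable]
  refine mul_le_mul_right ?_ _
  rw [← lintegral_const_mul' _ _ ENNReal.ofReal_ne_top]
  refine setLIntegral_mono' measurableSet_Ioi fun q hq => ?_
  have hq : 0 < q := hq
  have hG : ∀ s, G s q = (Ici q).indicator (fun s => e s q * (k q * ‖f q‖ₑ ^ 2)) s := fun s => by
    change (Ici q).indicator (fun s => k q * (e s q * ‖f q‖ₑ ^ 2)) s = _
    congr 1
    funext s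
    ring
  simp only [hG]
  rw [lintegral_indicator measurableSet_Ici]
  have hm : (volume.restrict (Ioi (0 : ℝ))).restrict (Ici q) ≤ volume.restrict (Ici q) :=
    Measure.restrict_mono subset_rfl Measure.restrict_le_self
  refine (lintegral_mono' hm le_rfl).trans_eq ?_
  rw [lintegral_mul_const _ (by fun_prop), setLIntegral_congr Ioi_ae_eq_Ici.symm,
    lintegral_exp_Ioi hl]

theorem memLp_expConv (hg : IsMemoryKernel c g) {l : ℝ} (hl : 0 < l)
    (ζ : Lp V 2 (histMeasure g)) : MemLp (expConv l ζ) 2 (histMeasure g) :=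
  ⟨aestronglyMeasurable_expConv l (Lp.stronglyMeasurable ζ),
    (eLpNorm_expConv_le hg hl (Lp.stronglyMeasurable ζ)).trans_lt
      (ENNReal.mul_lt_top ENNReal.ofReal_lt_top (Lp.eLpNorm_lt_top ζ))⟩

variable [CompleteSpace V]

theorem isPrim_expConv (hg : IsMemoryKernel c g) {l : ℝ} (hl : 0 < l)
    (ζ : Lp V 2 (histMeasure g)) :
    IsPrim ((memLp_expConv hg hl ζ).toLp _) (ζ - l • (memLp_expConv hg hl ζ).toLp _) := by
  set η := (memLp_expConv hg hl ζ).toLp _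
  have hη : η =ᵐ[histMeasure g] expConv l ζ := (memLp_expConv hg hl ζ).coeFn_toLp
  have h1 : (ζ - l • η : Lp V 2 (histMeasure g)) =ᵐ[histMeasure g]
      fun s => ζ s - l • expConv l ζ s := by
    filter_upwards [Lp.coeFn_sub ζ (l • η), Lp.coeFn_smul l η, hη] with s h1 h2 h3
    rw [h1, Pi.sub_apply, h2, Pi.smul_apply, h3]
  filter_upwards [hη, ae_histMeasure_pos] with s hs hp
  rw [hs, intervalIntegral_congr_histMeasure hg h1 hp.1.le hp.2,
    primitive_expConv hl.le hp.1.le (intervalIntegrable_of_memLp hg (Lp.memLp _) hp.1.le hp.2)]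

/-- Here η is the exponential convolution of l η + ξ, so the norm bound 1/l of that operator
applies. This replaces an integration by parts in age with its boundary terms. -/
theorem IsPrim.norm_le (hg : IsMemoryKernel c g) {η ξ : Lp V 2 (histMeasure g)} (h : IsPrim η ξ)
    {l : ℝ} (hl : 0 < l) : l * ‖η‖ ≤ ‖l • η + ξ‖ := by
  have h1 : (l • η + ξ : Lp V 2 (histMeasure g)) =ᵐ[histMeasure g]
      fun r => l • (∫ q in (0 : ℝ)..r, ξ q) + ξ r := by
    filter_upwards [Lp.coeFn_add (l • η) ξ, Lp.coeFn_smul l η, h] with s h1 h2 h3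
    rw [h1, Pi.add_apply, h2, Pi.smul_apply, h3]
  have h2 : η =ᵐ[histMeasure g] expConv l (l • η + ξ : Lp V 2 (histMeasure g)) := by
    filter_upwards [h, ae_histMeasure_pos] with s hs hp
    rw [hs, ← expConv_primitive hl.le hp.1.le
      (intervalIntegrable_of_memLp hg (Lp.memLp ξ) hp.1.le hp.2), expConv, expConv]
    congr 1
    refine intervalIntegral_congr_histMeasure hg ?_ hp.1.le hp.2
    filter_upwards [h1] with r hr
    rw [hr]
  have h3 : ‖η‖ₑ ≤ ENNReal.ofReal l⁻¹ * ‖l • η + ξ‖ₑ := by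
    rw [Lp.enorm_def, Lp.enorm_def, eLpNorm_congr_ae h2]
    exact eLpNorm_expConv_le hg hl (Lp.stronglyMeasurable _)
  have h4 : ‖η‖ ≤ l⁻¹ * ‖l • η + ξ‖ := by
    have := ENNReal.toReal_mono (by finiteness) h3
    rwa [ENNReal.toReal_mul, toReal_enorm, toReal_enorm,
      ENNReal.toReal_ofReal (inv_nonneg.2 hl.le)] at this
  rwa [inv_mul_eq_div, le_div_iff₀' hl] at h4

/-- Monotonicity of the derivative with respect to age. -/
theorem IsPrim.inner_nonneg (hg : IsMemoryKernel c g) {η ξ : Lp V 2 (histMeasure g)}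
    (h : IsPrim η ξ) : 0 ≤ inner ℝ ξ η := by
  -- Square the bound l ‖η‖ ≤ ‖l η + ξ‖, cancel l² ‖η‖² and divide by 2l; then l → ∞.
  have key : ∀ l : ℝ, 0 < l → 0 ≤ inner ℝ ξ η + ‖ξ‖ ^ 2 / 2 * l⁻¹ := fun l hl => by
    have h1 := pow_le_pow_left₀ (by positivity) (h.norm_le hg hl) 2
    rw [mul_pow, norm_add_sq_real, norm_smul, Real.norm_eq_abs, abs_of_pos hl, mul_pow,
      inner_smul_left, real_inner_comm] at h1
    simp only [conj_trivial] at h1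
    have : 0 ≤ l * (2 * inner ℝ ξ η) + ‖ξ‖ ^ 2 := by linarith
    have h2 : 0 ≤ (l * (2 * inner ℝ ξ η) + ‖ξ‖ ^ 2) * (2 * l)⁻¹ := by positivity
    have e : (l * (2 * inner ℝ ξ η) + ‖ξ‖ ^ 2) * (2 * l)⁻¹ = inner ℝ ξ η + ‖ξ‖ ^ 2 / 2 * l⁻¹ := by
      field_simp
    rwa [e] at h2
  have ht : Tendsto (fun l : ℝ => inner ℝ ξ η + ‖ξ‖ ^ 2 / 2 * l⁻¹) atTop (𝓝 (inner ℝ ξ η)) := by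
    simpa using (tendsto_inv_atTop_zero.const_mul (‖ξ‖ ^ 2 / 2)).const_add (inner ℝ ξ η)
  exact ge_of_tendsto ht ((eventually_gt_atTop 0).mono fun l hl => key l hl)

/-- The derivative with respect to age is unique. -/
theorem IsPrim.eq_zero (hg : IsMemoryKernel c g) {ξ : Lp V 2 (histMeasure g)} (h : IsPrim 0 ξ) :
    ξ = 0 := by
  have h0 : ∀ᵐ s : ℝ, 0 < s → deriv g s < 0 → ∫ r in (0 : ℝ)..s, ξ r = 0 := by
    refine ae_histMeasure_iff.1 ?_
    filter_upwards [h, Lp.coeFn_zero V 2 (histMeasure g)] with s hs h0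
    rw [← hs, h0]
    rfl
  have hT : ∀ T : ℝ, 0 < T → deriv g T < 0 → ∀ᵐ s : ℝ, s ∈ Ioo 0 T → ξ s = 0 := by
    intro T hT0 hT
    have hi := intervalIntegrable_of_memLp hg (Lp.memLp ξ) hT0.le hT
    have hc : ContinuousOn (fun s => ∫ r in (0 : ℝ)..s, ξ r) (Ioo 0 T) := by
      have := intervalIntegral.continuousOn_primitive_interval' hi left_mem_uIcc
      rw [uIcc_of_le hT0.le] at this
      exact this.mono Ioo_subset_Icc_self
    have hz : EqOn (fun s => ∫ r in (0 : ℝ)..s, ξ r) (fun _ => (0 : V)) (Ioo 0 T) := by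
      -- The primitive vanishes almost everywhere and is continuous, hence vanishes identically on
      -- (0, T); Lebesgue differentiation then kills ξ.
      refine Measure.eqOn_open_of_ae_eq (μ := volume) ?_ isOpen_Ioo hc continuousOn_const
      refine (ae_restrict_iff' measurableSet_Ioo).2 (h0.mono fun s hs hsT => ?_)
      exact hs hsT.1 ((hg.deriv_monotoneOn hsT.1 hT0 hsT.2.le).trans_lt hT)
    filter_upwards [hi.ae_hasDerivAt_integral] with s hs hsT
    have h1 := hs (by rw [uIcc_of_le hT0.le]; exact Ioo_subset_Icc_self hsT) 0 left_mem_uIcc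
    exact h1.unique ((hasDerivAt_const s (0 : V)).congr_of_eventuallyEq
      (hz.eventuallyEq_of_mem (isOpen_Ioo.mem_nhds hsT)))
  -- Rational endpoints keep the exceptional set null. By continuity of g', every s with g'(s) < 0
  -- lies below a rational q with g'(q) < 0.
  have hall : ∀ᵐ s : ℝ, ∀ q : ℚ, 0 < (q : ℝ) → deriv g q < 0 → s ∈ Ioo 0 (q : ℝ) → ξ s = 0 := by
    refine ae_all_iff.2 fun q => ?_
    by_cases hq : 0 < (q : ℝ) ∧ deriv g q < 0
    · filter_upwards [hT q hq.1 hq.2] with s hs _ _ using hs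
    · exact ae_of_all _ fun s h1 h2 => absurd ⟨h1, h2⟩ hq
  refine Lp.ext (EventuallyEq.trans ?_ (Lp.coeFn_zero V 2 (histMeasure g)).symm)
  refine ae_histMeasure_iff.2 (hall.mono fun s hs h1 h2 => ?_)
  have hcs : ContinuousAt (deriv g) s := hg.continuousOn_deriv.continuousAt (Ioi_mem_nhds h1)
  have hev : ∀ᶠ t in 𝓝[>] s, deriv g t < 0 :=
    (hcs.eventually (gt_mem_nhds h2)).filter_mono nhdsWithin_le_nhds
  obtain ⟨u, hu, hsub⟩ := (mem_nhdsGT_iff_exists_Ioo_subset).1 hev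
  obtain ⟨q, hq1, hq2⟩ := exists_rat_btwn (show s < u from hu)
  exact hs q (h1.trans hq1) (hsub ⟨hq1, hq2⟩) ⟨h1, hq1⟩

end Histories

end MGT

end

noncomputable section

namespace MGT

/-! ## The memory functional -/

section Memory

variable {c : ℝ} {g : ℝ → ℝ} {V : Type*} [NormedAddCommGroup V] [InnerProductSpace ℝ V]

theorem IsMemoryKernel.exists_le (hg : IsMemoryKernel c g) :
    ∃ C, 0 ≤ C ∧ ∀ s > 0, g s ≤ C * -deriv g s := by
  obtain ⟨ζ, hζ, h⟩ := hg.decay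
  refine ⟨ζ⁻¹, inv_nonneg.2 hζ.le, fun s hs => ?_⟩
  rw [inv_mul_eq_div, le_div_iff₀' hζ]
  linarith [h s hs]

theorem integrable_histMeasure_iff (hg : IsMemoryKernel c g) {f : ℝ → V} :
    Integrable f (histMeasure g) ↔ IntegrableOn (fun s => (-deriv g s) • f s) (Ioi 0) := by
  rw [histMeasure, integrable_withDensity_iff_integrable_smul' (measurable_density g)
    (ae_of_all _ fun _ => ENNReal.ofReal_lt_top)]
  refine integrable_congr ((ae_restrict_iff' measurableSet_Ioi).2 (ae_of_all _ fun s hs => ?_))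
  simp only [ENNReal.toReal_ofReal (neg_nonneg.2 (hg.deriv_nonpos hs))]

theorem integrableOn_kernel_smul (hg : IsMemoryKernel c g) (η : Lp V 2 (histMeasure g)) :
    IntegrableOn (fun s => g s • η s) (Ioi 0) := by
  have := isFiniteMeasure_histMeasure hg
  obtain ⟨C, hC, h⟩ := hg.exists_le
  have h1 := (integrable_histMeasure_iff hg).1 ((Lp.memLp η).integrable one_le_two)
  refine (h1.norm.const_mul C).mono' (hg.integrable.aestronglyMeasurable.smul
    (Lp.stronglyMeasurable η).aestronglyMeasurable)
    ((ae_restrict_iff' measurableSet_Ioi).2 (ae_of_all _ fun s hs => ?_))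
  rw [norm_smul, norm_smul, Real.norm_eq_abs, Real.norm_eq_abs, abs_of_nonneg (hg.nonneg s hs),
    abs_of_nonneg (neg_nonneg.2 (hg.deriv_nonpos hs)), ← mul_assoc]
  exact mul_le_mul_of_nonneg_right (h s hs) (norm_nonneg _)

/-- The ratio is bounded by 1/ζ and the measure is finite. Pairing with it in L² of the history
measure makes η ↦ ∫ g η a bounded operator. -/
theorem memLp_ratio (hg : IsMemoryKernel c g) :
    MemLp (fun s => g s / -deriv g s) 2 (histMeasure g) := by
  have := isFiniteMeasure_histMeasure hg
  obtain ⟨C, hC, h⟩ := hg.exists_le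
  refine MemLp.of_bound (C := C) ?_ ?_
  · have h1 := hg.integrable.aestronglyMeasurable.mono_ac (histMeasure_absolutelyContinuous g)
    exact (h1.aemeasurable.div (measurable_deriv g).neg.aemeasurable).aestronglyMeasurable
  · filter_upwards [ae_histMeasure_pos] with s hs
    have hp : 0 < -deriv g s := by linarith [hs.2]
    rw [norm_div, Real.norm_of_nonneg (hg.nonneg s hs.1), Real.norm_of_nonneg hp.le, div_le_iff₀ hp]
    exact h s hs.1

/-- The memory integral `∫₀^∞ g(s) η(s) ds`. -/
def memInt (hg : IsMemoryKernel c g) [CompleteSpace V] : Lp V 2 (histMeasure g) →L[ℝ] V :=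
  (ContinuousLinearMap.lsmul ℝ ℝ).lpPairing (histMeasure g) 2 2 ((memLp_ratio hg).toLp _)

/-- The integral `∫₀^∞ -g'(s) η(s) ds`. -/
def histInt (hg : IsMemoryKernel c g) [CompleteSpace V] : Lp V 2 (histMeasure g) →L[ℝ] V :=
  have := isFiniteMeasure_histMeasure hg
  (ContinuousLinearMap.lsmul ℝ ℝ).lpPairing (histMeasure g) 2 2 (Lp.const 2 (histMeasure g) 1)

/-- Constant histories. -/
def histConst (hg : IsMemoryKernel c g) : V →L[ℝ] Lp V 2 (histMeasure g) :=
  have := isFiniteMeasure_histMeasure hg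
  Lp.constL 2 (histMeasure g) ℝ

theorem coeFn_histConst (hg : IsMemoryKernel c g) (x : V) :
    histConst hg x =ᵐ[histMeasure g] fun _ => x :=
  have := isFiniteMeasure_histMeasure hg
  Lp.coeFn_const (p := 2) (μ := histMeasure g) x

variable [CompleteSpace V]

theorem memInt_apply (hg : IsMemoryKernel c g) (η : Lp V 2 (histMeasure g)) :
    memInt hg η = ∫ s in Ioi (0 : ℝ), g s • η s := by
  rw [memInt, ContinuousLinearMap.lpPairing_eq_integral]
  have h1 : ∀ᵐ s ∂(histMeasure g),
      (ContinuousLinearMap.lsmul ℝ ℝ) ((memLp_ratio hg).toLp _ s) (η s) =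
        (g s / -deriv g s) • η s := by
    filter_upwards [(memLp_ratio hg).coeFn_toLp] with s hs
    rw [hs]
    rfl
  rw [integral_congr_ae h1, integral_histMeasure hg]
  refine setIntegral_congr_fun measurableSet_Ioi fun s hs => ?_
  simp only [smul_smul]
  congr 1
  -- Where g' vanishes, 0 ≤ g ≤ C (-g') forces g = 0, so the quotient by zero does no harm.
  by_cases h0 : -deriv g s = 0
  · obtain ⟨C, hC, h⟩ := hg.exists_le
    have := h s hs
    rw [h0, mul_zero] at this
    rw [h0, zero_mul, le_antisymm this (hg.nonneg s hs)]
  · rw [mul_div_assoc', mul_div_cancel_left₀ _ h0]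

theorem histInt_apply (hg : IsMemoryKernel c g) (η : Lp V 2 (histMeasure g)) :
    histInt hg η = ∫ s, η s ∂(histMeasure g) := by
  have := isFiniteMeasure_histMeasure hg
  rw [histInt, ContinuousLinearMap.lpPairing_eq_integral]
  refine integral_congr_ae ?_
  filter_upwards [Lp.coeFn_const (p := 2) (μ := histMeasure g) (1 : ℝ)] with s hs
  rw [hs]
  simp

/-- Insert g(q) = ∫_q^∞ -g' and exchange the integrations: ∫ g η_s = ∫ (-g') η, without boundary
terms. The age derivative thus disappears from the equation for `effL`. -/
theorem IsPrim.memInt_eq (hg : IsMemoryKernel c g) {η ξ : Lp V 2 (histMeasure g)}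
    (h : IsPrim η ξ) : memInt hg ξ = histInt hg η := by
  rw [memInt_apply, histInt_apply, integral_congr_ae h, integral_histMeasure hg]
  have e1 : ∀ q ∈ Ioi (0 : ℝ), ∫ r in Ioi q, -deriv g r ∂(volume.restrict (Ioi 0)) = g q :=
    fun q hq => by
      rw [Measure.restrict_restrict measurableSet_Ioi, Ioi_inter_Ioi, sup_eq_left.2 (le_of_lt hq),
        hg.integral_Ioi_neg_deriv hq]
  have main := integral_smul_integral_Iio (ν := volume.restrict (Ioi (0 : ℝ)))
    (a := fun r => -deriv g r) (f := ξ) hg.deriv_integrable.neg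
    ((ae_restrict_iff' measurableSet_Ioi).2 (ae_of_all _ fun s hs =>
      neg_nonneg.2 (hg.deriv_nonpos hs)))
    (Lp.stronglyMeasurable ξ).aestronglyMeasurable
    ((integrableOn_kernel_smul hg ξ).congr ((ae_restrict_iff' measurableSet_Ioi).2
      (ae_of_all _ fun q hq => by simp only [e1 q hq])))
  have l1 : ∫ q in Ioi (0 : ℝ), (∫ r in Ioi q, -deriv g r ∂(volume.restrict (Ioi 0))) • ξ q =
      ∫ q in Ioi (0 : ℝ), g q • ξ q :=
    setIntegral_congr_fun measurableSet_Ioi fun q hq => by simp only [e1 q hq]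
  rw [← l1, ← main]
  refine setIntegral_congr_fun measurableSet_Ioi fun r hr => ?_
  have hr : 0 < r := hr
  rw [Measure.restrict_restrict measurableSet_Iio, intervalIntegral.integral_of_le hr.le,
    inter_comm, Ioi_inter_Iio, integral_Ioc_eq_integral_Ioo]

theorem memInt_congr (hg : IsMemoryKernel c g) {η : Lp V 2 (histMeasure g)} {f : ℝ → V}
    (h : η =ᵐ[histMeasure g] f) : memInt hg η = ∫ s in Ioi (0 : ℝ), g s • f s := by
  rw [memInt_apply]
  refine setIntegral_congr_ae measurableSet_Ioi ?_
  filter_upwards [ae_histMeasure_iff.1 h] with s hs hs0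
  by_cases h0 : deriv g s < 0
  · rw [hs hs0 h0]
  · obtain ⟨C, hC, h⟩ := hg.exists_le
    have h1 := h s hs0
    rw [le_antisymm (hg.deriv_nonpos hs0) (not_lt.1 h0), neg_zero, mul_zero] at h1
    rw [le_antisymm h1 (hg.nonneg s hs0), zero_smul, zero_smul]

theorem memInt_histConst (hg : IsMemoryKernel c g) (x : V) :
    memInt hg (histConst hg x) = (∫ s in Ioi (0 : ℝ), g s) • x := by
  rw [memInt_congr hg (coeFn_histConst hg x), integral_smul_const]

/-- A constant history contributes a nonnegative multiple of itself to the memory term, with a = ∫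
g(s) (1 - e^{-ls})/l ds; the sign preserves ellipticity in the resolvent equation. -/
theorem exists_memInt_expConv_histConst (hg : IsMemoryKernel c g) {l : ℝ} (hl : 0 < l) :
    ∃ a : ℝ, 0 ≤ a ∧ ∀ x : V,
      memInt hg ((memLp_expConv hg hl (histConst hg x)).toLp _) = a • x := by
  refine ⟨∫ s in Ioi (0 : ℝ), g s * ((1 - Real.exp (-(l * s))) / l),
    setIntegral_nonneg measurableSet_Ioi fun s hs => ?_, fun x => ?_⟩
  · have hs : 0 < s := hs
    have h1 : Real.exp (-(l * s)) ≤ 1 := Real.exp_le_one_iff.2 (by nlinarith)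
    exact mul_nonneg (hg.nonneg s hs) (div_nonneg (by linarith) hl.le)
  · rw [← integral_smul_const]
    have h1 : ((memLp_expConv hg hl (histConst hg x)).toLp _ : Lp V 2 (histMeasure g))
        =ᵐ[histMeasure g] fun s => ((1 - Real.exp (-(l * s))) / l) • x := by
      filter_upwards [(memLp_expConv hg hl (histConst hg x)).coeFn_toLp, ae_histMeasure_pos]
        with s hs hp
      have h2 : (fun q => Real.exp (l * q) • (histConst hg x : Lp V 2 (histMeasure g)) q)
          =ᵐ[histMeasure g] fun q => Real.exp (l * q) • x := by
        filter_upwards [coeFn_histConst hg x] with q hq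
        rw [hq]
      rw [hs, expConv, intervalIntegral_congr_histMeasure hg h2 hp.1.le hp.2,
        intervalIntegral.integral_smul_const, 
        intervalIntegral.integral_comp_mul_left Real.exp hl.ne', integral_exp, smul_smul, mul_zero,
        Real.exp_zero, smul_eq_mul, inv_mul_eq_div, mul_div_assoc', mul_sub, ← Real.exp_add,
        neg_add_cancel, Real.exp_zero, mul_one]
    rw [memInt_congr hg h1]
    simp only [smul_smul]

end Memory

end MGT

end

noncomputable section

namespace MGT

/-! ## Generation with respect to an equivalent inner product -/

section EquivalentForm

variable {H T : Type*} [NormedAddCommGroup H] [InnerProductSpace ℝ H] [CompleteSpace H]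
  [NormedAddCommGroup T] [InnerProductSpace ℝ T] [CompleteSpace T]

/-- An operator that is quasi-m-dissipative for the inner product `⟪J x, J y⟫`, where `J` is bounded
and bounded below, generates a `C₀`-semigroup. -/
theorem exists_semigroup_of_form (J : H →L[ℝ] T) {δ : ℝ≥0} (hJ : AntilipschitzWith δ J)
    (G : Submodule ℝ (H × H)) {γ : ℝ} (hγ : 0 ≤ γ)
    (hdiss : ∀ q ∈ G, inner ℝ (J q.2) (J q.1) ≤ γ * ‖J q.1‖ ^ 2)
    (hsurj : ∀ l > γ, ∀ f, ∃ q ∈ G, l • q.1 - q.2 = f) (hsingle : ∀ y, (0, y) ∈ G → y = 0) :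
    ∃ S : C0Semigroup H, S.IsGenerator {x | ∃ y, (x, y) ∈ G} fun x y => (x, y) ∈ G := by
  have hcl : IsClosed (range J) := hJ.isClosed_range J.uniformContinuous
  -- The range of J, with the inner product of T, serves as H with the new inner product. The graph
  -- is carried there and the semigroup is carried back.
  let e : H ≃L[ℝ] J.range := J.equivRange hJ.injective hcl
  have he : ∀ x, ((e x : J.range) : T) = J x := fun x => rfl
  have : CompleteSpace J.range := by
    have : IsClosed (J.range : Set T) := by
      rw [LinearMap.coe_range]
      exact hcl
    exact this.completeSpace_coe
  let E : J.range × J.range →ₗ[ℝ] H × H :=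
    LinearMap.prodMap (e.symm : J.range →ₗ[ℝ] H) (e.symm : J.range →ₗ[ℝ] H)
  have hE : ∀ q, E q = (e.symm q.1, e.symm q.2) := fun q => rfl
  have hq : IsQuasiMDissipative (G.comap E) γ := by
    refine ⟨hγ, fun q hq => ?_, fun l hl f => ?_, fun y hy => ?_⟩
    · have := hdiss _ hq
      rw [hE] at this
      simp only [← he, ContinuousLinearEquiv.apply_symm_apply] at this
      exact this
    · obtain ⟨q, hqG, hqf⟩ := hsurj l hl (e.symm f)
      refine ⟨(e q.1, e q.2), ?_, ?_⟩
      · rw [Submodule.mem_comap, hE]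
        simpa using hqG
      · apply e.symm.injective
        simpa using hqf
    · rw [Submodule.mem_comap, hE] at hy
      simp only [map_zero] at hy
      simpa using hsingle _ hy
  obtain ⟨S, hS⟩ := hq.exists_semigroup
  obtain ⟨S', hS'⟩ := exists_semigroup_of_equiv e S hS
  refine ⟨S', ?_⟩
  convert! hS' using 1
  · ext x
    constructor
    · rintro ⟨y, hy⟩
      exact ⟨e y, by simpa [hE] using hy⟩
    · rintro ⟨y, hy⟩
      exact ⟨e.symm y, by simpa [hE] using hy⟩
  · funext x y
    simp [hE]

end EquivalentForm

/-! ## Further maps between the Sobolev spaces -/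

section Maps

variable {n : ℕ}

/-- A word as a word of possibly greater length. -/
def Word.lift {p : ℕ} (α : Word n p) : Word n (p + 1) := ⟨α.1.castSucc, α.2⟩

/-- The inclusion `H^{p+1} → H^p`. -/
def Sob.lower {p : ℕ} (u : Sob n (p + 1)) : Sob n p :=
  (⟨WithLp.toLp 2 fun α : Word n p => u.d α.lift, fun α => u.hasWeakDeriv α.lift⟩ :
    sobSubmodule n p)

theorem Word.cons_nil (p : ℕ) (j : Fin n) : Word.cons j (Word.nil n p) = HomWord.single p j :=
  Sigma.ext rfl (heq_of_eq (funext fun i => match i with | ⟨0, _⟩ => rfl))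

/-- The partial derivative `∂_j ψ`, as an element of `H^p`. -/
def HomSob.pd {p : ℕ} (z : HomSob n (p + 1)) (j : Fin n) : Sob n p :=
  (⟨WithLp.toLp 2 fun α : Word n p => z.d (Word.cons j α), fun α => by
    obtain ⟨ψ, hψ⟩ := z.2
    have h0 := hψ.hasWeakPD j
    have h := h0.of_cons (hψ.2 (Word.cons j α))
    change HasWeakDeriv α.2 (z.d (Word.cons j (Word.nil n p))) (z.d (Word.cons j α))
    rw [Word.cons_nil]
    exact h⟩ : sobSubmodule n p)

theorem HomSob.pd_fn {p : ℕ} (z : HomSob n (p + 1)) (j : Fin n) :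
    (z.pd j).fn = z.d (HomWord.single p j) := by
  rw [← Word.cons_nil]
  rfl

theorem IsWeakDiv.add {F F' : Fin n → L2 n} {f f' : L2 n} (h : IsWeakDiv F f)
    (h' : IsWeakDiv F' f') : IsWeakDiv (F + F') (f + f') := by
  intro φ hφ hc
  have hd : ∀ j, Continuous (pd j φ) ∧ HasCompactSupport (pd j φ) := fun j =>
    ⟨(contDiff_pd j hφ).continuous, hasCompactSupport_pd j hc⟩
  have e : ∀ (u u' : L2 n) (χ : E n → ℝ), Continuous χ → HasCompactSupport χ →
      ∫ x, (u + u' : L2 n) x * χ x = (∫ x, u x * χ x) + ∫ x, u' x * χ x := fun u u' χ h1 h2 => by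
    rw [← inner_testL2 h1 h2, ← inner_testL2 h1 h2, ← inner_testL2 h1 h2, inner_add_right]
  rw [e _ _ _ hφ.continuous hc, h φ hφ hc, h' φ hφ hc, ← neg_add, ← Finset.sum_add_distrib]
  congr 1
  exact Finset.sum_congr rfl fun j _ => (e _ _ _ (hd j).1 (hd j).2).symm

theorem IsWeakDiv.smul {F : Fin n → L2 n} {f : L2 n} (a : ℝ) (h : IsWeakDiv F f) :
    IsWeakDiv (a • F) (a • f) := by
  intro φ hφ hc
  have hd : ∀ j, Continuous (pd j φ) ∧ HasCompactSupport (pd j φ) := fun j =>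
    ⟨(contDiff_pd j hφ).continuous, hasCompactSupport_pd j hc⟩
  have e : ∀ (u : L2 n) (χ : E n → ℝ), Continuous χ → HasCompactSupport χ →
      ∫ x, (a • u : L2 n) x * χ x = a * ∫ x, u x * χ x := fun u χ h1 h2 => by
    rw [← inner_testL2 h1 h2, ← inner_testL2 h1 h2, inner_smul_right]
  rw [e _ _ hφ.continuous hc, h φ hφ hc, mul_neg, Finset.mul_sum]
  congr 1
  exact Finset.sum_congr rfl fun j _ => (e _ _ (hd j).1 (hd j).2).symm

theorem isWeakDiv_zero : IsWeakDiv (0 : Fin n → L2 n) 0 := by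
  have h : ∀ χ : E n → ℝ, ∫ x, (0 : L2 n) x * χ x = 0 := fun χ => by
    refine integral_eq_zero_of_ae ?_
    filter_upwards [Lp.coeFn_zero ℝ 2 (volume : Measure (E n))] with x hx
    rw [hx]
    simp
  intro φ hφ hc
  simp only [Pi.zero_apply, h, Finset.sum_const_zero, neg_zero]

theorem IsWeakDiv.unique {F : Fin n → L2 n} {f f' : L2 n} (h : IsWeakDiv F f)
    (h' : IsWeakDiv F f') : f = f' :=
  Lp.ext (ae_eq_of_integral_mul_eq (locallyIntegrable_L2 f) (locallyIntegrable_L2 f')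
    fun φ hφ hc => (h φ hφ hc).trans (h' φ hφ hc).symm)

end Maps

end MGT

end

noncomputable section

namespace MGT

/-! ## The state space -/

section StateSpace

/-- A pair of bounded operators as an operator into the Hilbert sum. -/
def pairL {H A B : Type*} [NormedAddCommGroup H] [NormedSpace ℝ H] [NormedAddCommGroup A]
    [InnerProductSpace ℝ A] [NormedAddCommGroup B] [InnerProductSpace ℝ B] (f : H →L[ℝ] A)
    (h : H →L[ℝ] B) : H →L[ℝ] WithLp 2 (A × B) :=
  ((WithLp.prodContinuousLinearEquiv 2 ℝ A B).symm : A × B →L[ℝ] WithLp 2 (A × B)).comp (f.prod h)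

theorem inner_pairL {H A B : Type*} [NormedAddCommGroup H] [NormedSpace ℝ H] [NormedAddCommGroup A]
    [InnerProductSpace ℝ A] [NormedAddCommGroup B] [InnerProductSpace ℝ B] (f : H →L[ℝ] A)
    (h : H →L[ℝ] B) (x y : H) :
    inner ℝ (pairL f h x) (pairL f h y) = inner ℝ (f x) (f y) + inner ℝ (h x) (h y) :=
  WithLp.prod_inner_apply _ _

variable {n p : ℕ} {c : ℝ} {g : ℝ → ℝ}

/-- Histories as elements of `L²`. -/
def Hist.toLp {m : ℕ} : Hist n m g ≃ₗᵢ[ℝ] Lp (HomSob n m) 2 (histMeasure g) :=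
  LinearIsometryEquiv.refl ℝ (Lp (HomSob n m) 2 (histMeasure g))

theorem Hist.rep_eq {m : ℕ} (η : Hist n m g) : η.rep = Hist.toLp η := rfl

namespace State

/-- The state with given components. -/
def mk (ψ : HomSob n (p + 1)) (v : Sob n (p + 1)) (w : Sob n p) (η : Hist n (p + 1) g) :
    State n p g :=
  WithLp.toLp 2 (WithLp.toLp 2 (ψ, v), WithLp.toLp 2 (w, η))

theorem ext' {Ψ Φ : State n p g} (h1 : Ψ.psi = Φ.psi) (h2 : Ψ.v = Φ.v) (h3 : Ψ.w = Φ.w)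
    (h4 : Ψ.eta = Φ.eta) : Ψ = Φ :=
  WithLp.ofLp_injective 2 (Prod.ext (WithLp.ofLp_injective 2 (Prod.ext h1 h2))
    (WithLp.ofLp_injective 2 (Prod.ext h3 h4)))

/-- first component -/
def psiL : State n p g →L[ℝ] HomSob n (p + 1) :=
  (WithLp.fstL 2 ℝ (HomSob n (p + 1)) (Sob n (p + 1))).comp
    (WithLp.fstL 2 ℝ (WithLp 2 (HomSob n (p + 1) × Sob n (p + 1)))
      (WithLp 2 (Sob n p × Hist n (p + 1) g)))

/-- second component -/
def vL : State n p g →L[ℝ] Sob n (p + 1) :=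
  (WithLp.sndL 2 ℝ (HomSob n (p + 1)) (Sob n (p + 1))).comp
    (WithLp.fstL 2 ℝ (WithLp 2 (HomSob n (p + 1) × Sob n (p + 1)))
      (WithLp 2 (Sob n p × Hist n (p + 1) g)))

/-- third component -/
def wL : State n p g →L[ℝ] Sob n p :=
  (WithLp.fstL 2 ℝ (Sob n p) (Hist n (p + 1) g)).comp
    (WithLp.sndL 2 ℝ (WithLp 2 (HomSob n (p + 1) × Sob n (p + 1)))
      (WithLp 2 (Sob n p × Hist n (p + 1) g)))

/-- fourth component -/
def etaL : State n p g →L[ℝ] Lp (HomSob n (p + 1)) 2 (histMeasure g) :=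
  ((Hist.toLp : Hist n (p + 1) g ≃ₗᵢ[ℝ] _) :
    Hist n (p + 1) g →L[ℝ] Lp (HomSob n (p + 1)) 2 (histMeasure g)).comp
  ((WithLp.sndL 2 ℝ (Sob n p) (Hist n (p + 1) g)).comp
    (WithLp.sndL 2 ℝ (WithLp 2 (HomSob n (p + 1) × Sob n (p + 1)))
      (WithLp 2 (Sob n p × Hist n (p + 1) g))))

theorem psiL_apply (Ψ : State n p g) : psiL Ψ = Ψ.psi := rfl

theorem vL_apply (Ψ : State n p g) : vL Ψ = Ψ.v := rfl

theorem etaL_apply (Ψ : State n p g) : etaL Ψ = Hist.toLp Ψ.eta := rfl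

theorem norm_sq (Ψ : State n p g) :
    ‖Ψ‖ ^ 2 = ‖psiL Ψ‖ ^ 2 + ‖vL Ψ‖ ^ 2 + (‖wL Ψ‖ ^ 2 + ‖etaL Ψ‖ ^ 2) := by
  have h1 := WithLp.prod_norm_sq_eq_of_L2 (α := WithLp 2 (HomSob n (p + 1) × Sob n (p + 1)))
    (β := WithLp 2 (Sob n p × Hist n (p + 1) g)) Ψ
  have h2 := WithLp.prod_norm_sq_eq_of_L2 (WithLp.ofLp Ψ).1
  have h3 := WithLp.prod_norm_sq_eq_of_L2 (WithLp.ofLp Ψ).2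
  exact h1.trans (congrArg₂ (· + ·) h2 h3)

end State

theorem completeSpace_state [CompleteSpace (HomSob n (p + 1))] : CompleteSpace (State n p g) := by
  have h1 : CompleteSpace (Hist n (p + 1) g) :=
    inferInstanceAs (CompleteSpace (Lp (HomSob n (p + 1)) 2 (histMeasure g)))
  exact inferInstanceAs (CompleteSpace
    (WithLp 2 (WithLp 2 (HomSob n (p + 1) × Sob n (p + 1)) × WithLp 2 (Sob n p × Hist n (p + 1) g))))

/-- Each ∂_α is bounded and commutes with the Bochner integral, and an element of the homogeneous
space is determined by its derivatives. -/
theorem isHistDeriv_iff [CompleteSpace (HomSob n (p + 1))] (hg : IsMemoryKernel c g)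
    {η ξ : Hist n (p + 1) g} : IsHistDeriv η ξ ↔ IsPrim (Hist.toLp η) (Hist.toLp ξ) := by
  have key : ∀ s, 0 < s ∧ deriv g s < 0 → ∀ α : HomWord n (p + 1),
      ∫ r in (0 : ℝ)..s, (ξ.rep r).d α = (∫ r in (0 : ℝ)..s, Hist.toLp ξ r).d α := fun s hs α =>
    (HomSob.dL α).intervalIntegral_comp_comm
      (intervalIntegrable_of_memLp hg (Lp.memLp (Hist.toLp ξ)) hs.1.le hs.2)
  constructor
  · intro h
    filter_upwards [h, ae_histMeasure_pos] with s hs hp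
    refine HomSob.ext_d fun α => ?_
    rw [← key s hp α, ← hs α, Hist.rep_eq]
  · intro h
    filter_upwards [h, ae_histMeasure_pos] with s hs hp α
    rw [key s hp α, ← hs, Hist.rep_eq]

theorem memInt_d [CompleteSpace (HomSob n (p + 1))] (hg : IsMemoryKernel c g)
    (η : Hist n (p + 1) g) (α : HomWord n (p + 1)) :
    ∫ s in Ioi (0 : ℝ), g s • (η.rep s).d α = (memInt hg (Hist.toLp η)).d α := by
  rw [memInt_apply, ← HomSob.dL_apply, ← (HomSob.dL α).integral_comp_comm
    (integrableOn_kernel_smul hg (Hist.toLp η))]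
  rfl

/-- The combination `v + (c_g²/b) ψ + (1/b) ∫₀^∞ g(s) η(s) ds`. -/
def effL (hn : 3 ≤ n) (hg : IsMemoryKernel c g) (b : ℝ) [CompleteSpace (HomSob n (p + 1))] :
    State n p g →L[ℝ] HomSob n (p + 1) :=
  (Sob.toHom hn p).comp State.vL + (cgSq c g / b) • State.psiL +
    (1 / b) • (memInt hg).comp State.etaL

theorem effL_apply (hn : 3 ≤ n) (hg : IsMemoryKernel c g) (b : ℝ)
    [CompleteSpace (HomSob n (p + 1))] (Ψ : State n p g) :
    effL hn hg b Ψ = Sob.toHom hn p (State.vL Ψ) + (cgSq c g / b) • State.psiL Ψ +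
      (1 / b) • memInt hg (State.etaL Ψ) := rfl

theorem flux_eq (hn : 3 ≤ n) (hg : IsMemoryKernel c g) {b : ℝ} (hb : b ≠ 0) (τ : ℝ)
    [CompleteSpace (HomSob n (p + 1))] (Ψ : State n p g) :
    flux τ b c g Ψ = fun j => ((b / τ) • effL hn hg b Ψ).d (HomWord.single p j) := by
  funext j
  rw [flux, memInt_d hg, ← HomSob.dL_apply _ ((b / τ) • _), effL_apply]
  simp only [map_add, map_smul, smul_add, smul_smul]
  rw [show b / τ * (cgSq c g / b) = cgSq c g / τ by field_simp,
    show b / τ * (1 / b) = 1 / τ by field_simp]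
  rw [add_comm ((cgSq c g / τ) • _)]
  rfl

/-- The map whose norm is the energy norm. -/
def energyL (hn : 3 ≤ n) (hg : IsMemoryKernel c g) (b σ : ℝ) [CompleteSpace (HomSob n (p + 1))] :
    State n p g →L[ℝ] WithLp 2 (HomSob n (p + 1) × WithLp 2 (HomSob n (p + 1) ×
      WithLp 2 (Sob n p × WithLp 2 (Lp (HomSob n (p + 1)) 2 (histMeasure g) × L2 n)))) :=
  pairL State.psiL (pairL (σ • effL hn hg b) (pairL State.wL
    (pairL State.etaL ((Sob.dL (Word.nil n (p + 1))).comp State.vL))))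

theorem inner_energyL (hn : 3 ≤ n) (hg : IsMemoryKernel c g) (b σ : ℝ)
    [CompleteSpace (HomSob n (p + 1))] (Ψ Φ : State n p g) :
    inner ℝ (energyL hn hg b σ Ψ) (energyL hn hg b σ Φ) =
      inner ℝ (State.psiL Ψ) (State.psiL Φ) +
      (σ ^ 2 * inner ℝ (effL hn hg b Ψ) (effL hn hg b Φ) +
      (inner ℝ (State.wL Ψ) (State.wL Φ) + (inner ℝ (State.etaL Ψ) (State.etaL Φ) +
        inner ℝ (State.vL Ψ).fn (State.vL Φ).fn))) := by
  rw [energyL, inner_pairL, inner_pairL, inner_pairL, inner_pairL]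
  congr 2
  rw [smul_apply, smul_apply, inner_smul_left, inner_smul_right,
    conj_trivial, ← mul_assoc, sq]

/-- The change of variables (ψ, v, η) ↦ (ψ, z, η) is triangular, so the gradient part of v is z
minus bounded functions of ψ and η. The separate L² term controls the rest of ‖v‖, which homogeneous
norms do not see. -/
theorem exists_norm_le_energyL (hn : 3 ≤ n) (hg : IsMemoryKernel c g) (b : ℝ) {σ : ℝ} (hσ : 0 < σ)
    [CompleteSpace (HomSob n (p + 1))] :
    ∃ K : ℝ≥0, ∀ Ψ : State n p g, ‖Ψ‖ ≤ K * ‖energyL hn hg b σ Ψ‖ := by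
  set M : ℝ := σ⁻¹ + ‖cgSq c g / b‖ + ‖1 / b‖ *
    ‖(memInt hg : Lp (HomSob n (p + 1)) 2 (histMeasure g) →L[ℝ] HomSob n (p + 1))‖
  have hM : 0 ≤ M := by positivity
  refine ⟨(1 + M).toNNReal, fun Ψ => ?_⟩
  rw [Real.coe_toNNReal _ (by positivity)]
  set N := ‖energyL hn hg b σ Ψ‖
  have hN : 0 ≤ N := norm_nonneg _
  have e := inner_energyL hn hg b σ Ψ Ψ
  simp only [real_inner_self_eq_norm_sq] at e
  change N ^ 2 = _ at e
  have hle : ∀ r : ℝ, r ^ 2 ≤ N ^ 2 → r ≤ N := fun r hr => le_of_sq_le_sq hr hN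
  have h1 : ‖State.psiL Ψ‖ ≤ N := by
    refine hle _ ?_
    rw [e]
    nlinarith [sq_nonneg (‖State.wL Ψ‖),
      sq_nonneg (‖State.etaL Ψ‖), sq_nonneg (‖(State.vL Ψ).fn‖), sq_nonneg (σ * ‖effL hn hg b Ψ‖)]
  have h2 : ‖State.etaL Ψ‖ ≤ N := by
    refine hle _ ?_
    rw [e]
    nlinarith [sq_nonneg (‖State.wL Ψ‖),
      sq_nonneg (‖State.psiL Ψ‖), sq_nonneg (‖(State.vL Ψ).fn‖), sq_nonneg (σ * ‖effL hn hg b Ψ‖)]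
  have h3 : σ * ‖effL hn hg b Ψ‖ ≤ N := by
    refine hle _ ?_
    rw [e]
    nlinarith [sq_nonneg (‖State.wL Ψ‖),
      sq_nonneg (‖State.psiL Ψ‖), sq_nonneg (‖(State.vL Ψ).fn‖), sq_nonneg (‖State.etaL Ψ‖)]
  have h4 : ‖effL hn hg b Ψ‖ ≤ σ⁻¹ * N := by
    rw [inv_mul_eq_div, le_div_iff₀' hσ]
    exact h3
  have h5 : ‖Sob.toHom hn p (State.vL Ψ)‖ ≤ M * N := by
    have e1 : Sob.toHom hn p (State.vL Ψ) = effL hn hg b Ψ - (cgSq c g / b) • State.psiL Ψ -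
        (1 / b) • memInt hg (State.etaL Ψ) := by
      rw [effL_apply]
      abel
    rw [e1]
    refine (norm_sub_le _ _).trans ((add_le_add (norm_sub_le _ _) le_rfl).trans ?_)
    rw [norm_smul, norm_smul]
    have h6 := (memInt hg : Lp (HomSob n (p + 1)) 2 (histMeasure g) →L[ℝ] _).le_opNorm (State.etaL Ψ)
    calc _ ≤ σ⁻¹ * N + ‖cgSq c g / b‖ * N + ‖1 / b‖ * (‖(memInt hg :
          Lp (HomSob n (p + 1)) 2 (histMeasure g) →L[ℝ] HomSob n (p + 1))‖ * N) := by
          gcongr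
          exact h6.trans (by gcongr)
      _ = M * N := by ring
  have h7 : ‖State.vL Ψ‖ ^ 2 = ‖(State.vL Ψ).fn‖ ^ 2 + ‖Sob.toHom hn p (State.vL Ψ)‖ ^ 2 := by
    have := Sob.inner_eq hn (State.vL Ψ) (State.vL Ψ)
    simpa only [real_inner_self_eq_norm_sq] using this
  refine le_of_sq_le_sq ?_ (by positivity)
  rw [State.norm_sq, h7]
  have h8 := pow_le_pow_left₀ (norm_nonneg _) h5 2
  have h9 : 0 ≤ σ ^ 2 * ‖effL hn hg b Ψ‖ ^ 2 := by positivity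
  have h10 : 0 ≤ M * N ^ 2 := by positivity
  nlinarith

end StateSpace

end MGT

end

noncomputable section

namespace MGT

/-! ## The operator -/

section Operator

variable {n p : ℕ} {τ b c : ℝ} {g : ℝ → ℝ} [CompleteSpace (HomSob n (p + 1))]

/-- The working form of the operator: representatives and existential witnesses are eliminated, and
the whole elliptic term is the Laplacian of (b/τ) z. -/
theorem isImageA_iff (hn : 3 ≤ n) (hg : IsMemoryKernel c g) (hb : b ≠ 0) {Ψ Φ : State n p g} :
    IsImageA τ b c g Ψ Φ ↔ State.psiL Φ = Sob.toHom hn p (State.vL Ψ) ∧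
      (State.vL Φ).fn = (State.wL Ψ).fn ∧
      IsWeakDiv (fun j => HomSob.dL (HomWord.single p j) ((b / τ) • effL hn hg b Ψ))
        (State.wL Φ + (1 / τ) • State.wL Ψ).fn ∧
      IsPrim (State.etaL Ψ) (histConst hg (Sob.toHom hn p (State.vL Ψ)) - State.etaL Φ) := by
  have e1 : (State.wL Φ + (1 / τ) • State.wL Ψ).fn = Φ.w.fn + (1 / τ) • Ψ.w.fn := rfl
  have e2 : flux τ b c g Ψ =
      fun j => HomSob.dL (HomWord.single p j) ((b / τ) • effL hn hg b Ψ) := flux_eq hn hg hb τ Ψ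
  rw [e1, ← e2]
  constructor
  · rintro ⟨h1, h2, ⟨f, hf, h3⟩, V, ξ, hV, hξ, h4⟩
    have hV' : V = Sob.toHom hn p Ψ.v := hV.ext (Ψ.v.isPotential_toHom hn)
    refine ⟨h1.ext (Ψ.v.isPotential_toHom hn), h2, ?_, ?_⟩
    · rw [h3, neg_add_eq_sub, sub_add_cancel]
      exact hf
    · have : histConst hg (Sob.toHom hn p (State.vL Ψ)) - State.etaL Φ = Hist.toLp ξ := by
        refine Lp.ext ?_
        filter_upwards [Lp.coeFn_sub (histConst hg (Sob.toHom hn p (State.vL Ψ))) (State.etaL Φ),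
          coeFn_histConst hg (Sob.toHom hn p (State.vL Ψ)), h4] with s h5 h6 h7
        rw [h5, Pi.sub_apply, h6, State.etaL_apply, ← Hist.rep_eq, ← Hist.rep_eq, h7, hV',
          State.vL_apply, sub_sub_cancel]
      rw [this]
      exact (isHistDeriv_iff hg).1 hξ
  · rintro ⟨h1, h2, h3, h4⟩
    refine ⟨?_, h2, ⟨_, h3, ?_⟩, Sob.toHom hn p Ψ.v,
      Hist.toLp.symm (histConst hg (Sob.toHom hn p (State.vL Ψ)) - State.etaL Φ),
      Ψ.v.isPotential_toHom hn, ?_, ?_⟩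
    · rw [← State.psiL_apply, h1]
      exact Ψ.v.isPotential_toHom hn
    · rw [neg_add_eq_sub, add_sub_cancel_right]
    · rw [isHistDeriv_iff hg, LinearIsometryEquiv.apply_symm_apply]
      exact h4
    · filter_upwards [Lp.coeFn_sub (histConst hg (Sob.toHom hn p (State.vL Ψ))) (State.etaL Φ),
        coeFn_histConst hg (Sob.toHom hn p (State.vL Ψ))] with s h5 h6
      rw [Hist.rep_eq, Hist.rep_eq, LinearIsometryEquiv.apply_symm_apply, h5, Pi.sub_apply, h6,
        State.vL_apply, State.etaL_apply, sub_sub_cancel]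

theorem isImageA_zero (hn : 3 ≤ n) (hg : IsMemoryKernel c g) (hb : b ≠ 0) :
    IsImageA τ b c g (0 : State n p g) 0 := by
  rw [isImageA_iff hn hg hb]
  simp only [map_zero, smul_zero, add_zero, sub_zero]
  exact ⟨trivial, rfl, isWeakDiv_zero, isPrim_zero hg⟩

theorem IsImageA.add (hn : 3 ≤ n) (hg : IsMemoryKernel c g) (hb : b ≠ 0)
    {Ψ Φ Ψ' Φ' : State n p g} (h : IsImageA τ b c g Ψ Φ) (h' : IsImageA τ b c g Ψ' Φ') :
    IsImageA τ b c g (Ψ + Ψ') (Φ + Φ') := by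
  rw [isImageA_iff hn hg hb] at h h' ⊢
  obtain ⟨h1, h2, h3, h4⟩ := h
  obtain ⟨h1', h2', h3', h4'⟩ := h'
  simp only [map_add, smul_add]
  refine ⟨by rw [h1, h1'], congrArg₂ (· + ·) h2 h2', ?_, ?_⟩
  · rw [add_add_add_comm]
    exact h3.add h3'
  · rw [add_sub_add_comm]
    exact h4.add hg h4'

theorem IsImageA.smul (hn : 3 ≤ n) (hg : IsMemoryKernel c g) (hb : b ≠ 0)
    {Ψ Φ : State n p g} (a : ℝ) (h : IsImageA τ b c g Ψ Φ) :
    IsImageA τ b c g (a • Ψ) (a • Φ) := by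
  rw [isImageA_iff hn hg hb] at h ⊢
  obtain ⟨h1, h2, h3, h4⟩ := h
  simp only [map_smul]
  rw [smul_comm (1 / τ) a, ← smul_add, ← smul_sub]
  refine ⟨by rw [h1], congrArg (a • ·) h2, ?_, h4.smul hg a⟩
  have h5 := h3.smul a
  convert! h5 using 1
  funext j
  simp only [map_smul, Pi.smul_apply]
  rw [smul_comm]

/-- The graph of the operator. -/
def graphA (τ : ℝ) (hn : 3 ≤ n) (hg : IsMemoryKernel c g) (hb : b ≠ 0) :
    Submodule ℝ (State n p g × State n p g) where
  carrier := {q | IsImageA τ b c g q.1 q.2}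
  zero_mem' := isImageA_zero hn hg hb
  add_mem' := fun h h' => IsImageA.add hn hg hb h h'
  smul_mem' := fun a _ h => IsImageA.smul hn hg hb a h

theorem IsImageA.eq_zero (hn : 3 ≤ n) (hg : IsMemoryKernel c g) (hb : b ≠ 0) {Φ : State n p g}
    (h : IsImageA τ b c g 0 Φ) : Φ = 0 := by
  rw [isImageA_iff hn hg hb] at h
  simp only [map_zero, smul_zero, add_zero, zero_sub] at h
  obtain ⟨h1, h2, h3, h4⟩ := h
  have h5 := IsPrim.eq_zero hg h4
  rw [neg_eq_zero] at h5
  exact State.ext' h1 (Sob.ext_fn h2) (Sob.ext_fn (h3.unique isWeakDiv_zero))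
    ((LinearIsometryEquiv.map_eq_zero_iff Hist.toLp).1 h5)

/-- The three domain conditions say that the second, third and fourth components of the image exist;
the first always exists by the Sobolev embedding of v. -/
theorem mem_domainA_iff (hn : 3 ≤ n) (hg : IsMemoryKernel c g) (hb : b ≠ 0) {Ψ : State n p g} :
    Ψ ∈ domainA τ b c g ↔ ∃ Φ, IsImageA τ b c g Ψ Φ := by
  constructor
  · rintro ⟨⟨w', hw⟩, ⟨f, hf⟩, ξ, hξ⟩
    refine ⟨State.mk (Sob.toHom hn p Ψ.v) w' (f - (1 / τ) • Ψ.w)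
      (Hist.toLp.symm (histConst hg (Sob.toHom hn p Ψ.v) - Hist.toLp ξ)),
      (isImageA_iff hn hg hb).2 ⟨rfl, hw, ?_, ?_⟩⟩
    · have e : (State.wL (State.mk (Sob.toHom hn p Ψ.v) w' (f - (1 / τ) • Ψ.w)
          (Hist.toLp.symm (histConst hg (Sob.toHom hn p Ψ.v) - Hist.toLp ξ))) +
          (1 / τ) • State.wL Ψ) = f := sub_add_cancel f ((1 / τ) • Ψ.w)
      rw [e]
      have h := hf
      rw [IsElliptic, flux_eq hn hg hb] at h
      exact h
    · have e : histConst hg (Sob.toHom hn p (State.vL Ψ)) -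
          State.etaL (State.mk (Sob.toHom hn p Ψ.v) w' (f - (1 / τ) • Ψ.w)
          (Hist.toLp.symm (histConst hg (Sob.toHom hn p Ψ.v) - Hist.toLp ξ))) = Hist.toLp ξ :=
        sub_sub_cancel (histConst hg (Sob.toHom hn p Ψ.v)) (Hist.toLp ξ)
      rw [e]
      exact (isHistDeriv_iff hg).1 hξ
  · rintro ⟨Φ, h⟩
    have h' := (isImageA_iff hn hg hb).1 h
    obtain ⟨-, h2, -, V, ξ, -, hξ, -⟩ := h
    refine ⟨⟨Φ.v, h2⟩, ⟨State.wL Φ + (1 / τ) • State.wL Ψ, ?_⟩, ξ, hξ⟩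
    rw [IsElliptic, flux_eq hn hg hb]
    exact h'.2.2.1

theorem inner_clm_le {H F : Type*} [NormedAddCommGroup H] [NormedSpace ℝ H] [NormedAddCommGroup F]
    [InnerProductSpace ℝ F] (L M : H →L[ℝ] F) (x : H) :
    inner ℝ (L x) (M x) ≤ ‖L‖ * ‖M‖ * ‖x‖ ^ 2 :=
  calc inner ℝ (L x) (M x) ≤ ‖L x‖ * ‖M x‖ := real_inner_le_norm _ _
    _ ≤ ‖L‖ * ‖x‖ * (‖M‖ * ‖x‖) := mul_le_mul (L.le_opNorm x) (M.le_opNorm x) (norm_nonneg _)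
        (by positivity)
    _ = ‖L‖ * ‖M‖ * ‖x‖ ^ 2 := by ring

/-- The bounded part of the time derivative of `effL`. -/
def restL (hn : 3 ≤ n) (hg : IsMemoryKernel c g) (b : ℝ) : State n p g →L[ℝ] HomSob n (p + 1) :=
  ((cgSq c g + ∫ s in Ioi (0 : ℝ), g s) / b) • (Sob.toHom hn p).comp State.vL -
    (1 / b) • (histInt hg).comp State.etaL

theorem restL_apply (hn : 3 ≤ n) (hg : IsMemoryKernel c g) (b : ℝ) (Ψ : State n p g) :
    restL hn hg b Ψ = ((cgSq c g + ∫ s in Ioi (0 : ℝ), g s) / b) • Sob.toHom hn p (State.vL Ψ) -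
      (1 / b) • histInt hg (State.etaL Ψ) := rfl

/-- The image of z is the second component of the image plus a bounded function of the state: the
memory integral of the fourth component is rewritten by `IsPrim.memInt_eq`. -/
theorem IsImageA.effL_eq (hn : 3 ≤ n) (hg : IsMemoryKernel c g) (hb : b ≠ 0) {Ψ Φ : State n p g}
    (h : IsImageA τ b c g Ψ Φ) :
    effL hn hg b Φ = Sob.toHom hn p (State.vL Φ) + restL hn hg b Ψ := by
  obtain ⟨h1, -, -, h4⟩ := (isImageA_iff hn hg hb).1 h
  have hm := IsPrim.memInt_eq hg h4
  rw [map_sub, memInt_histConst] at hm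
  rw [effL_apply, restL_apply, h1, ← hm]
  module

/-- The weight σ² = b/τ is the one for which the z-term cancels against Green's formula for the
w-term. The friction (1/τ) ‖w‖² and the transport term ⟨η_s, η⟩, both nonnegative, are dropped; only
bounded forms remain. -/
theorem IsImageA.inner_energyL_le (hn : 3 ≤ n) (hg : IsMemoryKernel c g) (hb : b ≠ 0) (hτ : 0 < τ)
    {σ : ℝ} (hσ : σ ^ 2 = b / τ) {Ψ Φ : State n p g} (h : IsImageA τ b c g Ψ Φ) :
    inner ℝ (energyL hn hg b σ Φ) (energyL hn hg b σ Ψ) ≤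
      inner ℝ (Sob.toHom hn p (State.vL Ψ)) (State.psiL Ψ) +
      b / τ * inner ℝ (restL hn hg b Ψ) (effL hn hg b Ψ) +
      inner ℝ (histConst hg (Sob.toHom hn p (State.vL Ψ))) (State.etaL Ψ) +
      inner ℝ (State.wL Ψ).fn (State.vL Ψ).fn := by
  have h0 := h.effL_eq hn hg hb
  obtain ⟨h1, h2, h3, h4⟩ := (isImageA_iff hn hg hb).1 h
  have e2 : inner ℝ (State.wL Ψ) (State.wL Φ + (1 / τ) • State.wL Ψ) =
      -inner ℝ (Sob.toHom hn p (State.vL Φ)) ((b / τ) • effL hn hg b Ψ) :=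
    inner_div_eq (z := (b / τ) • effL hn hg b Ψ) hn h2 h3
  rw [inner_add_right, inner_smul_right, inner_smul_right, real_inner_self_eq_norm_sq] at e2
  have e3 := IsPrim.inner_nonneg hg h4
  rw [inner_sub_left] at e3
  rw [inner_energyL, h1, h0, h2, inner_add_left, hσ, real_inner_comm (State.wL Ψ)]
  have b5 : 0 ≤ 1 / τ * ‖State.wL Ψ‖ ^ 2 := by positivity
  have e4 := eq_sub_of_add_eq e2
  rw [e4, mul_add]
  generalize inner ℝ (Sob.toHom hn p (State.vL Φ)) (effL hn hg b Ψ) = x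
  generalize inner ℝ (State.etaL Φ) (State.etaL Ψ) = y at e3 ⊢
  generalize inner ℝ (histConst hg (Sob.toHom hn p (State.vL Ψ))) (State.etaL Ψ) = z at e3 ⊢
  generalize 1 / τ * ‖State.wL Ψ‖ ^ 2 = u at b5 ⊢
  generalize inner ℝ (Sob.toHom hn p (State.vL Ψ)) (State.psiL Ψ) = q
  generalize inner ℝ (State.wL Ψ).fn (State.vL Ψ).fn = r
  clear e2 e4 h0 h1 h2 h3 h4 h
  linarith

theorem exists_inner_energyL_le (hn : 3 ≤ n) (hg : IsMemoryKernel c g) (hb : 0 < b) (hτ : 0 < τ)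
    {σ : ℝ} (hσ : σ ^ 2 = b / τ) : ∃ C, 0 ≤ C ∧ ∀ Ψ Φ : State n p g, IsImageA τ b c g Ψ Φ →
      inner ℝ (energyL hn hg b σ Φ) (energyL hn hg b σ Ψ) ≤ C * ‖Ψ‖ ^ 2 := by
  have hbτ : 0 ≤ b / τ := (div_pos hb hτ).le
  have key : ∀ {F : Type} [NormedAddCommGroup F] [InnerProductSpace ℝ F]
      (L M : State n p g →L[ℝ] F), ∃ C, 0 ≤ C ∧ ∀ x, inner ℝ (L x) (M x) ≤ C * ‖x‖ ^ 2 :=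
    fun L M => ⟨‖L‖ * ‖M‖, by positivity, inner_clm_le L M⟩
  obtain ⟨C1, hC1, k1⟩ := key ((Sob.toHom hn p).comp State.vL) State.psiL
  obtain ⟨C2, hC2, k2⟩ := key (restL hn hg b) (effL hn hg b)
  obtain ⟨C3, hC3, k3⟩ := key ((histConst hg).comp ((Sob.toHom hn p).comp State.vL)) State.etaL
  obtain ⟨C4, hC4, k4⟩ := key ((Sob.dL (Word.nil n p)).comp State.wL)
    ((Sob.dL (Word.nil n (p + 1))).comp State.vL)
  refine ⟨C1 + b / τ * C2 + C3 + C4, by positivity, fun Ψ Φ h => ?_⟩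
  refine (h.inner_energyL_le hn hg hb.ne' hτ hσ).trans ?_
  have b2 := mul_le_mul_of_nonneg_left (k2 Ψ) hbτ
  refine (add_le_add (add_le_add (add_le_add (k1 Ψ) b2) (k3 Ψ)) (k4 Ψ)).trans_eq ?_
  ring

/-- Everything is expressed through v: ψ = (v + F_ψ)/l, w = l v - F_v, and η is the exponential
convolution of v + F_η. Then z = κ v + Z with Z known, and the third equation becomes m l v - (m F_v
+ F_w) = D Δ(v + κ⁻¹ Z) with m = l + 1/τ and D = κ b/τ. Positivity of c_g² and a gives κ > 0. -/
theorem exists_resolvent (hn : 3 ≤ n) (hg : IsMemoryKernel c g) (hb : 0 < b) (hτ : 0 < τ) {l : ℝ}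
    (hl : 0 < l) (F : State n p g) :
    ∃ Ψ Φ : State n p g, IsImageA τ b c g Ψ Φ ∧ l • Ψ - Φ = F := by
  have hcg : 0 < cgSq c g := sub_pos.2 hg.integral_lt
  obtain ⟨a, ha, hav⟩ := exists_memInt_expConv_histConst (V := HomSob n (p + 1)) hg hl
  let R : Lp (HomSob n (p + 1)) 2 (histMeasure g) → Lp (HomSob n (p + 1)) 2 (histMeasure g) :=
    fun ζ => (memLp_expConv hg hl ζ).toLp _
  have hR : ∀ ζ, IsPrim (R ζ) (ζ - l • R ζ) := isPrim_expConv hg hl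
  set κ : ℝ := 1 + cgSq c g / b * l⁻¹ + 1 / b * a
  have hκ : 0 < κ := by positivity
  set D : ℝ := b / τ * κ
  have hD : 0 < D := by positivity
  set Z : HomSob n (p + 1) := (cgSq c g / b) • l⁻¹ • F.psi + (1 / b) • memInt hg (R (State.etaL F))
  set m : ℝ := l + 1 / τ
  have hm : 0 < m := by positivity
  obtain ⟨v, hv⟩ := exists_elliptic_solution (μ := D⁻¹ * (m * l)) (by positivity)
    (D⁻¹ • (m • F.v.lower + F.w)) fun j => κ⁻¹ • Z.pd j
  set V := Sob.toHom hn p v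
  set η := R (State.etaL F) + R (histConst hg V)
  set w : Sob n p := l • v.lower - F.v.lower
  let Ψ : State n p g := State.mk (l⁻¹ • (V + F.psi)) v w (Hist.toLp.symm η)
  let Φ : State n p g := State.mk V (l • v - F.v) (l • w - F.w)
    (Hist.toLp.symm (l • η - State.etaL F))
  have p1 : State.psiL Ψ = l⁻¹ • (V + F.psi) := rfl
  have p2 : State.vL Ψ = v := rfl
  have p3 : State.wL Ψ = w := rfl
  have p4 : State.etaL Ψ = η := rfl
  have q1 : State.psiL Φ = V := rfl
  have q2 : State.vL Φ = l • v - F.v := rfl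
  have q3 : State.wL Φ = l • w - F.w := rfl
  have q4 : State.etaL Φ = l • η - State.etaL F := rfl
  have heff : effL hn hg b Ψ = κ • V + Z := by
    rw [effL_apply, p1, p2, p4, map_add, hav]
    module
  refine ⟨Ψ, Φ, (isImageA_iff hn hg hb.ne').2 ⟨?_, ?_, ?_, ?_⟩, ?_⟩
  · rw [q1, p2]
  · rw [q2, p3]
    rfl
  · have h := hv.smul D
    rw [heff, q3, p3]
    convert! h using 1
    · funext j
      have e : (κ⁻¹ • Z.pd j).fn = κ⁻¹ • HomSob.dL (HomWord.single p j) Z := by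
        rw [HomSob.dL_apply, ← HomSob.pd_fn]
        rfl
      have e' : v.d (Word.single p j) = HomSob.dL (HomWord.single p j) V := rfl
      rw [Pi.smul_apply, e, e', map_smul, map_add, map_smul, smul_add, smul_add, smul_smul,
        smul_smul, mul_assoc (b / τ), mul_inv_cancel₀ hκ.ne', mul_one]
    · have e : (D⁻¹ • (m • F.v.lower + F.w)).fn = D⁻¹ • (m • F.v.fn + F.w.fn) := rfl
      have e' : (l • w - F.w + (1 / τ) • w).fn =
        l • (l • v.fn - F.v.fn) - F.w.fn + (1 / τ) • (l • v.fn - F.v.fn) := rfl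
      have hmd : m = l + 1 / τ := rfl
      rw [e, e', smul_sub D, smul_smul D, smul_inv_smul₀ hD.ne', mul_inv_cancel_left₀ hD.ne', hmd]
      module
  · rw [p4, p2, q4]
    have h := (hR (State.etaL F)).add hg (hR (histConst hg V))
    convert! h using 1
    module
  · refine State.ext' ?_ ?_ ?_ ?_
    · change l • l⁻¹ • (V + F.psi) - V = F.psi
      rw [smul_inv_smul₀ hl.ne', add_sub_cancel_left]
    · exact sub_sub_cancel (l • v) F.v
    · exact sub_sub_cancel (l • w) F.w
    · exact sub_sub_cancel (l • η) (State.etaL F)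

theorem exists_semigroup_A (hn : 3 ≤ n) (hg : IsMemoryKernel c g) (hb : 0 < b) (hτ : 0 < τ) :
    ∃ S : C0Semigroup (State n p g), S.IsGenerator (domainA τ b c g) (IsImageA τ b c g) := by
  have hs : 0 < b / τ := div_pos hb hτ
  have : CompleteSpace (State n p g) := completeSpace_state
  obtain ⟨K, hK⟩ := exists_norm_le_energyL (p := p) hn hg b (Real.sqrt_pos.2 hs)
  obtain ⟨C, hC, hdiss⟩ := exists_inner_energyL_le (p := p) hn hg hb hτ (Real.sq_sqrt hs.le)
  have hd : (domainA τ b c g : Set (State n p g)) =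
      {x | ∃ y, (x, y) ∈ graphA τ hn hg hb.ne'} := by
    ext Ψ
    exact mem_domainA_iff hn hg hb.ne'
  rw [hd]
  -- The dissipation bound is C ‖Ψ‖², and K converts the norm into the energy norm; hence γ = C K².
  refine exists_semigroup_of_form (energyL hn hg b √(b / τ))
    (AddMonoidHomClass.antilipschitz_of_bound _ hK) (graphA τ hn hg hb.ne') (γ := C * K ^ 2)
    (by positivity) (fun q hq => ?_) (fun l hl f => ?_) fun y hy => IsImageA.eq_zero hn hg hb.ne' hy
  · refine (hdiss _ _ hq).trans ?_
    rw [mul_assoc, ← mul_pow]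
    gcongr
    exact hK _
  · obtain ⟨Ψ, Φ, h, e⟩ := exists_resolvent hn hg hb hτ
      (lt_of_le_of_lt (by positivity : 0 ≤ C * (K : ℝ) ^ 2) hl) f
    exact ⟨(Ψ, Φ), h, e⟩

end Operator

end MGT

end

/-! ### The generation theorem -/

theorem mainTheorem3 (n m : ℕ) (hn : 3 ≤ n) (hm : 1 ≤ m) (τ b c : ℝ) (g : ℝ → ℝ)
    (hτ : 0 < τ) (hc : 0 < c) (hg : MGT.IsMemoryKernel c g)
    (hb : τ * c ^ 2 ≤ b) (hcg : τ * MGT.cgSq c g < τ * c ^ 2) :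
    CompleteSpace (MGT.State n (m - 1) g) ∧
      ∃ S : MGT.C0Semigroup (MGT.State n (m - 1) g),
        S.IsGenerator (MGT.domainA τ b c g) (MGT.IsImageA τ b c g) := by
  have := MGT.completeSpace_homSob hn (m - 1)
  exact ⟨MGT.completeSpace_state,
    MGT.exists_semigroup_A hn hg ((mul_pos hτ (pow_pos hc 2)).trans_le hb) hτ⟩
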